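/- Let $V$ be a complex vector space of dimension $N=2n+1$ with a non-degenerate quadratic form $Q$, and let $\langle\,,\rangle$ be the associated bilinear form. Let $G=SL(V)$, let $\theta$ be the involution of $G$ sending $g$ to the inverse of its adjoint with respect to $\langle\,,\rangle$, and let $K=SO(V,Q)=G^\theta$. Let $\mathfrak g_1$ be the $(-1)$-eigenspace of $d\theta$ on $\mathfrak{sl}(V)$, that is, the space of traceless endomorphisms self-adjoint with respect to $\langle\,,\rangle$, and let $\mathcal N_1$ be the variety of nilpotent elements of $\mathfrak g_1$. Let $B$ be a $\theta$-stable Borel subgroup of $G$ (the stabilizer of a complete flag of $V$), $\mathfrak n$ the Lie algebra of its unipotent radical, $B_K=B\cap K$ and $\mathfrak n_1=\mathfrak n\cap\mathfrak g_1$. Consider the map $$\pi: K\times^{B_K}\mathfrak n_1\to\mathcal N_1,\qquad (k,y)\mapsto \operatorname{Ad}_k y .$$ Then $\pi$ is semismall, i.e. for every $k\ge 0$ the set $\{x\in\mathcal N_1 : \dim\pi^{-1}(x)\ge k\}$ has codimension at least $2k$ in $\mathcal N_1$. More precisely, let $\lambda=(\lambda_1\ge\dots\ge\lambda_s\ge 0)$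 be a partition of $2n+1$, and let $x\in\mathcal N_1$ have Jordan blocks of sizes $\lambda_1,\dots,\lambda_s$, with $K$-orbit $\mathcal O_\lambda\subset\mathcal N_1$. Then $$2\dim\pi^{-1}(x)\le \operatorname{codim}_{\mathcal N_1}\mathcal O_\lambda=\dim\mathcal N_1-\dim\mathcal O_\lambda ,$$ and equality holds if and only if $\lambda=(2p_1+1,2p_2,2p_3,\dots,2p_s)$ for some integers $p_1\ge\dots\ge p_s\ge 0$ with $p_1+\dots+p_s=n$. -/

import Mathlib

open Module

noncomputable section

namespace SymResolution

/-! ### The Zariski topology of a complex vector space -/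

/-- The algebra of polynomial functions on a complex vector space: the algebra of functions
generated by the linear forms. -/
def polyFun (W : Type*) [AddCommGroup W] [Module ℂ W] : Subalgebra ℂ (W → ℂ) :=
  Algebra.adjoin ℂ {f : W → ℂ | ∃ φ : Dual ℂ W, f = fun w => φ w}

/-- The Zariski topology on (the closed points of) a finite-dimensional complex vector space: its
basic open sets are the non-vanishing loci of polynomial functions. -/
@[reducible]
def zariski (W : Type*) [AddCommGroup W] [Module ℂ W] : TopologicalSpace W :=
  TopologicalSpace.generateFrom {U : Set W | ∃ f ∈ polyFun W, U = {w | f w ≠ 0}}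

/-- A (proper) map `f : X → Y` of varieties is semismall when for every `k` the locus of those `y` whose
fibre has dimension at least `k` has codimension at least `2k` in `Y`. Dimensions are Krull
dimensions (the empty set has dimension `⊥`). -/
def IsSemismall {X Y : Type*} [TopologicalSpace X] [TopologicalSpace Y] (f : X → Y) : Prop :=
  ∀ k : ℕ, 2 * (k : WithBot ℕ∞) +
    topologicalKrullDim {y : Y | (k : WithBot ℕ∞) ≤ topologicalKrullDim (f ⁻¹' {y})} ≤
      topologicalKrullDim Y

variable {V : Type*} [AddCommGroup V] [Module ℂ V]

/-! ### The symmetric pair `(SL(V), SO(V, Q))` -/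

/-- The symmetric bilinear form of `Q`, normalised by `⟨v, v⟩ = Q v`. -/
abbrev form (Q : QuadraticForm ℂ V) : LinearMap.BilinForm ℂ V :=
  QuadraticMap.associated (R := ℂ) Q

/-- The contragredient homomorphism `g ↦ (gᵀ)⁻¹` from `SL(V)` to `SL(V*)`. -/
def contragredient [FiniteDimensional ℂ V] :
    SpecialLinearGroup ℂ V →* SpecialLinearGroup ℂ (Dual ℂ V) where
  toFun g := SpecialLinearGroup.dualMap g⁻¹
  map_one' := by
    ext φ v
    simp
  map_mul' g h := by
    ext φ v
    simp

/-- The involution `θ` of `SL(V)` attached to `Q`: `θ(g)` is the inverse of the adjoint of `g`, i.e.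
the contragredient of `g` transported from `V*` to `V` by the isomorphism `V ≃ V*` given by `Q`. -/
def theta [FiniteDimensional ℂ V] (Q : QuadraticForm ℂ V) (hQ : (form Q).Nondegenerate) :
    SpecialLinearGroup ℂ V →* SpecialLinearGroup ℂ V :=
  (SpecialLinearGroup.congr_linearEquiv
    (LinearMap.BilinForm.toDual (form Q) hQ).symm).toMonoidHom.comp contragredient

/-- The characterisation of `θ`: `⟨θ(g) v, g w⟩ = ⟨v, w⟩`. -/
theorem form_theta [FiniteDimensional ℂ V] (Q : QuadraticForm ℂ V)
    (hQ : (form Q).Nondegenerate) (g : SpecialLinearGroup ℂ V) (v w : V) :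
    form Q (theta Q hQ g v) (g w) = form Q v w := by
  have h : theta Q hQ g v = (LinearMap.BilinForm.toDual (form Q) hQ).symm
      (SpecialLinearGroup.dualMap g⁻¹ (LinearMap.BilinForm.toDual (form Q) hQ v)) := rfl
  rw [h, LinearMap.BilinForm.apply_toDual_symm_apply]
  change LinearMap.BilinForm.toDual (form Q) hQ v ((g : V ≃ₗ[ℂ] V).symm (g w)) = _
  rw [LinearEquiv.symm_apply_apply]
  rfl

/-- `K = SO(V, Q)`, as a subgroup of `SL(V)`. -/
def specialOrthogonal (Q : QuadraticForm ℂ V) : Subgroup (SpecialLinearGroup ℂ V) where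
  carrier := {g | ∀ v, Q (g v) = Q v}
  mul_mem' {g h} hg hh v := (hg (h v)).trans (hh v)
  one_mem' _ := rfl
  inv_mem' {g} hg v := by
    have h : Q (g ((g : V ≃ₗ[ℂ] V).symm v)) = Q ((g : V ≃ₗ[ℂ] V).symm v) := hg _
    exact h.symm.trans (congrArg Q ((g : V ≃ₗ[ℂ] V).apply_symm_apply v))

/-- The adjoint action `Ad_g y = g y g⁻¹` of `SL(V)` on `End(V)`. -/
def Ad (g : SpecialLinearGroup ℂ V) : End ℂ V ≃ₗ[ℂ] End ℂ V := (g : V ≃ₗ[ℂ] V).conj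

theorem Ad_apply (g : SpecialLinearGroup ℂ V) (y : End ℂ V) (v : V) :
    Ad g y v = g (y ((g : V ≃ₗ[ℂ] V).symm v)) := rfl

theorem Ad_mul (g h : SpecialLinearGroup ℂ V) (y : End ℂ V) : Ad (g * h) y = Ad g (Ad h y) := rfl

theorem Ad_one (y : End ℂ V) : Ad (1 : SpecialLinearGroup ℂ V) y = y := rfl

/-- `𝔤₁`, the `(-1)`-eigenspace of `dθ` on `𝔤 = 𝔰𝔩(V)`. As `dθ(y)` is minus the adjoint of `y`, it
consists of the traceless endomorphisms that are self-adjoint (symmetric) for the form of `Q`. -/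
def gOne (Q : QuadraticForm ℂ V) : Submodule ℂ (End ℂ V) where
  carrier := {y | LinearMap.trace ℂ V y = 0 ∧ ∀ v w, form Q (y v) w = form Q v (y w)}
  add_mem' {y z} hy hz := ⟨by simp [hy.1, hz.1], fun v w => by
    rw [LinearMap.add_apply, LinearMap.add_apply, map_add, map_add, LinearMap.add_apply,
      hy.2, hz.2]⟩
  zero_mem' := ⟨by simp, fun v w => by simp⟩
  smul_mem' c y hy := ⟨by simp [hy.1], fun v w => by
    rw [LinearMap.smul_apply, LinearMap.smul_apply, map_smul, map_smul, LinearMap.smul_apply,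
      hy.2]⟩

theorem form_isometry {Q : QuadraticForm ℂ V} {g : SpecialLinearGroup ℂ V}
    (hg : g ∈ specialOrthogonal Q) (v w : V) : form Q (g v) (g w) = form Q v w := by
  have h : ∀ v, Q (g v) = Q v := hg
  simp only [form, QuadraticMap.associated_apply]
  rw [← map_add (g : V ≃ₗ[ℂ] V), h, h, h]

theorem Ad_mem_gOne {Q : QuadraticForm ℂ V} {g : SpecialLinearGroup ℂ V}
    (hg : g ∈ specialOrthogonal Q) {y : End ℂ V} (hy : y ∈ gOne Q) : Ad g y ∈ gOne Q := by
  refine ⟨(LinearMap.trace_conj' y (g : V ≃ₗ[ℂ] V)).trans hy.1, fun v w => ?_⟩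
  obtain ⟨v, rfl⟩ := (g : V ≃ₗ[ℂ] V).surjective v
  obtain ⟨w, rfl⟩ := (g : V ≃ₗ[ℂ] V).surjective w
  rw [Ad_apply, Ad_apply, LinearEquiv.symm_apply_apply, LinearEquiv.symm_apply_apply,
    form_isometry hg, form_isometry hg, hy.2]

/-! ### The nilpotent cone, its orbits, and Jordan types -/

/-- The nilpotent cone `𝒩₁ = 𝒩 ∩ 𝔤₁`. -/
def NilCone (Q : QuadraticForm ℂ V) : Type _ := {x : End ℂ V // x ∈ gOne Q ∧ IsNilpotent x}

instance (Q : QuadraticForm ℂ V) : TopologicalSpace (NilCone Q) :=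
  TopologicalSpace.induced Subtype.val (zariski (End ℂ V))

/-- The orbit of `x ∈ 𝒩₁` under the adjoint action of `K`. -/
def orbit {Q : QuadraticForm ℂ V} (x : NilCone Q) : Set (NilCone Q) :=
  {y | ∃ g ∈ specialOrthogonal Q, y.1 = Ad g x.1}

/-- The Jordan blocks of the nilpotent endomorphism `x` have sizes `lam 0, lam 1, …` (a size `0`
stands for an absent block): `V` has a basis made of strings `b i 0 ↦ b i 1 ↦ ⋯ ↦ 0` of these
lengths. -/
def HasJordanType (x : End ℂ V) {s : ℕ} (lam : Fin s → ℕ) : Prop :=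
  ∃ b : Basis (Σ i : Fin s, Fin (lam i)) ℂ V, ∀ (i : Fin s) (j : Fin (lam i)),
    x (b ⟨i, j⟩) = if h : (j : ℕ) + 1 < lam i then b ⟨i, ⟨j + 1, h⟩⟩ else 0

/-! ### Borel subgroups and the resolution -/

variable (V) in
/-- A complete flag `0 = V_0 ⊂ V_1 ⊂ ⋯ ⊂ V_N = V` with `dim V_i = i`, extended by `V_i = V` for
`i ≥ N = dim V`. -/
structure CompleteFlag where
  /-- The members of the flag. -/
  sub : ℕ → Submodule ℂ V
  mono : Monotone sub
  finrank_sub : ∀ i, finrank ℂ (sub i) = min i (finrank ℂ V)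

/-- The Borel subgroup of `SL(V)` attached to a complete flag, namely its stabilizer. -/
def CompleteFlag.borel (F : CompleteFlag V) : Subgroup (SpecialLinearGroup ℂ V) where
  carrier := {g | ∀ i, (F.sub i).map (g : V →ₗ[ℂ] V) = F.sub i}
  mul_mem' {g h} hg hh i := by
    have := Submodule.map_comp (h : V →ₗ[ℂ] V) (g : V →ₗ[ℂ] V) (F.sub i)
    rw [hh i, hg i] at this
    exact this
  one_mem' i := Submodule.map_id _
  inv_mem' {g} hg i := by
    have := Submodule.map_comp (g : V →ₗ[ℂ] V) ((g : V ≃ₗ[ℂ] V).symm : V →ₗ[ℂ] V) (F.sub i)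
    rw [hg i, LinearEquiv.comp_coe, LinearEquiv.self_trans_symm] at this
    exact this.symm.trans (Submodule.map_id _)

/-- The Lie algebra `𝔫` of the unipotent radical of the Borel subgroup of a flag: the endomorphisms
that map each `V_{i+1}` into `V_i`. -/
def CompleteFlag.nilradical (F : CompleteFlag V) : Submodule ℂ (End ℂ V) where
  carrier := {y | ∀ i, ∀ v ∈ F.sub (i + 1), y v ∈ F.sub i}
  add_mem' hy hz i v hv := (F.sub i).add_mem (hy i v hv) (hz i v hv)
  zero_mem' i _ _ := (F.sub i).zero_mem
  smul_mem' c _ hy i v hv := (F.sub i).smul_mem c (hy i v hv)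

/-- `𝔫₁ = 𝔫 ∩ 𝔤₁`. -/
def nOne (Q : QuadraticForm ℂ V) (F : CompleteFlag V) : Submodule ℂ (End ℂ V) :=
  F.nilradical ⊓ gOne Q

theorem isNilpotent_of_mem_nilradical [FiniteDimensional ℂ V] (F : CompleteFlag V)
    {y : End ℂ V} (hy : y ∈ F.nilradical) : IsNilpotent y := by
  have key : ∀ i, ∀ v ∈ F.sub i, (y ^ i) v = 0 := by
    intro i
    induction i with
    | zero =>
      intro v hv
      have h0 : F.sub 0 = ⊥ := Submodule.finrank_eq_zero.1 (by simp [F.finrank_sub])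
      rw [h0, Submodule.mem_bot] at hv
      simp [hv]
    | succ i ih =>
      intro v hv
      rw [pow_succ, Module.End.mul_apply]
      exact ih _ (hy i v hv)
  have htop : F.sub (finrank ℂ V) = ⊤ :=
    Submodule.eq_top_of_finrank_eq (by simp [F.finrank_sub])
  exact ⟨finrank ℂ V, LinearMap.ext fun v => key _ v (htop ▸ Submodule.mem_top)⟩

/-- The variety `K × 𝔫₁`. -/
def PreResolution (Q : QuadraticForm ℂ V) (F : CompleteFlag V) : Type _ :=
  specialOrthogonal Q × nOne Q F

/-- The Zariski topology of `K × 𝔫₁`, a closed subvariety of the vector space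
`End(V) × End(V)`. -/
instance (Q : QuadraticForm ℂ V) (F : CompleteFlag V) : TopologicalSpace (PreResolution Q F) :=
  TopologicalSpace.induced
    (fun p : PreResolution Q F => (((p.1.1 : V ≃ₗ[ℂ] V) : V →ₗ[ℂ] V), p.2.1))
    (zariski (End ℂ V × End ℂ V))

/-- The equivalence relation on `K × 𝔫₁` whose classes are the orbits of `B_K = B ∩ K`:
`(k, Ad_b y) ∼ (k b, y)` for `b ∈ B_K`. -/
def resolutionSetoid (Q : QuadraticForm ℂ V) (F : CompleteFlag V) :
    Setoid (PreResolution Q F) where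
  r p q := ∃ b ∈ F.borel ⊓ specialOrthogonal Q, q.1.1 = p.1.1 * b ∧ p.2.1 = Ad b q.2.1
  iseqv :=
    { refl := fun p => ⟨1, one_mem _, (mul_one _).symm, (Ad_one _).symm⟩
      symm := by
        rintro p q ⟨b, hb, h1, h2⟩
        refine ⟨b⁻¹, inv_mem hb, by rw [h1, mul_inv_cancel_right], ?_⟩
        rw [h2, ← Ad_mul, inv_mul_cancel, Ad_one]
      trans := by
        rintro p q r ⟨b, hb, h1, h2⟩ ⟨c, hc, h3, h4⟩
        exact ⟨b * c, mul_mem hb hc, by rw [h3, h1, mul_assoc], by rw [h2, h4, Ad_mul]⟩ }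

/-- The variety `K ×^{B_K} 𝔫₁`, the quotient of `K × 𝔫₁` by the free action of `B_K`. -/
def Resolution (Q : QuadraticForm ℂ V) (F : CompleteFlag V) : Type _ :=
  Quotient (resolutionSetoid Q F)

/-- `K × 𝔫₁ → K ×^{B_K} 𝔫₁` is a principal `B_K`-bundle, so that the Zariski topology of its target
is the quotient topology. -/
instance (Q : QuadraticForm ℂ V) (F : CompleteFlag V) : TopologicalSpace (Resolution Q F) :=
  TopologicalSpace.coinduced (Quotient.mk (resolutionSetoid Q F)) inferInstance

/-- The map `π : K ×^{B_K} 𝔫₁ → 𝒩₁`, `(k, y) ↦ Ad_k y`. -/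
def resolution [FiniteDimensional ℂ V] (Q : QuadraticForm ℂ V) (F : CompleteFlag V) :
    Resolution Q F → NilCone Q :=
  Quotient.lift
    (fun p : PreResolution Q F => (⟨Ad p.1.1 p.2.1, Ad_mem_gOne p.1.2 p.2.2.2, by
      obtain ⟨m, hm⟩ := isNilpotent_of_mem_nilradical F p.2.2.1
      refine ⟨m, ?_⟩
      have h : ∀ k : ℕ, Ad p.1.1 p.2.1 ^ k = Ad p.1.1 (p.2.1 ^ k) := by
        intro k
        induction k with
        | zero =>
          ext v
          simp [Ad_apply]
        | succ k ih =>
          ext v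
          rw [pow_succ, Module.End.mul_apply, ih, Ad_apply, Ad_apply, Ad_apply,
            LinearEquiv.symm_apply_apply, pow_succ, Module.End.mul_apply]
      rw [h, hm, map_zero]⟩ : NilCone Q))
    (by
      rintro p q ⟨b, hb, h1, h2⟩
      apply Subtype.ext
      change Ad p.1.1 p.2.1 = Ad q.1.1 q.2.1
      rw [h1, h2, Ad_mul])

end SymResolution

end

open SymResolution

/-!
# The resolution of the nilpotent cone of the symmetric pair `(SL(2n+1), SO(2n+1))` is semismall

Write `r_j` for the number of Jordan blocks of `x` of size more than `j` (`blockCount`).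

*Codimension of orbits.* The Cayley transform identifies the dimension of the stabilizer of `x` in `K`
with that of its Lie algebra, the skew-adjoint centralizer `skewCent` of `x`. For the trace form, the
commutators with `x` from skew-adjoint to self-adjoint endomorphisms and back are transposes of each
other up to sign; comparing `x` with a regular nilpotent element, whose stabilizer is finite, the
dimension of the skew-adjoint centralizer is `½ ∑ r_j (r_j - 1)` (`two_mul_finrank_skewCent`). Elements
of `𝒩₁` of the same Jordan type are conjugate under `K` (`exists_specialIsom_conj`), so there are
finitely many orbits, the regular one has dimension `dim K = dim 𝒩₁`, and the number above is the
codimension of the orbit of `x`.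

*Dimension of fibres.* The fibre over `x` is the quotient by `B_K` of the set of all `k ∈ K` such that
`Ad_{k⁻¹} x` lies in `𝔫₁`. A `θ`-stable flag is determined by its isotropic half, and by Witt's theorem
that set is fibred over the set of *frames* of `x` (`IsFrame`): the bases of totally isotropic flags of
length `n` moved down by `x`. The group `B_K` is fibred in the same way over the bases adapted to the
given flag. Hence the dimension of the fibre is that of the set of frames minus `n (n + 1) / 2`
(`topologicalKrullDim_fibre`).

*Frames.* The first vector `v` of a frame is an isotropic vector of `ker x`. Fixing it, the remaining
ones amount to a frame of the endomorphism induced on `⟨v, w⟩^⊥`, for a hyperbolic pair `(v, w)`,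
together with arbitrary components along `v`. If `v = x ^ m u` with `m` maximal, the induced
endomorphism is obtained by shortening a block of size `m + 1` by two when `⟨u, v⟩ ≠ 0`, and two such
blocks by one otherwise; vectors of the second kind form a quadric of dimension at most `r_m - 1` in the
space `ker x ⊓ range (x ^ m)` of dimension `r_m`. By induction on `n`,
`4 dim (frames) ≤ 2 n (n + 1) + ∑ r_j (r_j - 1)`; only vectors of the first kind with `r_m = r_{m-1}`
preserve equality, which therefore means that the `r_j` agree in pairs except for one pair `(1, 0)`
(`IsPaired`), that is, that the partition is `(2p₁ + 1, 2p₂, …)` (`isPaired_iff`).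

Dimensions are computed by means of algebraically independent polynomial functions (`DimGE`, `DimLE`);
these behave well in fibrations (`IsPolyImage.dimLE`, `DimGE.of_fibres`), and they are compared with
Krull dimensions of subspaces, of images and of quotients at the end (`topologicalKrullDim_le_of_dimLE`,
`le_topologicalKrullDim_of_isPolyImage`, `IsQuotientBy`).
-/

open Topology

noncomputable section

namespace SymResolution

/-! ### Polynomial functions and polynomial maps -/

section Zariski

variable {W W₁ W₂ W₃ : Type*} [AddCommGroup W] [Module ℂ W] [AddCommGroup W₁] [Module ℂ W₁]
  [AddCommGroup W₂] [Module ℂ W₂] [AddCommGroup W₃] [Module ℂ W₃]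

theorem dual_mem_polyFun (φ : Dual ℂ W) : (fun w => φ w) ∈ polyFun W :=
  Algebra.subset_adjoin ⟨φ, rfl⟩

theorem const_mem_polyFun (c : ℂ) : (fun _ : W => c) ∈ polyFun W :=
  (polyFun W).algebraMap_mem c

/-- Polynomial maps between vector spaces: the linear forms of the target pull back to polynomial
functions. -/
def IsPolyMap (f : W → W₂) : Prop := ∀ φ : Dual ℂ W₂, (fun w => φ (f w)) ∈ polyFun W

theorem IsPolyMap.comp_mem {f : W → W₂} (hf : IsPolyMap f) {g : W₂ → ℂ} (hg : g ∈ polyFun W₂) :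
    (fun w => g (f w)) ∈ polyFun W := by
  induction hg using Algebra.adjoin_induction with
  | mem x hx => obtain ⟨φ, rfl⟩ := hx; exact hf φ
  | algebraMap r => exact const_mem_polyFun r
  | add x y _ _ hx hy => exact add_mem hx hy
  | mul x y _ _ hx hy => exact mul_mem hx hy

theorem IsPolyMap.comp {g : W₂ → W₃} {f : W → W₂} (hg : IsPolyMap g) (hf : IsPolyMap f) :
    IsPolyMap (fun w => g (f w)) := fun φ => hf.comp_mem (hg φ)

theorem isPolyMap_linear (f : W →ₗ[ℂ] W₂) : IsPolyMap f :=
  fun φ => dual_mem_polyFun (φ.comp f)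

theorem isPolyMap_id : IsPolyMap (fun w : W => w) := fun φ => dual_mem_polyFun φ

theorem isPolyMap_const (c : W₂) : IsPolyMap (fun _ : W => c) := fun φ => const_mem_polyFun (φ c)

theorem IsPolyMap.add {f g : W → W₂} (hf : IsPolyMap f) (hg : IsPolyMap g) :
    IsPolyMap (fun w => f w + g w) := fun φ => by
  simp only [map_add]; exact add_mem (hf φ) (hg φ)

theorem IsPolyMap.sub {f g : W → W₂} (hf : IsPolyMap f) (hg : IsPolyMap g) :
    IsPolyMap (fun w => f w - g w) := fun φ => by
  simp only [map_sub]; exact sub_mem (hf φ) (hg φ)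

theorem IsPolyMap.sum {ι : Type*} (s : Finset ι) {f : ι → W → W₂} (hf : ∀ i, IsPolyMap (f i)) :
    IsPolyMap (fun w => ∑ i ∈ s, f i w) := fun φ => by
  simp only [map_sum]
  have : (fun w => ∑ i ∈ s, φ (f i w)) = ∑ i ∈ s, fun w => φ (f i w) := by
    ext w; simp
  rw [this]
  exact sum_mem fun i _ => hf i φ

theorem IsPolyMap.smul {c : W → ℂ} {f : W → W₂} (hc : c ∈ polyFun W) (hf : IsPolyMap f) :
    IsPolyMap (fun w => c w • f w) := fun φ => by
  simp only [map_smul]; exact mul_mem hc (hf φ)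

theorem IsPolyMap.linear {f : W → W₂} (hf : IsPolyMap f) (l : W₂ →ₗ[ℂ] W₃) :
    IsPolyMap (fun w => l (f w)) := fun φ => hf (φ.comp l)

theorem isPolyMap_of_mem {c : W → ℂ} (hc : c ∈ polyFun W) : IsPolyMap c := fun φ => by
  have : (fun w => φ (c w)) = fun w => c w * φ 1 := by
    ext w
    conv_lhs => rw [← mul_one (c w), ← smul_eq_mul, map_smul, smul_eq_mul]
  rw [this]
  exact mul_mem hc (const_mem_polyFun _)

theorem IsPolyMap.mem {c : W → ℂ} (hc : IsPolyMap c) : c ∈ polyFun W := hc LinearMap.id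

theorem IsPolyMap.prodMk {f : W → W₂} {g : W → W₃} (hf : IsPolyMap f) (hg : IsPolyMap g) :
    IsPolyMap (fun w => (f w, g w)) := fun φ => by
  have : (fun w => φ (f w, g w)) =
      fun w => (φ.comp (LinearMap.inl ℂ W₂ W₃)) (f w) + (φ.comp (LinearMap.inr ℂ W₂ W₃)) (g w) := by
    ext w; simp [← map_add]
  rw [this]
  exact add_mem (hf _) (hg _)

theorem IsPolyMap.pi {ι : Type*} [Finite ι] {f : ι → W → W₂} (hf : ∀ i, IsPolyMap (f i)) :
    IsPolyMap (fun w i => f i w) := fun φ => by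
  classical
  cases nonempty_fintype ι
  have : (fun w => φ (fun i => f i w)) =
      ∑ i, fun w => (φ.comp (LinearMap.single ℂ (fun _ : ι => W₂) i)) (f i w) := by
    ext w
    rw [Finset.sum_apply]
    simp only [LinearMap.comp_apply, LinearMap.coe_single]
    rw [← map_sum, Finset.univ_sum_single (fun i => f i w)]
  rw [this]
  exact sum_mem fun i _ => hf i _

theorem IsPolyMap.apply {ι : Type*} {f : W → ι → W₂} (hf : IsPolyMap f) (i : ι) :
    IsPolyMap (fun w => f w i) := hf.linear (LinearMap.proj i)

theorem IsPolyMap.fst {f : W → W₂ × W₃} (hf : IsPolyMap f) : IsPolyMap (fun w => (f w).1) :=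
  hf.linear (LinearMap.fst ℂ W₂ W₃)

theorem IsPolyMap.snd {f : W → W₂ × W₃} (hf : IsPolyMap f) : IsPolyMap (fun w => (f w).2) :=
  hf.linear (LinearMap.snd ℂ W₂ W₃)

theorem IsPolyMap.bilin [FiniteDimensional ℂ W₁] (B : W₁ →ₗ[ℂ] W₂ →ₗ[ℂ] W₃) {f : W → W₁}
    {g : W → W₂} (hf : IsPolyMap f) (hg : IsPolyMap g) : IsPolyMap (fun w => B (f w) (g w)) := by
  let b := finBasis ℂ W₁
  have : (fun w => B (f w) (g w)) = fun w => ∑ i, b.coord i (f w) • B (b i) (g w) := by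
    ext w
    conv_lhs => rw [← b.sum_repr (f w)]
    simp only [map_sum, map_smul, LinearMap.sum_apply, LinearMap.smul_apply, Basis.coord_apply]
  rw [this]
  exact IsPolyMap.sum _ fun i => IsPolyMap.smul (hf _) (hg.linear _)

/-- Evaluation at a point, as a homomorphism from the algebra of polynomial functions. -/
def evalPoly (w : W) : polyFun W →ₐ[ℂ] ℂ := (Pi.evalAlgHom ℂ (fun _ : W => ℂ) w).comp (polyFun W).val

@[simp] theorem evalPoly_apply (w : W) (f : polyFun W) : evalPoly w f = f.1 w := rfl

/-- The point of the prime spectrum of the polynomial functions attached to a vector. -/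
def toSpec (w : W) : PrimeSpectrum (polyFun W) :=
  ⟨RingHom.ker (evalPoly w), RingHom.ker_isPrime _⟩

/-- The Zariski topology is induced from the prime spectrum of the algebra of polynomial functions; in
particular it is Noetherian. -/
theorem isInducing_toSpec : @Topology.IsInducing W _ (zariski W) _ (toSpec : W → _) := by
  let _ := zariski W
  constructor
  rw [PrimeSpectrum.isTopologicalBasis_basic_opens.eq_generateFrom, induced_generateFrom_eq]
  refine congrArg TopologicalSpace.generateFrom (Set.ext fun U => ⟨?_, ?_⟩)
  · rintro ⟨f, hf, rfl⟩
    refine ⟨_, ⟨⟨f, hf⟩, rfl⟩, ?_⟩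
    ext w
    simp [toSpec, RingHom.mem_ker]
  · rintro ⟨_, ⟨f, rfl⟩, rfl⟩
    refine ⟨f.1, f.2, ?_⟩
    ext w
    simp [toSpec, RingHom.mem_ker]

theorem isClosed_zariski_iff {S : Set W} : IsClosed[zariski W] S ↔
    ∀ w, (∀ f ∈ polyFun W, (∀ v ∈ S, f v = 0) → f w = 0) → w ∈ S := by
  let _ := zariski W
  rw [isInducing_toSpec.isClosed_iff]
  constructor
  · rintro ⟨T, hT, rfl⟩ w hw
    obtain ⟨s, rfl⟩ := (PrimeSpectrum.isClosed_iff_zeroLocus T).1 hT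
    rw [Set.mem_preimage, PrimeSpectrum.mem_zeroLocus]
    intro f hf
    refine hw f.1 f.2 fun v hv => ?_
    exact hv hf
  · intro h
    refine ⟨PrimeSpectrum.zeroLocus {f | ∀ v ∈ S, f.1 v = 0}, PrimeSpectrum.isClosed_zeroLocus _, ?_⟩
    ext w
    rw [Set.mem_preimage, PrimeSpectrum.mem_zeroLocus]
    constructor
    · exact fun hw => h w fun f hf hfS => hw (show (⟨f, hf⟩ : polyFun W) ∈ _ from hfS)
    · exact fun hw f hf => hf w hw

theorem mem_zariski_closure_iff {S : Set W} {w : W} : w ∈ @closure W (zariski W) S ↔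
    ∀ f ∈ polyFun W, (∀ v ∈ S, f v = 0) → f w = 0 := by
  let _ := zariski W
  constructor
  · intro hw f hf hfS
    have hcl : IsClosed {v | f v = 0} := isClosed_zariski_iff.2 fun w hw => hw f hf fun v hv => hv
    exact hcl.closure_subset_iff.2 hfS hw
  · intro h
    exact (isClosed_zariski_iff.1 (isClosed_closure (s := S))) w fun f hf hfS =>
      h f hf fun v hv => hfS v (subset_closure hv)

theorem isClosed_zeros {f : W → ℂ} (hf : f ∈ polyFun W) : IsClosed[zariski W] {w | f w = 0} :=
  isClosed_zariski_iff.2 fun _ hw => hw f hf fun _ hv => hv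

theorem IsPolyMap.continuous {f : W → W₂} (hf : IsPolyMap f) :
    @Continuous _ _ (zariski W) (zariski W₂) f := by
  let _ := zariski W
  let _ := zariski W₂
  refine continuous_iff_isClosed.2 fun S hS => isClosed_zariski_iff.2 fun w hw => ?_
  refine isClosed_zariski_iff.1 hS _ fun g hg hgS => ?_
  exact hw _ (hf.comp_mem hg) fun v hv => hgS _ hv

theorem isClosed_eq_of_isPolyMap {f g : W → W₂} (hf : IsPolyMap f) (hg : IsPolyMap g) :
    IsClosed[zariski W] {w | f w = g w} := by
  refine isClosed_zariski_iff.2 fun w hw => ?_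
  rw [Set.mem_ofPred_eq, ← sub_eq_zero, ← Module.forall_dual_apply_eq_zero_iff ℂ]
  intro φ
  refine hw (fun w => φ (f w - g w)) ((hf.sub hg) φ) fun v hv => ?_
  rw [show f v = g v from hv, sub_self, map_zero]

theorem exists_polyFun_eq_adjoin [FiniteDimensional ℂ W] :
    polyFun W = Algebra.adjoin ℂ
      (Set.range fun i => fun w : W => (finBasis ℂ W).coord i w) := by
  apply le_antisymm
  · refine Algebra.adjoin_le ?_
    rintro _ ⟨φ, rfl⟩
    have : (fun w : W => φ w) = ∑ i, φ (finBasis ℂ W i) • fun w => (finBasis ℂ W).coord i w := by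
      ext w
      conv_lhs => rw [← (finBasis ℂ W).sum_repr w]
      simp only [map_sum, map_smul, Finset.sum_apply, Pi.smul_apply, smul_eq_mul,
        Basis.coord_apply, mul_comm]
    rw [this]
    exact Subalgebra.sum_mem _ fun i _ => Subalgebra.smul_mem _ (Algebra.subset_adjoin (Set.mem_range_self i)) _
  · refine Algebra.adjoin_le ?_
    rintro _ ⟨i, rfl⟩
    exact dual_mem_polyFun ((finBasis ℂ W).coord i)

instance polyFun_finiteType [FiniteDimensional ℂ W] : Algebra.FiniteType ℂ (polyFun W) := by
  rw [exists_polyFun_eq_adjoin]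
  exact (Subalgebra.fg_iff_finiteType _).1
    (Subalgebra.fg_def.2 ⟨_, Set.finite_range _, rfl⟩)

theorem noetherianSpace_zariski [FiniteDimensional ℂ W] :
    @TopologicalSpace.NoetherianSpace W (zariski W) := by
  let _ := zariski W
  have : IsNoetherianRing (polyFun W) := Algebra.FiniteType.isNoetherianRing ℂ _
  exact isInducing_toSpec.noetherianSpace

end Zariski

/-! ### Dimension by algebraically independent functions -/

section Dimension

variable {W W₁ W₂ W₃ : Type*} [AddCommGroup W] [Module ℂ W] [AddCommGroup W₁] [Module ℂ W₁]
  [AddCommGroup W₂] [Module ℂ W₂] [AddCommGroup W₃] [Module ℂ W₃]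

/-- A family of functions satisfies no polynomial relation on the set `S`. -/
def IndepOnSet {ι : Type*} (S : Set W) (f : ι → W → ℂ) : Prop :=
  ∀ P : MvPolynomial ι ℂ, (∀ w ∈ S, MvPolynomial.eval (fun i => f i w) P = 0) → P = 0

/-- The Zariski closure of `S` has dimension at least `d`: there are `d` polynomial functions which
are algebraically independent on `S`. -/
def DimGE (S : Set W) (d : ℕ) : Prop :=
  ∃ f : Fin d → W → ℂ, (∀ i, f i ∈ polyFun W) ∧ IndepOnSet S f

/-- The Zariski closure of `S` has dimension at most `d`; this includes the empty set. -/
def DimLE (S : Set W) (d : ℕ) : Prop := ∀ e, DimGE S e → e ≤ d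

theorem algHom_aeval {A : Type*} [CommRing A] [Algebra ℂ A] {ι : Type*} (χ : A →ₐ[ℂ] ℂ) (f : ι → A)
    (P : MvPolynomial ι ℂ) :
    χ (MvPolynomial.aeval f P) = MvPolynomial.eval (fun i => χ (f i)) P := by
  induction P using MvPolynomial.induction_on with
  | C a => simp
  | add p q hp hq => simp [hp, hq]
  | mul_X p i hp => simp [hp]

theorem eval_mem_polyFun {ι : Type*} {f : ι → W → ℂ} (hf : ∀ i, f i ∈ polyFun W)
    (P : MvPolynomial ι ℂ) : (fun w => MvPolynomial.eval (fun i => f i w) P) ∈ polyFun W := by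
  induction P using MvPolynomial.induction_on with
  | C a => simpa using const_mem_polyFun a
  | add p q hp hq => simp only [map_add]; exact add_mem hp hq
  | mul_X p i hp => simp only [map_mul, MvPolynomial.eval_X]; exact mul_mem hp (hf i)

variable {S T : Set W} {d e : ℕ}

omit [AddCommGroup W] [Module ℂ W] in
theorem IndepOnSet.mono {ι : Type*} {f : ι → W → ℂ} (h : IndepOnSet S f) (hST : S ⊆ T) :
    IndepOnSet T f := fun P hP => h P fun w hw => hP w (hST hw)

omit [AddCommGroup W] [Module ℂ W] in
theorem IndepOnSet.comp {ι κ : Type*} {f : ι → W → ℂ} (h : IndepOnSet S f) {g : κ → ι}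
    (hg : Function.Injective g) : IndepOnSet S (fun k => f (g k)) := fun P hP => by
  refine MvPolynomial.rename_injective g hg ?_
  rw [map_zero]
  refine h _ fun w hw => ?_
  rw [MvPolynomial.eval_rename]
  exact hP w hw

theorem DimGE.of_indep {ι : Type*} [Fintype ι] {f : ι → W → ℂ} (hf : ∀ i, f i ∈ polyFun W)
    (h : IndepOnSet S f) (hd : d ≤ Fintype.card ι) : DimGE S d :=
  ⟨fun i => f ((Fintype.equivFin ι).symm (Fin.castLE hd i)), fun _ => hf _,
    h.comp ((Equiv.injective _).comp (Fin.castLE_injective hd))⟩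

theorem DimGE.mono (h : DimGE S d) (hST : S ⊆ T) : DimGE T d :=
  let ⟨f, hf, hfS⟩ := h
  ⟨f, hf, hfS.mono hST⟩

theorem DimGE.le (h : DimGE S d) (hed : e ≤ d) : DimGE S e :=
  let ⟨_, hf, hfS⟩ := h
  .of_indep hf hfS (by simpa using hed)

theorem DimLE.mono (h : DimLE T d) (hST : S ⊆ T) : DimLE S d := fun e he => h e (he.mono hST)

theorem DimLE.le (h : DimLE S d) (hde : d ≤ e) : DimLE S e := fun k hk => (h k hk).trans hde

theorem DimGE.of_closure (h : DimGE (@closure W (zariski W) S) d) : DimGE S d := by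
  obtain ⟨f, hf, hfS⟩ := h
  refine ⟨f, hf, fun P hP => hfS P fun w hw => ?_⟩
  exact mem_zariski_closure_iff.1 hw _ (eval_mem_polyFun hf P) hP

/-- A polynomial map does not raise the dimension: functions pull back. -/
theorem DimGE.of_image {p : W → W₂} (hp : IsPolyMap p) (h : DimGE (p '' S) d) : DimGE S d := by
  obtain ⟨f, hf, hfS⟩ := h
  refine ⟨fun i w => f i (p w), fun i => hp.comp_mem (hf i), fun P hP => hfS P ?_⟩
  rintro _ ⟨w, hw, rfl⟩
  exact hP w hw

theorem DimLE.image {p : W → W₂} (hp : IsPolyMap p) (h : DimLE S d) : DimLE (p '' S) d :=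
  fun e he => h e (he.of_image hp)

/-- A polynomial map with a polynomial left inverse preserves dimension. -/
theorem DimGE.image_of_leftInv {p : W → W₂} {q : W₂ → W} (hq : IsPolyMap q)
    (hqp : ∀ w ∈ S, q (p w) = w) (h : DimGE S d) : DimGE (p '' S) d := by
  refine DimGE.of_image hq (h.mono fun w hw => ?_)
  exact ⟨p w, ⟨w, hw, rfl⟩, hqp w hw⟩

theorem DimGE.nonempty (h : DimGE S d) : S.Nonempty := by
  obtain ⟨f, -, hfS⟩ := h
  by_contra hS
  rw [Set.not_nonempty_iff_eq_empty] at hS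
  exact one_ne_zero (hfS 1 (by simp [hS]))

theorem dimGE_zero (h : S.Nonempty) : DimGE S 0 := by
  obtain ⟨w, hw⟩ := h
  refine ⟨fun i => i.elim0, fun i => i.elim0, fun P hP => ?_⟩
  obtain ⟨c, rfl⟩ := MvPolynomial.C_surjective _ P
  simpa using hP w hw

/-- If both families of `d` functions satisfied a relation, so would the product of the relations on
the union; hence one of the two sets has dimension at least `d`. -/
theorem DimGE.union (h : DimGE (S ∪ T) d) : DimGE S d ∨ DimGE T d := by
  obtain ⟨f, hf, hfST⟩ := h
  by_contra hcon
  rw [not_or] at hcon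
  obtain ⟨h1, h2⟩ := hcon
  have h1 : ¬ IndepOnSet S f := fun h => h1 ⟨f, hf, h⟩
  have h2 : ¬ IndepOnSet T f := fun h => h2 ⟨f, hf, h⟩
  unfold IndepOnSet at h1 h2
  push Not at h1 h2
  obtain ⟨P, hP, hP0⟩ := h1
  obtain ⟨R, hR, hR0⟩ := h2
  refine mul_ne_zero hP0 hR0 (hfST _ fun w hw => ?_)
  rw [map_mul]
  rcases hw with hw | hw
  · rw [hP w hw, zero_mul]
  · rw [hR w hw, mul_zero]

theorem DimGE.exists_of_biUnion {ι : Type*} {s : Set ι} (hs : s.Finite) {A : ι → Set W}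
    (h : DimGE (⋃ i ∈ s, A i) d) : ∃ i ∈ s, DimGE (A i) d := by
  induction s, hs using Set.Finite.induction_on with
  | empty => exact absurd h.nonempty (by simp)
  | insert _ _ ih =>
    rw [Set.biUnion_insert] at h
    rcases h.union with h | h
    · exact ⟨_, Set.mem_insert _ _, h⟩
    · obtain ⟨i, hi, h⟩ := ih h
      exact ⟨i, Set.mem_insert_of_mem _ hi, h⟩

theorem DimLE.biUnion {ι : Type*} {s : Set ι} (hs : s.Finite) {A : ι → Set W}
    (h : ∀ i ∈ s, DimLE (A i) d) : DimLE (⋃ i ∈ s, A i) d := fun e he =>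
  let ⟨i, hi, hA⟩ := he.exists_of_biUnion hs
  h i hi e hA

theorem dimLE_empty : DimLE (∅ : Set W) d := fun _ he => absurd he.nonempty (by simp)

/-- Independent polynomial functions are algebraically independent elements of a polynomial ring in
`finrank ℂ W` variables. -/
theorem dimLE_finrank [FiniteDimensional ℂ W] : DimLE S (finrank ℂ W) := by
  rintro e ⟨f, hf, hfS⟩
  have hind : AlgebraicIndependent ℂ (fun i => (⟨f i, hf i⟩ : polyFun W)) := by
    rw [algebraicIndependent_iff]
    intro P hP
    refine hfS P fun w _ => ?_
    have := congrArg (evalPoly w) hP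
    rw [algHom_aeval, map_zero] at this
    exact this
  have hsurj : Function.Surjective
      ((MvPolynomial.aeval (fun i => (⟨(fun w : W => (finBasis ℂ W).coord i w),
        dual_mem_polyFun ((finBasis ℂ W).coord i)⟩ : polyFun W)) :
        MvPolynomial (Fin (finrank ℂ W)) ℂ →ₐ[ℂ] polyFun W)) := by
    rintro ⟨g, hg⟩
    have hg' := hg
    rw [exists_polyFun_eq_adjoin, Algebra.adjoin_range_eq_range_aeval] at hg'
    obtain ⟨P, hP⟩ := hg'
    refine ⟨P, Subtype.ext (funext fun w => ?_)⟩
    have h1 := algHom_aeval (evalPoly w) (fun i => (⟨(fun w : W => (finBasis ℂ W).coord i w),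
        dual_mem_polyFun ((finBasis ℂ W).coord i)⟩ : polyFun W)) P
    have h2 := algHom_aeval (Pi.evalAlgHom ℂ (fun _ : W => ℂ) w)
      (fun i => fun w : W => (finBasis ℂ W).coord i w) P
    exact h1.trans (h2.symm.trans (congrFun hP w))
  have h1 := lift_trdeg_le_of_surjective _ hsurj
  have h2 := hind.lift_cardinalMk_le_trdeg
  rw [MvPolynomial.trdeg_of_isDomain] at h1
  have h3 := h2.trans (show _ ≤ ((finrank ℂ W : ℕ) : Cardinal) by
    simpa [-Module.finrank_eq_rank] using h1)
  rw [Cardinal.mk_fin, Cardinal.lift_natCast] at h3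
  exact Nat.cast_le.1 h3

theorem dimLE_range_linearMap [FiniteDimensional ℂ W] (l : W →ₗ[ℂ] W₂) :
    DimLE (Set.range l) (finrank ℂ W) := by
  rw [← Set.image_univ]
  exact dimLE_finrank.image (isPolyMap_linear l)

theorem dimLE_submodule (U : Submodule ℂ W) [FiniteDimensional ℂ U] :
    DimLE (U : Set W) (finrank ℂ U) := by
  have := dimLE_range_linearMap U.subtype
  simpa using this

theorem indepOnSet_coord [FiniteDimensional ℂ W] {h : W → ℂ} (hh : h ∈ polyFun W) {w₀ : W}
    (hw₀ : h w₀ ≠ 0) : IndepOnSet {w | h w ≠ 0} (fun i w => (finBasis ℂ W).coord i w) := by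
  intro P hP
  rw [exists_polyFun_eq_adjoin, Algebra.adjoin_range_eq_range_aeval] at hh
  obtain ⟨R, rfl⟩ := hh
  have hR : ∀ w, MvPolynomial.aeval (fun i => fun w : W => (finBasis ℂ W).coord i w) R w =
      MvPolynomial.eval (fun i => (finBasis ℂ W).coord i w) R := by
    intro w
    exact algHom_aeval (Pi.evalAlgHom ℂ (fun _ : W => ℂ) w) _ R
  have hRP : R * P = 0 := by
    refine MvPolynomial.funext fun t => ?_
    let w := (finBasis ℂ W).equivFun.symm t
    have hw : (fun i => (finBasis ℂ W).coord i w) = t := by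
      ext i
      exact congrFun ((finBasis ℂ W).equivFun.apply_symm_apply t) i
    rw [map_mul, map_zero, ← hw]
    by_cases h0 : MvPolynomial.aeval (fun i => fun w : W => (finBasis ℂ W).coord i w) R w = 0
    · rw [← hR, h0, zero_mul]
    · rw [hP w h0, mul_zero]
  rcases mul_eq_zero.1 hRP with h | h
  · simp [h] at hw₀
  · exact h

theorem dimGE_open [FiniteDimensional ℂ W] {h : W → ℂ} (hh : h ∈ polyFun W) {w₀ : W}
    (hw₀ : h w₀ ≠ 0) : DimGE {w | h w ≠ 0} (finrank ℂ W) :=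
  ⟨_, fun i => dual_mem_polyFun ((finBasis ℂ W).coord i), indepOnSet_coord hh hw₀⟩

/-- A non-empty principal open subset of a subspace has the dimension of the subspace. -/
theorem dimGE_submodule_open [FiniteDimensional ℂ W] (U : Submodule ℂ W) {h : W → ℂ}
    (hh : h ∈ polyFun W) {w₀ : W} (hw₀ : w₀ ∈ U) (hw₀' : h w₀ ≠ 0) :
    DimGE {w | w ∈ U ∧ h w ≠ 0} (finrank ℂ U) := by
  have h1 : DimGE {u : U | h u ≠ 0} (finrank ℂ U) :=
    dimGE_open ((isPolyMap_linear U.subtype).comp_mem hh) (w₀ := ⟨w₀, hw₀⟩) hw₀'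
  obtain ⟨q, hq⟩ := U.subtype.exists_leftInverse_of_injective U.ker_subtype
  refine (h1.image_of_leftInv (p := U.subtype) (isPolyMap_linear q)
    fun w _ => LinearMap.congr_fun hq w).mono ?_
  rintro _ ⟨u, hu, rfl⟩
  exact ⟨u.2, hu⟩

/-! ### Irreducible sets and transcendence bases -/

/-- Irreducible sets are those whose ideals are prime. -/
theorem isIrreducible_zariski_mul {X : Set W} (hX : @IsIrreducible W (zariski W) X) {f g : W → ℂ}
    (hf : f ∈ polyFun W) (hg : g ∈ polyFun W) (h : ∀ w ∈ X, f w * g w = 0) :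
    (∀ w ∈ X, f w = 0) ∨ (∀ w ∈ X, g w = 0) := by
  let _ := zariski W
  refine (isPreirreducible_iff_isClosed_union_isClosed.1 hX.isPreirreducible) _ _
    (isClosed_zeros hf) (isClosed_zeros hg) fun w hw => ?_
  exact mul_eq_zero.1 (h w hw)

/-- Restriction of functions to a subset. -/
def restr (X : Set W) : (W → ℂ) →ₐ[ℂ] (X → ℂ) where
  toFun f x := f x
  map_one' := rfl
  map_mul' _ _ := rfl
  map_zero' := rfl
  map_add' _ _ := rfl
  commutes' _ := rfl

/-- The algebra of functions on `X` which are restrictions of polynomial functions. -/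
def coordRing (X : Set W) : Subalgebra ℂ (X → ℂ) := (polyFun W).map (restr X)

/-- Restriction of polynomial functions to `X`. -/
def toCoord (X : Set W) : polyFun W →ₐ[ℂ] coordRing X where
  toFun f := ⟨restr X f, f.1, f.2, rfl⟩
  map_one' := rfl
  map_mul' _ _ := rfl
  map_zero' := rfl
  map_add' _ _ := rfl
  commutes' _ := rfl

theorem toCoord_surjective (X : Set W) : Function.Surjective (toCoord X) := by
  rintro ⟨_, f, hf, rfl⟩
  exact ⟨⟨f, hf⟩, rfl⟩

/-- Evaluation at a point of `X`. -/
def coordEval {X : Set W} (x : X) : coordRing X →ₐ[ℂ] ℂ :=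
  (Pi.evalAlgHom ℂ (fun _ : X => ℂ) x).comp (coordRing X).val

theorem coordRing_ext {X : Set W} {a b : coordRing X} (h : ∀ x, coordEval x a = coordEval x b) :
    a = b := Subtype.ext (funext h)

@[simp] theorem coordEval_toCoord {X : Set W} (x : X) (f : polyFun W) :
    coordEval x (toCoord X f) = f.1 x := rfl

theorem coordEval_aeval {X : Set W} (x : X) {ι : Type*} {f : ι → W → ℂ}
    (hf : ∀ i, f i ∈ polyFun W) (P : MvPolynomial ι ℂ) :
    coordEval x (MvPolynomial.aeval (fun i => toCoord X ⟨f i, hf i⟩) P) =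
      MvPolynomial.eval (fun i => f i x) P := algHom_aeval _ _ _

/-- Independence on `X` is algebraic independence in the coordinate algebra of `X`. -/
theorem indepOnSet_iff {X : Set W} {ι : Type*} {f : ι → W → ℂ} (hf : ∀ i, f i ∈ polyFun W) :
    IndepOnSet X f ↔ AlgebraicIndependent ℂ (fun i => toCoord X ⟨f i, hf i⟩) := by
  rw [algebraicIndependent_iff]
  refine forall_congr' fun P => imp_congr_left ?_
  constructor
  · intro h
    refine coordRing_ext fun x => ?_
    rw [coordEval_aeval, map_zero]
    exact h x x.2
  · intro h w hw
    have := coordEval_aeval ⟨w, hw⟩ hf P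
    rw [h, map_zero] at this
    exact this.symm

theorem isDomain_coordRing {X : Set W} (hX : @IsIrreducible W (zariski W) X) :
    IsDomain (coordRing X) := by
  obtain ⟨x, hx⟩ := hX.1
  have : Nontrivial (coordRing X) :=
    ⟨0, 1, fun h => by simpa using congrArg (coordEval ⟨x, hx⟩) h⟩
  have : NoZeroDivisors (coordRing X) := by
    refine ⟨fun {a b} hab => ?_⟩
    obtain ⟨f, rfl⟩ := toCoord_surjective X a
    obtain ⟨g, rfl⟩ := toCoord_surjective X b
    rcases isIrreducible_zariski_mul hX f.2 g.2 fun w hw => by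
      simpa using congrArg (coordEval ⟨w, hw⟩) hab with h | h
    · exact Or.inl (coordRing_ext fun x => by simpa using h x x.2)
    · exact Or.inr (coordRing_ext fun x => by simpa using h x x.2)
  exact NoZeroDivisors.to_isDomain _

/-- A non-zero element algebraic over a subalgebra divides a non-zero element of it: the constant
term of a relation of minimal degree. -/
theorem exists_aeval_eq_mul_of_isAlgebraic {A : Type*} [CommRing A] [IsDomain A] [Algebra ℂ A]
    {ι : Type*} (x : ι → A) {g : A} (hg : g ≠ 0)
    (halg : IsAlgebraic (Algebra.adjoin ℂ (Set.range x)) g) :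
    ∃ P : MvPolynomial ι ℂ, MvPolynomial.aeval x P ≠ 0 ∧
      ∃ c, MvPolynomial.aeval x P = g * c := by
  obtain ⟨q, hq0, hq⟩ :=
    halg.exists_nonzero_coeff_and_aeval_eq_zero (mem_nonZeroDivisors_of_ne_zero hg)
  obtain ⟨P, hP⟩ := (Algebra.adjoin_range_eq_range_aeval ℂ x).le (q.coeff 0).2
  have hP : MvPolynomial.aeval x P = (q.coeff 0 : A) := hP
  refine ⟨P, ?_, -Polynomial.aeval g q.divX, ?_⟩
  · rw [hP]
    exact fun h => hq0 (Subtype.ext h)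
  · rw [← q.divX_mul_X_add, map_add, map_mul, Polynomial.aeval_X, Polynomial.aeval_C] at hq
    rw [hP, mul_neg, mul_comm]
    exact eq_neg_of_add_eq_zero_right hq

/-- Dimension increases strictly along inclusions into irreducible sets. -/
theorem DimGE.succ_of_irreducible {X Z : Set W} (hX : @IsIrreducible W (zariski W) X) (hZX : Z ⊆ X)
    {g : W → ℂ} (hg : g ∈ polyFun W) (hgZ : ∀ z ∈ Z, g z = 0) (hgX : ∃ x ∈ X, g x ≠ 0)
    (h : DimGE Z d) : DimGE X (d + 1) := by
  obtain ⟨f, hf, hfZ⟩ := h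
  have := isDomain_coordRing hX
  have hfX := (indepOnSet_iff hf).1 (hfZ.mono hZX)
  let g' : coordRing X := toCoord X ⟨g, hg⟩
  have hg' : g' ≠ 0 := by
    obtain ⟨x, hx, hgx⟩ := hgX
    intro h0
    exact hgx (by simpa [g'] using congrArg (coordEval ⟨x, hx⟩) h0)
  have htr : Transcendental (Algebra.adjoin ℂ (Set.range fun i => toCoord X ⟨f i, hf i⟩)) g' := by
    intro halg
    obtain ⟨P, hP0, c, hPc⟩ := exists_aeval_eq_mul_of_isAlgebraic _ hg' halg
    refine hP0 ?_
    have : P = 0 := by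
      refine hfZ P fun z hz => ?_
      have h3 : coordEval (⟨z, hZX hz⟩ : X) g' = 0 := hgZ z hz
      rw [← coordEval_aeval ⟨z, hZX hz⟩ hf, hPc, map_mul, h3, zero_mul]
    rw [this, map_zero]
  have hopt := (hfX.option_iff_transcendental g').2 htr
  let f' : Option (Fin d) → W → ℂ := fun o => o.elim g f
  have hf' : ∀ o, f' o ∈ polyFun W := by
    rintro (_ | i)
    · exact hg
    · exact hf i
  refine DimGE.of_indep (f := f') hf' ((indepOnSet_iff hf').2 ?_) (by simp)
  convert hopt using 2 with o
  cases o <;> rfl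

end Dimension

/-! ### Characters of coordinate algebras and dominant maps -/

section Fibres

variable {W W₁ W₂ W₃ : Type*} [AddCommGroup W] [Module ℂ W] [AddCommGroup W₁] [Module ℂ W₁]
  [AddCommGroup W₂] [Module ℂ W₂] [AddCommGroup W₃] [Module ℂ W₃]
variable {S T : Set W} {d e : ℕ}

/-- A closed set is a finite union of irreducible closed sets; one of them carries a given lower
bound on the dimension of a polynomial image. -/
theorem DimGE.exists_irreducible [FiniteDimensional ℂ W] {X : Set W} (hX : IsClosed[zariski W] X)
    {p : W → W₁} (h : DimGE (p '' X) d) :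
    ∃ C ⊆ X, IsClosed[zariski W] C ∧ @IsIrreducible W (zariski W) C ∧ DimGE (p '' C) d := by
  let _ := zariski W
  have := noetherianSpace_zariski (W := W)
  obtain ⟨s, hs, hcl, hirr, rfl⟩ :=
    TopologicalSpace.NoetherianSpace.exists_finite_set_isClosed_irreducible hX
  rw [Set.image_sUnion, Set.sUnion_image] at h
  obtain ⟨C, hC, hd⟩ := h.exists_of_biUnion hs
  exact ⟨C, Set.subset_sUnion_of_mem hC, hcl C hC, hirr C hC, hd⟩

/-- Every character of the coordinate algebra of a closed set is the evaluation at a point. -/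
theorem exists_eq_coordEval [FiniteDimensional ℂ W] {X : Set W} (hX : IsClosed[zariski W] X)
    (χ : coordRing X →ₐ[ℂ] ℂ) : ∃ x : X, χ = coordEval x := by
  -- the values of the character on linear forms define the point `w`
  let χ' : polyFun W →ₐ[ℂ] ℂ := χ.comp (toCoord X)
  let l : Dual ℂ (Dual ℂ W) :=
    { toFun := fun φ => χ' ⟨_, dual_mem_polyFun φ⟩
      map_add' := fun φ ψ => by
        rw [← map_add]; rfl
      map_smul' := fun c φ => by
        rw [RingHom.id_apply, ← map_smul]; rfl }
  obtain ⟨w, hw⟩ := (evalEquiv ℂ W).surjective l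
  have hφ : ∀ φ : Dual ℂ W, χ' ⟨_, dual_mem_polyFun φ⟩ = φ w := fun φ => by
    change l φ = φ w
    rw [← hw]; rfl
  have hχ : ∀ f : polyFun W, χ' f = f.1 w := by
    rintro ⟨f, hf⟩
    induction hf using Algebra.adjoin_induction with
    | mem x hx => obtain ⟨φ, rfl⟩ := hx; exact hφ φ
    | algebraMap r => exact χ'.commutes r
    | add x y hx hy h1 h2 =>
      refine (map_add χ' ⟨x, hx⟩ ⟨y, hy⟩).trans ?_
      rw [h1, h2]; rfl
    | mul x y hx hy h1 h2 =>
      refine (map_mul χ' ⟨x, hx⟩ ⟨y, hy⟩).trans ?_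
      rw [h1, h2]; rfl
  have hwX : w ∈ X := by
    refine isClosed_zariski_iff.1 hX w fun f hf hfX => ?_
    refine (hχ ⟨f, hf⟩).symm.trans ?_
    have : toCoord X ⟨f, hf⟩ = 0 := coordRing_ext fun x => by
      rw [map_zero]; exact hfX x x.2
    change χ (toCoord X ⟨f, hf⟩) = 0
    rw [this, map_zero]
  refine ⟨⟨w, hwX⟩, AlgHom.ext fun a => ?_⟩
  obtain ⟨f, rfl⟩ := toCoord_surjective X a
  exact hχ f

instance [FiniteDimensional ℂ W] (X : Set W) : Algebra.FiniteType ℂ (coordRing X) :=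
  Algebra.FiniteType.of_surjective (toCoord X) (toCoord_surjective X)

/-- A point of the spectrum of an algebra of finite type over `ℂ` lying over the maximal ideal of
`t` produces a character with values `t`. -/
theorem exists_algHom_of_le {B : Type*} [CommRing B] [Algebra ℂ B] [Algebra.FiniteType ℂ B]
    {ι : Type*} (b : ι → B) (t : ι → ℂ) (P : Ideal B) [P.IsPrime]
    (hP : ∀ i, b i - algebraMap ℂ B (t i) ∈ P) : ∃ χ : B →ₐ[ℂ] ℂ, ∀ i, χ (b i) = t i := by
  obtain ⟨M, hM, hPM⟩ := P.exists_le_maximal (Ideal.IsPrime.ne_top inferInstance)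
  let _ := Ideal.Quotient.field M
  have hfin : Module.Finite ℂ (B ⧸ M) := finite_of_finite_type_of_isJacobsonRing ℂ (B ⧸ M)
  have : Algebra.IsIntegral ℂ (B ⧸ M) := inferInstance
  let e : ℂ ≃ₐ[ℂ] (B ⧸ M) := AlgEquiv.ofBijective (Algebra.ofId ℂ (B ⧸ M))
    (IsAlgClosed.algebraMap_bijective_of_isIntegral (k := ℂ) (K := B ⧸ M))
  refine ⟨(e.symm : (B ⧸ M) →ₐ[ℂ] ℂ).comp (Ideal.Quotient.mkₐ ℂ M), fun i => ?_⟩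
  have h1 : Ideal.Quotient.mkₐ ℂ M (b i) = algebraMap ℂ (B ⧸ M) (t i) :=
    Ideal.Quotient.eq.2 (hPM (hP i))
  change e.symm (Ideal.Quotient.mkₐ ℂ M (b i)) = t i
  rw [h1, AlgEquiv.commutes]
  rfl

/-- A dominant morphism from an irreducible closed set to an affine space hits a non-empty principal
open set: a form of Chevalley's theorem. -/
theorem exists_principalOpen_subset_image [FiniteDimensional ℂ W] {X : Set W}
    (hX : IsClosed[zariski W] X) (hirr : @IsIrreducible W (zariski W) X) {ι : Type*} [Finite ι]
    {f : ι → W → ℂ} (hf : ∀ i, f i ∈ polyFun W) (hind : IndepOnSet X f) :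
    ∃ h : MvPolynomial ι ℂ, h ≠ 0 ∧
      ∀ t : ι → ℂ, MvPolynomial.eval t h ≠ 0 → ∃ x ∈ X, ∀ i, f i x = t i := by
  have := isDomain_coordRing hirr
  -- the image on spectra is constructible and contains the generic point
  let φ : MvPolynomial ι ℂ →ₐ[ℂ] coordRing X :=
    MvPolynomial.aeval (fun i => toCoord X ⟨f i, hf i⟩)
  have hφ : Function.Injective φ := (indepOnSet_iff hf).1 hind
  have hft : φ.toRingHom.FinitePresentation := by
    refine RingHom.FinitePresentation.of_finiteType.1 ?_
    exact RingHom.FiniteType.of_comp_finiteType (f := algebraMap ℂ (MvPolynomial ι ℂ)) (by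
      have h1 : φ.toRingHom.comp (algebraMap ℂ (MvPolynomial ι ℂ)) =
        algebraMap ℂ (coordRing X) := φ.comp_algebraMap
      rw [h1]
      exact RingHom.finiteType_algebraMap.2 inferInstance)
  obtain ⟨Dat, hD⟩ := PrimeSpectrum.exists_constructibleSetData_iff.2
    (PrimeSpectrum.isConstructible_range_comap hft)
  have hbot : (⊥ : PrimeSpectrum (MvPolynomial ι ℂ)) ∈
      Set.range (PrimeSpectrum.comap φ.toRingHom) := by
    refine ⟨⊥, PrimeSpectrum.ext ?_⟩
    exact (RingHom.injective_iff_ker_eq_bot φ.toRingHom).1 hφ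
  rw [← hD] at hbot
  obtain ⟨C, hC, hbot⟩ := Set.mem_iUnion₂.1 hbot
  obtain ⟨hg, hne⟩ := hbot
  refine ⟨C.f, fun h0 => hne ?_, fun t ht => ?_⟩
  · rw [PrimeSpectrum.mem_zeroLocus, h0]
    simp
  · have hg0 : ∀ i, C.g i = 0 := fun i => by
      have := hg (Set.mem_range_self i)
      simpa using this
    let m : PrimeSpectrum (MvPolynomial ι ℂ) :=
      ⟨RingHom.ker (MvPolynomial.eval t), RingHom.ker_isPrime _⟩
    have hm : m ∈ Set.range (PrimeSpectrum.comap φ.toRingHom) := by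
      rw [← hD]
      refine Set.mem_iUnion₂.2 ⟨C, hC, ?_, ?_⟩
      · rw [PrimeSpectrum.mem_zeroLocus]
        rintro _ ⟨i, rfl⟩
        rw [hg0]
        exact zero_mem _
      · rw [PrimeSpectrum.mem_zeroLocus, Set.singleton_subset_iff]
        exact ht
    obtain ⟨P, hP⟩ := hm
    obtain ⟨χ, hχ⟩ := exists_algHom_of_le (fun i => toCoord X ⟨f i, hf i⟩) t P.asIdeal fun i => by
      have h1 : (MvPolynomial.X i - MvPolynomial.C (t i) : MvPolynomial ι ℂ) ∈ m.asIdeal := by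
        change MvPolynomial.eval t _ = 0
        simp
      rw [← hP] at h1
      have h2 : φ (MvPolynomial.X i - MvPolynomial.C (t i)) ∈ P.asIdeal := h1
      rw [map_sub, MvPolynomial.aeval_X] at h2
      convert h2 using 2
      exact (MvPolynomial.aeval_C _ _).symm
    obtain ⟨x, rfl⟩ := exists_eq_coordEval hX χ
    exact ⟨x, x.2, hχ⟩

/-- The polynomial relation expressing algebraicity over a generated subalgebra. -/
theorem exists_polynomial_of_isAlgebraic {A : Type*} [CommRing A] [Algebra ℂ A] {ι : Type*}
    (x : ι → A) {g : A} (halg : IsAlgebraic (Algebra.adjoin ℂ (Set.range x)) g) :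
    ∃ (R : Polynomial (MvPolynomial ι ℂ)) (j : ℕ), R.coeff j ≠ 0 ∧
      R.eval₂ (MvPolynomial.aeval x : MvPolynomial ι ℂ →ₐ[ℂ] A).toRingHom g = 0 := by
  obtain ⟨q, hq0, hq⟩ := halg
  have heq := Algebra.adjoin_range_eq_range_aeval ℂ x
  let φ : MvPolynomial ι ℂ →ₐ[ℂ] Algebra.adjoin ℂ (Set.range x) :=
    (MvPolynomial.aeval x).codRestrict _ fun P => heq.ge ⟨P, rfl⟩
  have hφ : Function.Surjective φ := fun a => by
    obtain ⟨P, hP⟩ := heq.le a.2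
    exact ⟨P, Subtype.ext hP⟩
  obtain ⟨R, hR⟩ := Polynomial.map_surjective φ.toRingHom hφ q
  obtain ⟨j, hj⟩ : ∃ j, R.coeff j ≠ 0 := by
    by_contra! h
    refine hq0 ?_
    rw [← hR, show R = 0 from Polynomial.ext h, Polynomial.map_zero]
  refine ⟨R, j, hj, ?_⟩
  rw [Polynomial.aeval_def, ← hR, Polynomial.eval₂_map] at hq
  exact hq

/-- Specialising a polynomial relation along a character. -/
theorem isRoot_of_eval₂_aeval {A : Type*} [CommRing A] [Algebra ℂ A] {ι : Type*} {x : ι → A} {g : A}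
    {R : Polynomial (MvPolynomial ι ℂ)}
    (hR : R.eval₂ (MvPolynomial.aeval x : MvPolynomial ι ℂ →ₐ[ℂ] A).toRingHom g = 0)
    (χ : A →ₐ[ℂ] ℂ) : (R.map (MvPolynomial.eval fun i => χ (x i))).IsRoot (χ g) := by
  have h1 : χ.toRingHom.comp (MvPolynomial.aeval x : MvPolynomial ι ℂ →ₐ[ℂ] A).toRingHom =
      MvPolynomial.eval fun i => χ (x i) :=
    RingHom.ext fun P => algHom_aeval χ x P
  have h2 := Polynomial.hom_eval₂ R (MvPolynomial.aeval x : MvPolynomial ι ℂ →ₐ[ℂ] A).toRingHom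
    χ.toRingHom g
  rw [hR, map_zero, h1] at h2
  rw [Polynomial.IsRoot, Polynomial.eval_map]
  exact h2.symm

/-- Extension of a maximal algebraically independent subfamily of `u` by members of `y`. -/
theorem exists_algebraicIndependent_extension {A : Type*} [CommRing A] [IsDomain A] [Algebra ℂ A]
    {κ : Type*} [Finite κ] (u : κ → A) {D : ℕ} {y : Fin D → A} (hy : AlgebraicIndependent ℂ y) :
    ∃ (s : Finset κ) (t : Finset (Fin D)), D ≤ s.card + t.card ∧
      AlgebraicIndependent ℂ (Sum.elim (fun i : t => y i) fun k : s => u k) ∧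
      ∀ k, IsAlgebraic (Algebra.adjoin ℂ (Set.range fun k : s => u k)) (u k) := by
  classical
  -- algebraic independence is a matroid: `I` is a basis of `u`, and `K ⊇ I` one of `u ∪ y`
  let Mt := AlgebraicIndependent.matroid ℂ A
  have hE : ∀ s : Set A, s ⊆ Mt.E := fun s => Set.subset_univ s
  obtain ⟨I, hI⟩ := Mt.exists_isBasis (Set.range u) (hE _)
  obtain ⟨K, hK, hIK⟩ := hI.indep.subset_isBasis_of_subset
    (hI.subset.trans Set.subset_union_left) (X := Set.range u ∪ Set.range y) (hE _)
  have hKfin : K.Finite := ((Set.finite_range u).union (Set.finite_range y)).subset hK.subset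
  have hIfin : I.Finite := hKfin.subset hIK
  have hyind : Mt.Indep (Set.range y) := AlgebraicIndependent.coe_range hy
  have hcard : D ≤ K.ncard := by
    have h1 : (Set.range y).encard ≤ K.encard := by
      obtain ⟨K', hK', hyK'⟩ := hyind.subset_isBasis_of_subset
        (Set.subset_union_right (s := Set.range u)) (hE _)
      rw [← hK'.encard_eq_encard hK]
      exact Set.encard_le_encard hyK'
    have h2 : (Set.range y).encard = D := by
      rw [← Set.image_univ, hy.injective.encard_image, Set.encard_univ]
      simp
    rw [h2, ← hKfin.cast_ncard_eq] at h1
    exact_mod_cast h1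
  have hKI : ∀ a ∈ K, a ∈ Set.range u → a ∈ I := fun a haK hau => by
    have h1 : I = K ∩ Set.range u := hI.eq_of_subset_indep
      (hK.indep.subset Set.inter_subset_left) (Set.subset_inter hIK hI.subset)
      Set.inter_subset_right
    rw [h1]
    exact ⟨haK, hau⟩
  choose k hk using fun a : I => hI.subset a.2
  have := hIfin.fintype
  have hkinj : Function.Injective k := fun a b hab => Subtype.ext (by rw [← hk a, ← hk b, hab])
  let s : Finset κ := Finset.univ.image k
  have hs : ∀ i : s, u i ∈ I := fun i => by
    obtain ⟨a, -, ha⟩ := Finset.mem_image.1 i.2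
    rw [← ha, hk]
    exact a.2
  have hsinj : Function.Injective fun i : s => u i := fun i j hij => by
    obtain ⟨a, -, ha⟩ := Finset.mem_image.1 i.2
    obtain ⟨b, -, hb⟩ := Finset.mem_image.1 j.2
    have : (a : A) = b := by
      rw [← hk a, ← hk b, ha, hb]
      exact hij
    exact Subtype.ext (by rw [← ha, ← hb, Subtype.ext this])
  have hsrange : Set.range (fun i : s => u i) = I := by
    refine Set.Subset.antisymm (Set.range_subset_iff.2 hs) fun a ha => ?_
    exact ⟨⟨k ⟨a, ha⟩, Finset.mem_image_of_mem _ (Finset.mem_univ _)⟩, hk ⟨a, ha⟩⟩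
  let t : Finset (Fin D) := Finset.univ.filter fun i => y i ∈ K \ I
  have ht : ∀ i : t, y i ∈ K \ I := fun i => (Finset.mem_filter.1 i.2).2
  let ψ : t ⊕ s → K := Sum.elim (fun i => ⟨y i, (ht i).1⟩) fun i => ⟨u i, hIK (hs i)⟩
  have hψ : Function.Injective ψ := by
    rintro (i | i) (j | j) hij
    · exact congrArg Sum.inl (Subtype.ext (hy.injective (congrArg Subtype.val hij)))
    · have h1 : y i = u j := congrArg Subtype.val hij
      exact absurd (h1 ▸ hs j) (ht i).2
    · have h1 : u i = y j := congrArg Subtype.val hij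
      exact absurd (h1 ▸ hs i) (ht j).2
    · exact congrArg Sum.inr (hsinj (congrArg Subtype.val hij))
  refine ⟨s, t, ?_, ?_, fun k => ?_⟩
  · have hsub : K ⊆ (s.image u : Finset A) ∪ (t.image y : Finset A) := by
      intro a ha
      by_cases haI : a ∈ I
      · rw [← hsrange] at haI
        obtain ⟨i, rfl⟩ := haI
        exact Or.inl (Finset.mem_coe.2 (Finset.mem_image_of_mem _ i.2))
      · rcases hK.subset ha with h | ⟨i, rfl⟩
        · exact absurd (hKI a ha h) haI
        · exact Or.inr (Finset.mem_coe.2 (Finset.mem_image_of_mem _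
            (Finset.mem_filter.2 ⟨Finset.mem_univ _, ha, haI⟩)))
    rw [← Finset.coe_union] at hsub
    have h1 := Set.ncard_le_ncard hsub (Finset.finite_toSet _)
    rw [Set.ncard_coe_finset] at h1
    have h2 := Finset.card_union_le (s.image u) (t.image y)
    have h3 := Finset.card_image_le (s := s) (f := u)
    have h4 := Finset.card_image_le (s := t) (f := y)
    omega
  · have hKind : AlgebraicIndependent ℂ (fun a : K => (a : A)) := hK.indep
    have h1 : Sum.elim (fun i : t => y i) (fun k : s => u k) = fun i => ((ψ i : K) : A) :=
      funext (by rintro (i | i) <;> rfl)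
    rw [h1]
    exact hKind.comp ψ hψ
  · have := (AlgebraicIndependent.matroid_isBasis_iff.1 hI).2.2 _ ⟨k, rfl⟩
    rwa [hsrange]

/-- The transcendence degree of a finitely generated domain is attained by a set of generators. -/
theorem exists_algebraicIndependent_generators {A : Type*} [CommRing A] [IsDomain A] [Algebra ℂ A]
    {κ : Type*} [Finite κ] {u : κ → A} (hu : Algebra.adjoin ℂ (Set.range u) = ⊤) {D : ℕ}
    {y : Fin D → A} (hy : AlgebraicIndependent ℂ y) :
    ∃ s : Finset κ, D ≤ s.card ∧ AlgebraicIndependent ℂ (fun i : s => u i) := by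
  classical
  let Mt := AlgebraicIndependent.matroid ℂ A
  have hE : ∀ s : Set A, s ⊆ Mt.E := fun s => Set.subset_univ s
  obtain ⟨I, hI⟩ := Mt.exists_isBasis (Set.range u) (hE _)
  have hIfin : I.Finite := (Set.finite_range u).subset hI.subset
  have hspan : Mt.Spanning (Set.range u) := by
    refine AlgebraicIndependent.matroid_spanning_iff.2 ⟨fun a => ?_⟩
    exact isAlgebraic_algebraMap
      (⟨a, by rw [hu]; exact Algebra.mem_top⟩ : Algebra.adjoin ℂ (Set.range u))
  have hyind : Mt.Indep (Set.range y) := AlgebraicIndependent.coe_range hy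
  have hbase := hI.isBase_of_spanning hspan
  have hle : (Set.range y).encard ≤ I.encard := by
    obtain ⟨B, hB, hyB⟩ := hyind.exists_isBase_superset
    rw [hbase.encard_eq_encard_of_isBase hB]
    exact Set.encard_le_encard hyB
  have h2 : (Set.range y).encard = D := by
    rw [← Set.image_univ, hy.injective.encard_image, Set.encard_univ]
    simp
  choose k hk using fun a : I => hI.subset a.2
  have := hIfin.fintype
  have hkinj : Function.Injective k := fun a b hab => Subtype.ext (by rw [← hk a, ← hk b, hab])
  refine ⟨Finset.univ.image k, ?_, ?_⟩
  · rw [Finset.card_image_of_injective _ hkinj, Finset.card_univ, ← Nat.card_eq_fintype_card,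
      Nat.card_coe_set_eq]
    rw [h2, ← hIfin.cast_ncard_eq] at hle
    exact_mod_cast hle
  · have hIind : AlgebraicIndependent ℂ (fun a : I => (a : A)) := hI.indep
    have hex : ∀ i : (Finset.univ.image k : Finset κ), ∃ a : I, k a = i := fun i => by
      obtain ⟨a, -, ha⟩ := Finset.mem_image.1 i.2
      exact ⟨a, ha⟩
    choose c hc using hex
    have hcinj : Function.Injective c := fun i j hij => Subtype.ext (by rw [← hc i, ← hc j, hij])
    have := hIind.comp c hcinj
    convert this using 2 with i
    rw [Function.comp_apply, ← hk, hc]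

end Fibres

/-! ### Dimensions of fibres -/

section Fibres

variable {W W₁ W₂ W₃ : Type*} [AddCommGroup W] [Module ℂ W] [AddCommGroup W₁] [Module ℂ W₁]
  [AddCommGroup W₂] [Module ℂ W₂] [AddCommGroup W₃] [Module ℂ W₃]
variable {S T : Set W} {d e : ℕ}

/-- A set which is the image of a Zariski closed set under a polynomial map. -/
def IsPolyImage (S : Set W) : Prop :=
  ∃ (m : ℕ) (X : Set (Fin m → ℂ)) (p : (Fin m → ℂ) → W),
    IsClosed[zariski (Fin m → ℂ)] X ∧ IsPolyMap p ∧ S = p '' X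

theorem isPolyImage_image [FiniteDimensional ℂ W] {X : Set W} (hX : IsClosed[zariski W] X)
    {p : W → W₁} (hp : IsPolyMap p) : IsPolyImage (p '' X) := by
  let e := (finBasis ℂ W).equivFun
  refine ⟨_, e.symm ⁻¹' X, fun t => p (e.symm t), ?_, ?_, ?_⟩
  · let _ := zariski W
    let _ := zariski (Fin (finrank ℂ W) → ℂ)
    exact hX.preimage (isPolyMap_linear e.symm.toLinearMap).continuous
  · exact hp.comp (isPolyMap_linear e.symm.toLinearMap)
  · ext w
    constructor
    · rintro ⟨x, hx, rfl⟩
      exact ⟨e x, by simpa using hx, by simp⟩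
    · rintro ⟨t, ht, rfl⟩
      exact ⟨_, ht, rfl⟩

theorem eval_sumElim {ι κ : Type*} (v : ι → ℂ) (u : κ → ℂ) (P : MvPolynomial (ι ⊕ κ) ℂ) :
    MvPolynomial.eval (Sum.elim v u) P = MvPolynomial.eval v
      (MvPolynomial.map (MvPolynomial.eval u) (MvPolynomial.sumAlgEquiv ℂ ι κ P)) := by
  induction P using MvPolynomial.induction_on with
  | C a => simp
  | add p q hp hq => simp [hp, hq]
  | mul_X p i hp => rcases i with i | i <;> simp [hp]

/-- Let functions `u`, `y` be independent on an irreducible closed set, and let the `z k` be algebraic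
over the `u`. For suitable values `τ` of the `u`, the `y` remain independent on the locus `u = τ` and
the `z k` take only finitely many values there. -/
theorem exists_specialization [FiniteDimensional ℂ W] {C : Set W} (hC : IsClosed[zariski W] C)
    (hirr : @IsIrreducible W (zariski W) C) {ι J κ : Type*} [Finite ι] [Finite J] [Fintype κ]
    {u : ι → W → ℂ} {y : J → W → ℂ} (hu : ∀ i, u i ∈ polyFun W) (hy : ∀ i, y i ∈ polyFun W)
    (hind : IndepOnSet C (Sum.elim y u)) {z : κ → W → ℂ}
    {R : κ → Polynomial (MvPolynomial ι ℂ)} {j : κ → ℕ} (hR : ∀ k, (R k).coeff (j k) ≠ 0)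
    (hz : ∀ k, ∀ w ∈ C, ((R k).map (MvPolynomial.eval fun i => u i w)).IsRoot (z k w)) :
    ∃ τ : ι → ℂ, IndepOnSet {w | w ∈ C ∧ ∀ i, u i w = τ i} y ∧
      ∃ E : κ → Set ℂ, (∀ k, (E k).Finite) ∧ ∀ w ∈ C, (∀ i, u i w = τ i) → ∀ k, z k w ∈ E k := by
  obtain ⟨h, hh0, hh⟩ := exists_principalOpen_subset_image hC hirr (f := Sum.elim y u)
    (by rintro (i | i); exacts [hy i, hu i]) hind
  let h' := MvPolynomial.sumAlgEquiv ℂ J ι h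
  have hh' : h' ≠ 0 := fun h0 => hh0 ((MvPolynomial.sumAlgEquiv ℂ J ι).injective (by
    rw [map_zero]; exact h0))
  obtain ⟨m, hm⟩ := MvPolynomial.ne_zero_iff.1 hh'
  -- `τ` avoids the zeros of a coefficient of `h` and of a coefficient of each relation `R k`
  let big : MvPolynomial ι ℂ := h'.coeff m * ∏ k, (R k).coeff (j k)
  have hbig : big ≠ 0 := mul_ne_zero hm (Finset.prod_ne_zero_iff.2 fun k _ => hR k)
  obtain ⟨τ, hτ⟩ : ∃ τ : ι → ℂ, MvPolynomial.eval τ big ≠ 0 := by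
    by_contra! hcon
    exact hbig (MvPolynomial.funext fun τ => by rw [hcon, map_zero])
  rw [map_mul, map_prod] at hτ
  have hτh := left_ne_zero_of_mul hτ
  have hτR := fun k => Finset.prod_ne_zero_iff.1 (right_ne_zero_of_mul hτ) k (Finset.mem_univ k)
  refine ⟨τ, fun P hP => ?_, fun k => {c | ((R k).map (MvPolynomial.eval τ)).IsRoot c}, fun k => ?_,
    fun w hw hwτ k => ?_⟩
  · have h1 : MvPolynomial.map (MvPolynomial.eval τ) h' * P = 0 := by
      refine MvPolynomial.funext fun v => ?_
      rw [map_mul, map_zero, ← eval_sumElim]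
      by_cases hv : MvPolynomial.eval (Sum.elim v τ) h = 0
      · rw [hv, zero_mul]
      · obtain ⟨x, hx, hxv⟩ := hh _ hv
        have h2 := hP x ⟨hx, fun i => hxv (Sum.inr i)⟩
        have h3 : (fun i => y i x) = v := funext fun i => hxv (Sum.inl i)
        rw [h3] at h2
        rw [h2, mul_zero]
    refine (mul_eq_zero.1 h1).resolve_left fun h0 => hτh ?_
    rw [← MvPolynomial.coeff_map, h0, MvPolynomial.coeff_zero]
  · refine Polynomial.finite_setOfPred_isRoot fun h0 => hτR k ?_
    rw [← Polynomial.coeff_map, h0, Polynomial.coeff_zero]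
  · have h1 := hz k w hw
    rwa [funext hwτ] at h1

/-- Some fibre of a polynomial map is at least as large as the difference of the dimensions. -/
theorem IsPolyImage.exists_fibre [FiniteDimensional ℂ W₂] {S : Set W₁}
    (hS : IsPolyImage S) {f : W₁ → W₂} (hf : IsPolyMap f) {D : ℕ} (hD : DimGE S D)
    (hd : DimLE (f '' S) d) :
    ∃ t ∈ f '' S, ∃ r, D ≤ d + r ∧ DimGE {s | s ∈ S ∧ f s = t} r := by
  obtain ⟨m, X, p, hX, hp, rfl⟩ := hS
  obtain ⟨C, hCX, hC, hirr, hDC⟩ := hD.exists_irreducible hX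
  have := isDomain_coordRing hirr
  obtain ⟨y, hy, hyC⟩ := hDC
  let b := finBasis ℂ W₂
  let z : Fin (finrank ℂ W₂) → W₁ → ℂ := fun k w => b.coord k (f w)
  have hz : ∀ k, z k ∈ polyFun W₁ := fun k => hf (b.coord k)
  let zp : Fin (finrank ℂ W₂) → (Fin m → ℂ) → ℂ := fun k w => z k (p w)
  let yp : Fin D → (Fin m → ℂ) → ℂ := fun i w => y i (p w)
  have hzp : ∀ k, zp k ∈ polyFun (Fin m → ℂ) := fun k => hp.comp_mem (hz k)
  have hyp : ∀ i, yp i ∈ polyFun (Fin m → ℂ) := fun i => hp.comp_mem (hy i)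
  have hypC : IndepOnSet C yp := by
    intro P hP
    refine hyC P ?_
    rintro _ ⟨w, hw, rfl⟩
    exact hP w hw
  obtain ⟨σ, τ, hcard, hind, halg⟩ := exists_algebraicIndependent_extension
    (fun k => toCoord C ⟨zp k, hzp k⟩) ((indepOnSet_iff hyp).1 hypC)
  have hind' : IndepOnSet C (Sum.elim (fun i : τ => yp i) fun k : σ => zp k) := by
    refine (indepOnSet_iff (by rintro (i | i); exacts [hyp i, hzp i])).2 ?_
    have h1 : (fun i => toCoord C ⟨Sum.elim (fun i : τ => yp i) (fun k : σ => zp k) i,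
        (by rcases i with i | i; exacts [hyp i, hzp i])⟩) =
        Sum.elim (fun i : τ => toCoord C ⟨yp i, hyp i⟩) fun k : σ => toCoord C ⟨zp k, hzp k⟩ :=
      funext (by rintro (i | i) <;> rfl)
    rw [h1]
    exact hind
  choose R j hRj hRu using fun k => exists_polynomial_of_isAlgebraic _ (halg k)
  obtain ⟨v, hv, E, hE, hzE⟩ := exists_specialization hC hirr (fun k : σ => hzp k)
    (fun i : τ => hyp i) hind' (z := zp) hRj
    fun k w hw => isRoot_of_eval₂_aeval (hRu k) (coordEval (⟨w, hw⟩ : C))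
  -- only finitely many points of the target have the prescribed values
  let T0 : Set W₂ := b.equivFun ⁻¹' Set.pi Set.univ E
  have hT0 : T0.Finite := Set.Finite.preimage b.equivFun.injective.injOn (Set.Finite.pi hE)
  let Sv : Set W₁ := p '' {w | w ∈ C ∧ ∀ i : σ, zp i w = v i}
  have hSv : Sv ⊆ ⋃ t ∈ T0 ∩ f '' (p '' X), {s | s ∈ p '' X ∧ f s = t} := by
    rintro _ ⟨x, ⟨hx, hxv⟩, rfl⟩
    refine Set.mem_iUnion₂.2 ⟨f (p x), ⟨?_, ⟨_, ⟨x, hCX hx, rfl⟩, rfl⟩⟩, ⟨x, hCX hx, rfl⟩, rfl⟩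
    exact fun k _ => hzE x hx hxv k
  have hdim : DimGE Sv τ.card := by
    refine .of_indep (f := fun i : τ => y i) (fun i => hy i) (fun P hP => ?_) (by simp)
    exact hv P fun w hw => hP (p w) ⟨w, hw, rfl⟩
  obtain ⟨t, ht, htd⟩ := (hdim.mono hSv).exists_of_biUnion (hT0.inter_of_left _)
  refine ⟨t, ht.2, _, ?_, htd⟩
  have hσd : σ.card ≤ d := by
    refine hd _ (.of_indep (f := fun (k : σ) w => b.coord k w)
      (fun k => dual_mem_polyFun (b.coord k)) (fun P hP => ?_) (by simp))
    refine hind'.comp Sum.inr_injective P fun w hw => ?_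
    exact hP (f (p w)) ⟨_, ⟨w, hCX hw, rfl⟩, rfl⟩
  omega

/-- Upper bound for the dimension of the source by that of the image and of the fibres. -/
theorem IsPolyImage.dimLE [FiniteDimensional ℂ W₂] {S : Set W₁} (hS : IsPolyImage S)
    {f : W₁ → W₂} (hf : IsPolyMap f) (hd : DimLE (f '' S) d)
    (he : ∀ t ∈ f '' S, DimLE {s | s ∈ S ∧ f s = t} e) : DimLE S (d + e) := by
  intro D hD
  obtain ⟨t, ht, r, hr, htr⟩ := hS.exists_fibre hf hD hd
  have := he t ht r htr
  omega

theorem adjoin_coord_eq_top [FiniteDimensional ℂ W] (X : Set W) : Algebra.adjoin ℂ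
    (Set.range fun k => toCoord X ⟨_, dual_mem_polyFun ((finBasis ℂ W).coord k)⟩) = ⊤ := by
  rw [eq_top_iff]
  rintro a -
  obtain ⟨⟨g, hg⟩, rfl⟩ := toCoord_surjective X a
  induction hg using Algebra.adjoin_induction with
  | mem x hx =>
    obtain ⟨φ, rfl⟩ := hx
    have h1 : toCoord X ⟨_, dual_mem_polyFun φ⟩ = ∑ k, φ (finBasis ℂ W k) •
        toCoord X ⟨_, dual_mem_polyFun ((finBasis ℂ W).coord k)⟩ := by
      refine coordRing_ext fun x => ?_
      rw [map_sum]
      simp only [map_smul, coordEval_toCoord]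
      conv_lhs => rw [← (finBasis ℂ W).sum_repr x]
      simp only [map_sum, map_smul, smul_eq_mul, Basis.coord_apply, mul_comm]
    rw [h1]
    exact Subalgebra.sum_mem _ fun k _ =>
      Subalgebra.smul_mem _ (Algebra.subset_adjoin (Set.mem_range_self k)) _
  | algebraMap r => exact Subalgebra.algebraMap_mem _ r
  | add x y hx hy h1 h2 => exact add_mem h1 h2
  | mul x y hx hy h1 h2 => exact mul_mem h1 h2

/-- Lower bound for the dimension of the source by that of a subset of the target and of the fibres
over it. -/
theorem DimGE.of_fibres [FiniteDimensional ℂ W] {S : Set W} {f : W → W₂} (hf : IsPolyMap f)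
    {T : Set W₂} (hT : DimGE T d) (he : ∀ t ∈ T, DimGE {s | s ∈ S ∧ f s = t} e) :
    DimGE S (d + e) := by
  classical
  -- on each fibre, `e` of the coordinate functions are independent
  let b := finBasis ℂ W
  have key : ∀ A : Set W, DimGE A e → ∃ s : Finset (Fin (finrank ℂ W)), e ≤ s.card ∧
      IndepOnSet A (fun (i : s) w => b.coord i w) := by
    intro A hA
    have hA' : DimGE ((fun w : W => w) '' @closure W (zariski W) A) e := by
      rw [Set.image_id']
      exact hA.mono (@subset_closure W (zariski W) A)
    obtain ⟨C, hCA, hC, hirr, y, hy, hyC⟩ :=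
      hA'.exists_irreducible (@isClosed_closure W (zariski W) A)
    rw [Set.image_id'] at hyC
    have := isDomain_coordRing hirr
    have hu := adjoin_coord_eq_top C
    obtain ⟨s, hs, hsind⟩ := exists_algebraicIndependent_generators hu
      ((indepOnSet_iff hy).1 hyC)
    refine ⟨s, hs, fun P hP => ?_⟩
    refine (indepOnSet_iff fun i : s => dual_mem_polyFun (b.coord i)).2 hsind P fun w hw => ?_
    exact mem_zariski_closure_iff.1 (hCA hw) _
      (eval_mem_polyFun (fun i : s => dual_mem_polyFun (b.coord i)) P) hP
  choose! s hs hsind using fun t ht => key _ (he t ht)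
  have hcov : T ⊆ ⋃ σ ∈ (Set.univ : Set (Finset (Fin (finrank ℂ W)))), {t | t ∈ T ∧ s t = σ} :=
    fun t ht => Set.mem_iUnion₂.2 ⟨s t, trivial, ht, rfl⟩
  obtain ⟨σ, -, y, hy, hyσ⟩ := (hT.mono hcov).exists_of_biUnion Set.finite_univ
  have hσ : e ≤ Fintype.card σ := by
    obtain ⟨t, ht, rfl⟩ := (DimGE.nonempty ⟨y, hy, hyσ⟩ : {t | t ∈ T ∧ s t = σ}.Nonempty)
    simpa using hs t ht
  refine .of_indep (ι := σ ⊕ Fin d) (f := Sum.elim (fun i w => b.coord i w) fun i w => y i (f w))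
    ?_ ?_ (by simpa [add_comm] using hσ)
  · rintro (i | i)
    · exact dual_mem_polyFun (b.coord i)
    · exact hf.comp_mem (hy i)
  · -- view a relation as a polynomial in the coordinates with coefficients polynomials in `y`
    intro P hP
    refine (MvPolynomial.sumAlgEquiv ℂ σ (Fin d)).injective ?_
    rw [map_zero]
    refine MvPolynomial.ext _ _ fun m => ?_
    rw [MvPolynomial.coeff_zero]
    refine hyσ _ ?_
    rintro t ⟨ht, rfl⟩
    have h1 : MvPolynomial.map (MvPolynomial.eval fun i => y i t)
        (MvPolynomial.sumAlgEquiv ℂ (s t) (Fin d) P) = 0 := by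
      refine hsind t ht _ ?_
      rintro w ⟨hw, rfl⟩
      rw [← eval_sumElim, ← hP w hw]
      congr 2
      ext (i | i) <;> rfl
    rw [← MvPolynomial.coeff_map, h1, MvPolynomial.coeff_zero]

end Fibres

/-! ### Krull dimension and quotients by groups -/

section Krull

variable {W W₁ W₂ W₃ : Type*} [AddCommGroup W] [Module ℂ W] [AddCommGroup W₁] [Module ℂ W₁]
  [AddCommGroup W₂] [Module ℂ W₂] [AddCommGroup W₃] [Module ℂ W₃]
variable {S T : Set W} {d e : ℕ}

/-- A constant function satisfies a polynomial relation, so a set with at most one point has dimension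
zero. -/
theorem dimLE_of_subsingleton (hS : S.Subsingleton) : DimLE S d := by
  rintro e ⟨f, hf, hfS⟩
  by_contra! hlt
  let i : Fin e := ⟨0, by omega⟩
  rcases S.eq_empty_or_nonempty with rfl | ⟨w, hw⟩
  · exact one_ne_zero (hfS 1 (by simp))
  · have h1 := hfS (MvPolynomial.X i - MvPolynomial.C (f i w)) fun v hv => by
      rw [hS hv hw]; simp
    rw [sub_eq_zero] at h1
    have h2 := congrArg MvPolynomial.totalDegree h1
    simp at h2

/-- The dimension of the Zariski closure of a non-empty set. -/
def zdim (S : Set W) : ℕ := sSup {d | DimGE S d}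

theorem dimGE_zdim [FiniteDimensional ℂ W] (hS : S.Nonempty) : DimGE S (zdim S) :=
  Nat.sSup_mem ⟨0, dimGE_zero hS⟩ ⟨_, fun _ he => dimLE_finrank _ he⟩

theorem DimGE.le_zdim [FiniteDimensional ℂ W] (h : DimGE S d) : d ≤ zdim S :=
  le_csSup ⟨_, fun _ he => dimLE_finrank _ he⟩ h

theorem dimLE_zdim [FiniteDimensional ℂ W] : DimLE S (zdim S) := fun _ he => he.le_zdim

/-- A strictly monotone bounded function on irreducible closed subsets bounds the Krull dimension. -/
theorem topologicalKrullDim_le_of_strictMono {Y : Type*} [TopologicalSpace Y]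
    {μ : TopologicalSpace.IrreducibleCloseds Y → ℕ} (hμ : StrictMono μ) (hd : ∀ Z, μ Z ≤ d) :
    topologicalKrullDim Y ≤ d := by
  rw [topologicalKrullDim, Order.krullDim_eq_iSup_height, iSup_le_iff]
  intro Z
  have h := Order.height_le_height_apply_of_strictMono μ hμ Z
  rw [Order.height_nat] at h
  exact_mod_cast h.trans (by exact_mod_cast hd Z)

theorem le_topologicalKrullDim_of_height {Y : Type*} [TopologicalSpace Y]
    {Z : TopologicalSpace.IrreducibleCloseds Y} (h : (d : ℕ∞) ≤ Order.height Z) :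
    d ≤ topologicalKrullDim Y := by
  rw [topologicalKrullDim, Order.krullDim_eq_iSup_height]
  refine le_trans ?_ (le_iSup
    (fun Z : TopologicalSpace.IrreducibleCloseds Y => (Order.height Z : WithBot ℕ∞)) Z)
  exact_mod_cast WithBot.coe_le_coe.2 h

/-- The Krull dimension of a set is at most its dimension in the sense of independent functions. -/
theorem topologicalKrullDim_le_of_dimLE [FiniteDimensional ℂ W] {Y : Type*} [TopologicalSpace Y]
    {i : Y → W} (hi : @IsInducing Y W _ (zariski W) i) (hd : DimLE (Set.range i) d) :
    topologicalKrullDim Y ≤ d := by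
  let _ := zariski W
  refine topologicalKrullDim_le_of_strictMono (μ := fun Z => zdim (i '' (Z : Set Y)))
    (fun Z Z' hZ => ?_) fun Z => ?_
  · have hirr : IsIrreducible (i '' (Z' : Set Y)) := Z'.isIrreducible.image i hi.continuous.continuousOn
    obtain ⟨y, hy', hy⟩ := Set.exists_of_ssubset (show (Z : Set Y) ⊂ Z' from hZ)
    obtain ⟨A, hA, hAZ⟩ := hi.isClosed_iff.1 Z.isClosed
    have hyA : i y ∉ A := fun h => hy (by rw [← hAZ]; exact h)
    have := mt (isClosed_zariski_iff.1 hA (i y)) hyA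
    push Not at this
    obtain ⟨g, hg, hgA, hgy⟩ := this
    have h1 : DimGE (i '' (Z : Set Y)) (zdim (i '' (Z : Set Y))) :=
      dimGE_zdim (Z.isIrreducible.nonempty.image i)
    have h2 := h1.succ_of_irreducible hirr (Set.image_mono hZ.le) hg
      (by
        rintro _ ⟨z, hz, rfl⟩
        exact hgA _ (by rw [← hAZ] at hz; exact hz))
      ⟨i y, ⟨y, hy', rfl⟩, hgy⟩
    exact Nat.lt_of_succ_le h2.le_zdim
  · exact hd _ ((dimGE_zdim (Z.isIrreducible.nonempty.image i)).mono (Set.image_subset_range _ _))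

/-- The product of irreducible sets is irreducible for the Zariski topology, which is finer than the
product topology. -/
theorem isIrreducible_prod {A : Set W} {B : Set W₂} (hA : @IsIrreducible W (zariski W) A)
    (hB : @IsIrreducible W₂ (zariski W₂) B) :
    @IsIrreducible (W × W₂) (zariski (W × W₂)) (A ×ˢ B) := by
  let _ := zariski W
  let _ := zariski W₂
  let _ : TopologicalSpace (W × W₂) := zariski (W × W₂)
  refine ⟨hA.nonempty.prod hB.nonempty, isPreirreducible_iff_isClosed_union_isClosed.2 ?_⟩
  intro Z₁ Z₂ h1 h2 hcov
  have hl : ∀ a : W, Continuous fun β : W₂ => (a, β) := fun a =>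
    ((isPolyMap_const a).prodMk isPolyMap_id).continuous
  have hr : ∀ β : W₂, Continuous fun a : W => (a, β) := fun β =>
    (isPolyMap_id.prodMk (isPolyMap_const β)).continuous
  have hcl : ∀ Z : Set (W × W₂), IsClosed Z → IsClosed {a : W | ∀ β ∈ B, (a, β) ∈ Z} := by
    intro Z hZ
    simp only [Set.ofPred_forall]
    exact isClosed_biInter fun β _ => hZ.preimage (hr β)
  have key := isPreirreducible_iff_isClosed_union_isClosed.1 hA.isPreirreducible _ _
    (hcl Z₁ h1) (hcl Z₂ h2) fun a ha => ?_
  · rcases key with h | h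
    · exact Or.inl fun x hx => h hx.1 x.2 hx.2
    · exact Or.inr fun x hx => h hx.1 x.2 hx.2
  · exact isPreirreducible_iff_isClosed_union_isClosed.1 hB.isPreirreducible _ _
      (h1.preimage (hl a)) (h2.preimage (hl a)) fun β hβ => hcov ⟨ha, hβ⟩

theorem isClosed_preimage_of_isPolyMap {f : W → W₂} (hf : IsPolyMap f) {X : Set W₂}
    (hX : IsClosed[zariski W₂] X) : IsClosed[zariski W] (f ⁻¹' X) := by
  let _ := zariski W
  let _ := zariski W₂
  exact hX.preimage hf.continuous

theorem isClosed_zariski_prod {A : Set W} {B : Set W₂} (hA : IsClosed[zariski W] A)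
    (hB : IsClosed[zariski W₂] B) : IsClosed[zariski (W × W₂)] (A ×ˢ B) := by
  let _ := zariski (W × W₂)
  exact (isClosed_preimage_of_isPolyMap (isPolyMap_id.fst) hA).inter
    (isClosed_preimage_of_isPolyMap (isPolyMap_id.snd) hB)

theorem isIrreducible_preimage_of_isInducing {Y Y' : Type*} [TopologicalSpace Y] [TopologicalSpace Y']
    {i : Y → Y'} (hi : IsInducing i) {S : Set Y'} (hS : IsIrreducible S) (hSi : S ⊆ Set.range i) :
    IsIrreducible (i ⁻¹' S) := by
  obtain ⟨s, hs⟩ := hS.nonempty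
  obtain ⟨y, rfl⟩ := hSi hs
  refine ⟨⟨y, hs⟩, isPreirreducible_iff_isClosed_union_isClosed.2 fun Z₁ Z₂ h1 h2 hcov => ?_⟩
  obtain ⟨A₁, hA₁, rfl⟩ := hi.isClosed_iff.1 h1
  obtain ⟨A₂, hA₂, rfl⟩ := hi.isClosed_iff.1 h2
  rcases isPreirreducible_iff_isClosed_union_isClosed.1 hS.isPreirreducible _ _ hA₁ hA₂ (fun s hs => by
    obtain ⟨y, rfl⟩ := hSi hs
    exact hcov hs) with h | h
  · exact Or.inl fun y hy => h hy
  · exact Or.inr fun y hy => h hy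

theorem isClosed_image_of_isInducing {Y Y' : Type*} [TopologicalSpace Y] [TopologicalSpace Y']
    {i : Y → Y'} (hi : IsInducing i) (hr : IsClosed (Set.range i)) {S : Set Y} (hS : IsClosed S) :
    IsClosed (i '' S) := by
  obtain ⟨A, hA, rfl⟩ := hi.isClosed_iff.1 hS
  rw [Set.image_preimage_eq_inter_range]
  exact hA.inter hr

/-- An irreducible set covered by finitely many closed sets lies in one of them. -/
theorem exists_subset_of_irreducible {Y : Type*} [TopologicalSpace Y] {S : Set Y}
    (hS : IsIrreducible S) {ι : Type*} {s : Set ι} (hs : s.Finite) {A : ι → Set Y}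
    (hA : ∀ j ∈ s, IsClosed (A j)) (hcov : S ⊆ ⋃ j ∈ s, A j) : ∃ j ∈ s, S ⊆ A j := by
  obtain ⟨z, hz, hSz⟩ := isIrreducible_iff_sUnion_isClosed.1 hS (hs.image A).toFinset
    (by
      intro z hz
      rw [Set.Finite.mem_toFinset] at hz
      obtain ⟨j, hj, rfl⟩ := hz
      exact hA j hj)
    (by simpa [Set.sUnion_image] using hcov)
  rw [Set.Finite.mem_toFinset] at hz
  obtain ⟨j, hj, rfl⟩ := hz
  exact ⟨j, hj, hSz⟩

section Quotient

variable {Φ Y : Type*} [TopologicalSpace Φ] [TopologicalSpace Y]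
  {B : Set W₂} {m : W × W₂ → W₃} {i : Y → W} {q : Y → Φ}

/-- The irreducible closed subset of `Φ` spanned by the image of an irreducible subset of `Y`,
where `Y` is embedded in a vector space. -/
def closureImage (hi : @IsInducing Y W _ (zariski W) i) (hq : Continuous q) (S : Set W)
    (hS : @IsIrreducible W (zariski W) S) (hSi : S ⊆ Set.range i) :
    TopologicalSpace.IrreducibleCloseds Φ where
  carrier := closure (q '' (i ⁻¹' S))
  isIrreducible' := by
    let _ := zariski W
    exact ((isIrreducible_preimage_of_isInducing hi hS hSi).image q hq.continuousOn).closure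
  isClosed' := isClosed_closure

/-- Cutting an irreducible closed set `S` by level sets of linear forms, the dimension of the
swept-out set `m(S × B)` drops by at most one at each step, so that many members of the resulting
descending chain have distinct images in `Φ`. -/
theorem le_height_closureImage [FiniteDimensional ℂ W] [FiniteDimensional ℂ W₂]
    (hi : @IsInducing Y W _ (zariski W) i) (hq : Continuous q)
    (hB : IsClosed[zariski W₂] B) (hm : IsPolyMap m) {b : ℕ}
    (hb : ∀ y, DimLE (m '' ({i y} ×ˢ B)) b)
    (hqm : ∀ S ⊆ Set.range i, ∀ S' ⊆ Set.range i, q '' (i ⁻¹' S) ⊆ closure (q '' (i ⁻¹' S')) →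
      m '' (S ×ˢ B) ⊆ @closure W₃ (zariski W₃) (m '' (S' ×ˢ B))) (k : ℕ) :
    ∀ (S : Set W) (hS : @IsIrreducible W (zariski W) S) (hSi : S ⊆ Set.range i),
      IsClosed[zariski W] S → DimLE S k → ∀ D, DimGE (m '' (S ×ˢ B)) D →
      ((D - b : ℕ) : ℕ∞) ≤ Order.height (closureImage hi hq S hS hSi) := by
  induction k using Nat.strong_induction_on with
  | _ k ih =>
    intro S hS hSi hSc hk D hD
    let _ := zariski W
    have := noetherianSpace_zariski (W := W)
    by_cases hsub : S.Subsingleton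
    · obtain ⟨s, hs⟩ := hS.nonempty
      obtain ⟨y, rfl⟩ := hSi hs
      have h1 : S = {i y} := hsub.eq_singleton_of_mem hs
      have h2 : D ≤ b := hb y D (by rw [← h1]; exact hD)
      simp [Nat.sub_eq_zero_of_le h2]
    obtain ⟨s, hs, s', hs', hne⟩ := Set.not_subsingleton_iff.1 hsub
    obtain ⟨φ, hφ⟩ := (Module.forall_dual_apply_eq_zero_iff ℂ (s - s')).not.2 (sub_ne_zero.2 hne) |>
      not_forall.1
    rw [map_sub, sub_eq_zero] at hφ
    let G : W × W₂ → ℂ × W₃ := fun p => (φ p.1, m p)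
    have hG : IsPolyMap G := ((isPolyMap_linear φ).comp isPolyMap_id.fst).prodMk hm
    have hGS : IsPolyImage (G '' (S ×ˢ B)) := isPolyImage_image (isClosed_zariski_prod hSc hB) hG
    have hDG : DimGE (G '' (S ×ˢ B)) D := by
      refine DimGE.of_image (p := Prod.snd) isPolyMap_id.snd ?_
      rwa [Set.image_image]
    have hd1 : DimLE ((Prod.fst : ℂ × W₃ → ℂ) '' (G '' (S ×ˢ B))) 1 := by
      simpa using dimLE_finrank (W := ℂ) (S := (Prod.fst : ℂ × W₃ → ℂ) '' (G '' (S ×ˢ B)))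
    -- the level set `φ = t` sweeps out a set of dimension `r ≥ D - 1`
    obtain ⟨t, -, r, hr, htr⟩ := hGS.exists_fibre isPolyMap_id.fst hDG hd1
    have hclt : IsClosed (S ∩ {w | φ w = t}) := hSc.inter
      (isClosed_eq_of_isPolyMap (isPolyMap_linear φ) (isPolyMap_const t))
    have htr' : DimGE (m '' ((S ∩ {w | φ w = t}) ×ˢ B)) r := by
      refine DimGE.of_image (p := fun w => (t, w)) ((isPolyMap_const t).prodMk isPolyMap_id)
        (htr.mono ?_)
      rintro _ ⟨⟨⟨a, β⟩, ⟨ha, hβ⟩, rfl⟩, hat⟩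
      exact ⟨_, ⟨(a, β), ⟨⟨ha, hat⟩, hβ⟩, rfl⟩, by rw [← show φ a = t from hat]⟩
    obtain ⟨s₀, hs₀, hcl, hirr, hcov⟩ :=
      TopologicalSpace.NoetherianSpace.exists_finite_set_isClosed_irreducible hclt
    rw [hcov, Set.sUnion_eq_biUnion, Set.iUnion₂_prod_const, Set.image_iUnion₂] at htr'
    obtain ⟨C, hC, hCr⟩ := htr'.exists_of_biUnion hs₀
    have hCS : C ⊆ S ∩ {w | φ w = t} := by rw [hcov]; exact Set.subset_sUnion_of_mem hC
    have hCi := (hCS.trans Set.inter_subset_left).trans hSi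
    have hlt : ∃ k' < k, DimLE C k' := by
      have hsucc : ∀ d, DimGE C d → d + 1 ≤ k := fun d hd => by
        refine hk _ (hd.succ_of_irreducible hS (hCS.trans Set.inter_subset_left)
          (g := fun w => φ w - t)
          (sub_mem (dual_mem_polyFun φ) (const_mem_polyFun t)) (fun z hz => ?_) ?_)
        · rw [show φ z = t from (hCS hz).2, sub_self]
        · by_cases h : φ s = t
          · exact ⟨s', hs', sub_ne_zero.2 fun h' => hφ (h.trans h'.symm)⟩
          · exact ⟨s, hs, sub_ne_zero.2 h⟩
      have h0 := hsucc 0 (dimGE_zero (hirr C hC).nonempty)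
      exact ⟨k - 1, by omega, fun d hd => by have := hsucc d hd; omega⟩
    obtain ⟨k', hk', hCk'⟩ := hlt
    have hle : closureImage hi hq C (hirr C hC) hCi ≤ closureImage hi hq S hS hSi :=
      closure_mono (Set.image_mono (Set.preimage_mono (hCS.trans Set.inter_subset_left)))
    -- if `C` has the same image as `S`, it still sweeps out a set of dimension `D`; otherwise the chain
    -- grows by one
    rcases hle.eq_or_lt with heq | hlt
    · rw [← heq]
      refine ih k' hk' C (hirr C hC) hCi (hcl C hC) hCk' D (DimGE.of_closure (hD.mono ?_))
      refine hqm S hSi C hCi ?_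
      have h3 : closure (q '' (i ⁻¹' C)) = closure (q '' (i ⁻¹' S)) :=
        congrArg (fun Z : TopologicalSpace.IrreducibleCloseds Φ => (Z : Set Φ)) heq
      rw [h3]
      exact subset_closure
    · have h1 := ih k' hk' C (hirr C hC) hCi (hcl C hC) hCk' r hCr
      have h2 := Order.height_add_one_le hlt
      refine le_trans ?_ ((add_le_add_left h1 1).trans h2)
      norm_cast
      omega

/-- If `Φ` is the quotient of a closed set `Y` by a group `B` acting with orbits of dimension `b`,
then `dim Φ = dim Y - b`. The action is given by the polynomial map `m`. -/
structure IsQuotientBy (B : Set W₂) (m : W × W₂ → W) (i : Y → W) (q : Y → Φ) (b : ℕ) : Prop where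
  isInducing : @IsInducing Y W _ (zariski W) i
  injective : Function.Injective i
  isClosed_range : IsClosed[zariski W] (Set.range i)
  continuous : Continuous q
  surjective : Function.Surjective q
  isClosed : IsClosed[zariski W₂] B
  isPolyMap : IsPolyMap m
  exists_mul : ∀ y, ∀ β ∈ B, ∃ y', i y' = m (i y, β) ∧ q y' = q y
  exists_of_eq : ∀ y y', q y = q y' → ∃ β ∈ B, i y' = m (i y, β)
  isClosed_image : ∀ A : Set Y, IsClosed A → (∀ y ∈ A, ∀ y', q y' = q y → y' ∈ A) → IsClosed (q '' A)
  dimLE : ∀ y, DimLE (m '' ({i y} ×ˢ B)) b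
  dimGE : ∀ y, DimGE (m '' ({i y} ×ˢ B)) b

namespace IsQuotientBy

variable {m : W × W₂ → W} {b : ℕ} (h : IsQuotientBy B m i q b)
include h

theorem mem_image {y y' : Y} {S : Set W} (hS : i y ∈ S) (hy : q y' = q y) : i y' ∈ m '' (S ×ˢ B) := by
  obtain ⟨β, hβ, hy'⟩ := h.exists_of_eq y y' hy.symm
  exact ⟨(i y, β), ⟨hS, hβ⟩, hy'.symm⟩

/-- The closure of the set swept out by the action contains the preimage of the closure in `Φ`. -/
theorem mem_closure {S : Set W} (hS : S ⊆ Set.range i) {y : Y}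
    (hy : q y ∈ closure (q '' (i ⁻¹' S))) : i y ∈ @closure W (zariski W) (m '' (S ×ˢ B)) := by
  let _ := zariski W
  let A : Set Y := i ⁻¹' closure (m '' (S ×ˢ B))
  have hA : IsClosed A := isClosed_closure.preimage h.isInducing.continuous
  have hAm : ∀ y ∈ A, ∀ y', q y' = q y → y' ∈ A := by
    intro y hy y' hyy'
    obtain ⟨β, hβ, hy'⟩ := h.exists_of_eq y y' hyy'.symm
    change i y' ∈ closure _
    rw [hy']
    have hc : Continuous fun w : W => m (w, β) :=
      (h.isPolyMap.comp (isPolyMap_id.prodMk (isPolyMap_const β))).continuous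
    refine map_mem_closure (f := fun w : W => m (w, β)) hc hy ?_
    rintro _ ⟨⟨w, β'⟩, ⟨hw, hβ'⟩, rfl⟩
    obtain ⟨z, rfl⟩ := hS hw
    obtain ⟨z', hz', hqz'⟩ := h.exists_mul z β' hβ'
    obtain ⟨z'', hz'', hqz''⟩ := h.exists_mul z' β hβ
    change m (m (i z, β'), β) ∈ _
    rw [← hz', ← hz'']
    exact h.mem_image hw (hqz''.trans hqz')
  have hsub : closure (q '' (i ⁻¹' S)) ⊆ q '' A := by
    refine closure_minimal (Set.image_mono fun y hy => ?_) (h.isClosed_image A hA hAm)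
    exact subset_closure (h.mem_image hy rfl)
  obtain ⟨y', hy', hyy'⟩ := hsub hy
  exact hAm y' hy' y hyy'.symm

/-- The lower bound for the dimension of a quotient, by `le_height_closureImage`. -/
theorem le_topologicalKrullDim [FiniteDimensional ℂ W] [FiniteDimensional ℂ W₂] {d : ℕ}
    (hd : DimGE (Set.range i) (b + d)) : d ≤ topologicalKrullDim Φ := by
  let _ := zariski W
  have hd' : DimGE (id '' Set.range i) (b + d) := by rwa [Set.image_id]
  obtain ⟨C, hC, hCc, hCi, hCd⟩ := hd'.exists_irreducible h.isClosed_range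
  rw [Set.image_id] at hCd
  have h1 := le_height_closureImage h.isInducing h.continuous h.isClosed h.isPolyMap h.dimLE
    (fun S hS S' hS' hSS' => ?_) _ C hCi hC hCc dimLE_finrank (b + d) (hCd.mono fun w hw => ?_)
  · rw [Nat.add_sub_cancel_left] at h1
    exact le_topologicalKrullDim_of_height h1
  · rintro _ ⟨⟨w, β⟩, ⟨hw, hβ⟩, rfl⟩
    obtain ⟨z, rfl⟩ := hS hw
    obtain ⟨z', hz', hqz'⟩ := h.exists_mul z β hβ
    rw [← hz']
    refine h.mem_closure hS' (hSS' ?_)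
    rw [hqz']
    exact ⟨z, hw, rfl⟩
  · obtain ⟨z, rfl⟩ := hC hw
    exact h.mem_image hw rfl

/-- The dimension of the preimage in `Y` strictly increases along a strict inclusion of a closed subset
in an irreducible closed subset of the quotient. -/
theorem dimGE_preimage_succ [FiniteDimensional ℂ W] [FiniteDimensional ℂ W₂] {d : ℕ} {Z Z' : Set Φ}
    (hZ : IsClosed Z) (hZ' : IsClosed Z') (hirr : IsIrreducible Z') (hZZ' : Z ⊂ Z')
    (hd : DimGE (i '' (q ⁻¹' Z)) d) : DimGE (i '' (q ⁻¹' Z')) (d + 1) := by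
  let _ := zariski W
  let _ := zariski W₂
  have := noetherianSpace_zariski (W := W)
  have := noetherianSpace_zariski (W := W₂)
  have hcl : ∀ Z : Set Φ, IsClosed Z → IsClosed (i '' (q ⁻¹' Z)) := fun Z hZ =>
    isClosed_image_of_isInducing h.isInducing h.isClosed_range (hZ.preimage h.continuous)
  -- a component `C` of the preimage of `Z'` that dominates `Z'`
  obtain ⟨s, hs, hsc, hsi, hcov⟩ :=
    TopologicalSpace.NoetherianSpace.exists_finite_set_isClosed_irreducible (hcl Z' hZ')
  obtain ⟨C, hC, hCZ⟩ := exists_subset_of_irreducible hirr hs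
    (A := fun C => closure (q '' (i ⁻¹' C))) (fun _ _ => isClosed_closure) (by
      intro φ hφ
      obtain ⟨y, rfl⟩ := h.surjective φ
      have hy : i y ∈ ⋃₀ s := by rw [← hcov]; exact ⟨y, hφ, rfl⟩
      obtain ⟨C, hC, hyC⟩ := hy
      exact Set.mem_biUnion hC (subset_closure ⟨y, hyC, rfl⟩))
  have hCs : C ⊆ i '' (q ⁻¹' Z') := by rw [hcov]; exact Set.subset_sUnion_of_mem hC
  have hCr : C ⊆ Set.range i := hCs.trans (Set.image_subset_range _ _)
  obtain ⟨t, ht, htc, hti, htcov⟩ :=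
    TopologicalSpace.NoetherianSpace.exists_finite_set_isClosed_irreducible h.isClosed
  have hcovE : i '' (q ⁻¹' Z') ⊆ ⋃ D ∈ t, closure (m '' (C ×ˢ D)) := by
    rw [← ht.closure_biUnion, ← Set.image_iUnion₂, ← Set.prod_iUnion₂, ← Set.sUnion_eq_biUnion,
      ← htcov]
    rintro _ ⟨y, hy, rfl⟩
    exact h.mem_closure hCr (hCZ hy)
  have hE : ∀ D ∈ t, closure (m '' (C ×ˢ D)) ⊆ i '' (q ⁻¹' Z') := by
    intro D hD
    refine closure_minimal ?_ (hcl Z' hZ')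
    rintro _ ⟨⟨w, β⟩, ⟨hw, hβ⟩, rfl⟩
    obtain ⟨y, hy, rfl⟩ := hCs hw
    obtain ⟨y', hy', hqy'⟩ := h.exists_mul y β (by rw [htcov]; exact ⟨D, hD, hβ⟩)
    exact ⟨y', by change q y' ∈ Z'; rw [hqy']; exact hy, hy'⟩
  -- a component of the preimage of `Z` of full dimension
  have hd' : DimGE (id '' (i '' (q ⁻¹' Z))) d := by rwa [Set.image_id]
  obtain ⟨C', hC', hC'c, hC'i, hC'd⟩ := hd'.exists_irreducible (hcl Z hZ)
  rw [Set.image_id] at hC'd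
  obtain ⟨D, hD, hC'D⟩ := exists_subset_of_irreducible hC'i ht
    (A := fun D => closure (m '' (C ×ˢ D))) (fun _ _ => isClosed_closure)
    ((hC'.trans (Set.image_mono (Set.preimage_mono hZZ'.subset))).trans hcovE)
  have hEi : IsIrreducible (closure (m '' (C ×ˢ D))) := by
    let _ : TopologicalSpace (W × W₂) := zariski (W × W₂)
    have := isIrreducible_prod (hsi C hC) (hti D hD)
    exact (this.image m h.isPolyMap.continuous.continuousOn).closure
  -- if the component equalled `C'`, the image of `Z'` would lie in `Z`
  by_cases hEC : closure (m '' (C ×ˢ D)) ⊆ C'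
  · exfalso
    refine hZZ'.2 (hCZ.trans (closure_minimal ?_ hZ))
    rintro _ ⟨y, hy, rfl⟩
    obtain ⟨β, hβ⟩ := (hti D hD).nonempty
    obtain ⟨y', hy', hqy'⟩ := h.exists_mul y β (by rw [htcov]; exact ⟨D, hD, hβ⟩)
    obtain ⟨z, hz, hzy⟩ := hC' (hEC (subset_closure ⟨(i y, β), ⟨hy, hβ⟩, rfl⟩))
    obtain rfl := h.injective (hzy.trans hy'.symm)
    rw [← hqy']
    exact hz
  · obtain ⟨w, hw, hwC⟩ := Set.not_subset.1 hEC
    have := mt (isClosed_zariski_iff.1 hC'c w) hwC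
    push Not at this
    obtain ⟨g, hg, hgC, hgw⟩ := this
    exact (hC'd.succ_of_irreducible hEi hC'D hg hgC ⟨w, hw, hgw⟩).mono (hE D hD)

/-- The upper bound for the dimension of a quotient: `Z ↦ dim q⁻¹(Z) - b` is strictly monotone. -/
theorem topologicalKrullDim_le [FiniteDimensional ℂ W] [FiniteDimensional ℂ W₂] {d : ℕ}
    (hd : DimLE (Set.range i) (b + d)) : topologicalKrullDim Φ ≤ d := by
  have hb : ∀ Z : TopologicalSpace.IrreducibleCloseds Φ, b ≤ zdim (i '' (q ⁻¹' (Z : Set Φ))) := by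
    intro Z
    obtain ⟨φ, hφ⟩ := Z.isIrreducible.nonempty
    obtain ⟨y, rfl⟩ := h.surjective φ
    refine DimGE.le_zdim ((h.dimGE y).mono ?_)
    rintro _ ⟨⟨w, β⟩, ⟨hw, hβ⟩, rfl⟩
    obtain rfl : w = i y := hw
    obtain ⟨y', hy', hqy'⟩ := h.exists_mul y β hβ
    exact ⟨y', by change q y' ∈ (Z : Set Φ); rw [hqy']; exact hφ, hy'⟩
  have hne : ∀ Z : TopologicalSpace.IrreducibleCloseds Φ, (i '' (q ⁻¹' (Z : Set Φ))).Nonempty := by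
    intro Z
    obtain ⟨φ, hφ⟩ := Z.isIrreducible.nonempty
    obtain ⟨y, rfl⟩ := h.surjective φ
    exact ⟨i y, y, hφ, rfl⟩
  refine topologicalKrullDim_le_of_strictMono
    (μ := fun Z => zdim (i '' (q ⁻¹' (Z : Set Φ))) - b) (fun Z Z' hZZ' => ?_) fun Z => ?_
  · have h1 := (h.dimGE_preimage_succ Z.isClosed Z'.isClosed Z'.isIrreducible
      (show (Z : Set Φ) ⊂ Z' from hZZ') (dimGE_zdim (hne Z))).le_zdim
    have := hb Z
    change _ - b < _ - b
    omega
  · have := hd _ ((dimGE_zdim (hne Z)).mono (Set.image_subset_range _ _))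
    change _ - b ≤ d
    omega

end IsQuotientBy
end Quotient

end Krull

/-! ### Images of closed sets under polynomial maps -/

section Tools

variable {W W₁ W₂ W₃ : Type*} [AddCommGroup W] [Module ℂ W] [AddCommGroup W₁] [Module ℂ W₁]
  [AddCommGroup W₂] [Module ℂ W₂] [AddCommGroup W₃] [Module ℂ W₃]
variable {S T : Set W} {d e : ℕ}

theorem IsPolyMap.mul {A : Type*} [Ring A] [Algebra ℂ A] [FiniteDimensional ℂ A] {f g : W → A}
    (hf : IsPolyMap f) (hg : IsPolyMap g) : IsPolyMap (fun w => f w * g w) :=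
  IsPolyMap.bilin (LinearMap.mul ℂ A) hf hg

theorem det_mem_polyFun {V : Type*} [AddCommGroup V] [Module ℂ V] [FiniteDimensional ℂ V] :
    (fun g : End ℂ V => LinearMap.det g) ∈ polyFun (End ℂ V) := by
  let b := finBasis ℂ V
  have : (fun g : End ℂ V => LinearMap.det g) = fun g => ∑ σ : Equiv.Perm (Fin (finrank ℂ V)),
      ((Equiv.Perm.sign σ : ℤ) : ℂ) * ∏ i, LinearMap.toMatrix b b g (σ i) i := by
    ext g
    rw [← LinearMap.det_toMatrix b, Matrix.det_apply']
  rw [this, show (fun g : End ℂ V => ∑ σ : Equiv.Perm (Fin (finrank ℂ V)),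
      ((Equiv.Perm.sign σ : ℤ) : ℂ) * ∏ i, LinearMap.toMatrix b b g (σ i) i) =
      ∑ σ : Equiv.Perm (Fin (finrank ℂ V)), (fun _ => ((Equiv.Perm.sign σ : ℤ) : ℂ)) *
        ∏ i, (fun g : End ℂ V => LinearMap.toMatrix b b g (σ i) i) by ext g; simp]
  refine sum_mem fun σ _ => mul_mem (const_mem_polyFun _) (prod_mem fun i _ => ?_)
  exact dual_mem_polyFun ((LinearMap.toMatrix b b).toLinearMap.comp (LinearMap.id) |> fun l =>
    (Matrix.entryLinearMap ℂ ℂ (σ i) i).comp l)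

/-- An injective polynomial map does not lower the dimension, since its fibres are points. -/
theorem DimGE.image_of_injOn [FiniteDimensional ℂ W₂] (hS : IsPolyImage S) {f : W → W₂}
    (hf : IsPolyMap f) (hinj : Set.InjOn f S) (h : DimGE S d) : DimGE (f '' S) d := by
  refine (dimGE_zdim (h.nonempty.image f)).le (hS.dimLE hf dimLE_zdim (e := 0) ?_ d h)
  rintro _ ⟨s, hs, rfl⟩
  exact dimLE_of_subsingleton fun a ha b hb => hinj ha.1 hb.1 (ha.2.trans hb.2.symm)

/-- A non-empty principal open subset of an irreducible set has the same dimension. -/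
theorem DimGE.principalOpen (hS : @IsIrreducible W (zariski W) S) {g : W → ℂ} (hg : g ∈ polyFun W)
    (hgS : ∃ s ∈ S, g s ≠ 0) (h : DimGE S d) : DimGE {s | s ∈ S ∧ g s ≠ 0} d := by
  obtain ⟨f, hf, hfS⟩ := h
  refine ⟨f, hf, fun P hP => hfS P ?_⟩
  have hmul : ∀ w ∈ S, g w * MvPolynomial.eval (fun i => f i w) P = 0 := fun w hw => by
    by_cases hw' : g w = 0
    · rw [hw', zero_mul]
    · rw [hP w ⟨hw, hw'⟩, mul_zero]
  rcases isIrreducible_zariski_mul hS hg (eval_mem_polyFun hf P) hmul with h | h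
  · obtain ⟨s, hs, hgs⟩ := hgS
    exact absurd (h s hs) hgs
  · exact h

theorem IsPolyImage.image (hS : IsPolyImage S) {f : W → W₂} (hf : IsPolyMap f) :
    IsPolyImage (f '' S) := by
  obtain ⟨m, X, p, hX, hp, rfl⟩ := hS
  exact ⟨m, X, fun t => f (p t), hX, hf.comp hp, by rw [Set.image_image]⟩

theorem isPolyImage_of_isClosed [FiniteDimensional ℂ W] (hS : IsClosed[zariski W] S) :
    IsPolyImage S := by
  simpa using isPolyImage_image hS isPolyMap_id

theorem IsPolyImage.prod {T : Set W₂} (hS : IsPolyImage S) (hT : IsPolyImage T) :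
    IsPolyImage (S ×ˢ T) := by
  obtain ⟨m, X, p, hX, hp, rfl⟩ := hS
  obtain ⟨k, Y, q, hY, hq, rfl⟩ := hT
  rw [Set.prod_image_image_eq]
  exact isPolyImage_image (isClosed_zariski_prod hX hY)
    ((hp.comp isPolyMap_id.fst).prodMk (hq.comp isPolyMap_id.snd))

theorem IsPolyImage.inter_isClosed (hS : IsPolyImage S) (hT : IsClosed[zariski W] T) :
    IsPolyImage (S ∩ T) := by
  obtain ⟨m, X, p, hX, hp, rfl⟩ := hS
  refine ⟨m, X ∩ p ⁻¹' T, p, ?_, hp, ?_⟩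
  · let _ := zariski (Fin m → ℂ)
    exact hX.inter (isClosed_preimage_of_isPolyMap hp hT)
  · rw [Set.image_inter_preimage]

/-- Within the image of a closed set, the preimage of such an image is again of this kind: it is the
projection of a fibre product. -/
theorem IsPolyImage.inter_preimage {T : Set W₂} (hS : IsPolyImage S) (hT : IsPolyImage T)
    {f : W → W₂} (hf : IsPolyMap f) : IsPolyImage (S ∩ f ⁻¹' T) := by
  have h := ((hS.prod hT).inter_isClosed
    (isClosed_eq_of_isPolyMap (hf.comp isPolyMap_id.fst) isPolyMap_id.snd)).image
    (isPolyMap_id.fst (W₂ := W) (W₃ := W₂))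
  refine (congrArg IsPolyImage ?_).mp h
  ext w
  constructor
  · rintro ⟨⟨a, b⟩, ⟨⟨ha, hb⟩, hab⟩, rfl⟩
    refine ⟨ha, ?_⟩
    change f a = b at hab
    change f a ∈ T
    rw [hab]
    exact hb
  · rintro ⟨h1, h2⟩
    exact ⟨(w, f w), ⟨⟨h1, h2⟩, rfl⟩, rfl⟩

/-- The Krull dimension of the image of a closed set is at least its dimension in the sense of
independent functions. -/
theorem le_topologicalKrullDim_of_isPolyImage {Φ : Type*} [TopologicalSpace Φ] {j : Φ → W}
    (hj : @IsInducing Φ W _ (zariski W) j) (hS : IsPolyImage (Set.range j))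
    (hd : DimGE (Set.range j) d) : d ≤ topologicalKrullDim Φ := by
  obtain ⟨m, X, p, hX, hp, hXp⟩ := hS
  rw [hXp] at hd
  obtain ⟨C, hCX, hCc, hCi, hCd⟩ := hd.exists_irreducible hX
  let _ := zariski W
  let _ : TopologicalSpace (Fin m → ℂ) := zariski (Fin m → ℂ)
  have hex : ∀ y : X, ∃ φ : Φ, j φ = p y := fun y => by
    have : p y ∈ Set.range j := by rw [hXp]; exact ⟨y, y.2, rfl⟩
    exact this
  choose q hq using hex
  have hqc : Continuous q := by
    rw [hj.continuous_iff]
    rw [show j ∘ q = fun y : X => p y from funext hq]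
    exact hp.continuous.comp continuous_subtype_val
  have h1 := le_height_closureImage (b := 0) (W₂ := ℂ) (W₃ := W) (i := (Subtype.val : X → Fin m → ℂ))
    (B := {0}) (m := fun a => p a.1) .subtypeVal hqc
    (by simpa using isClosed_eq_of_isPolyMap (isPolyMap_id (W := ℂ)) (isPolyMap_const 0))
    (hp.comp isPolyMap_id.fst)
    (fun y => dimLE_of_subsingleton (by simp)) (fun S hS S' hS' hSS' => ?_) _ C hCi
    (by simpa using hCX) hCc dimLE_finrank d (hCd.mono ?_)
  · rw [Nat.sub_zero] at h1
    exact le_topologicalKrullDim_of_height h1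
  · rintro _ ⟨⟨w, β⟩, ⟨hw, hβ⟩, rfl⟩
    obtain ⟨y, rfl⟩ := hS hw
    have h2 : j (q y) ∈ closure (j '' (q '' (Subtype.val ⁻¹' S'))) := by
      rw [← Set.mem_preimage, ← hj.closure_eq_preimage_closure_image]
      exact hSS' ⟨y, hw, rfl⟩
    change p y ∈ _
    rw [← hq y]
    refine closure_mono ?_ h2
    rintro _ ⟨_, ⟨z, hz, rfl⟩, rfl⟩
    exact ⟨(z, 0), ⟨hz, rfl⟩, (hq z).symm⟩
  · rintro _ ⟨z, hz, rfl⟩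
    exact ⟨(z, 0), ⟨hz, rfl⟩, rfl⟩

end Tools

theorem isClosed_submodule {W : Type*} [AddCommGroup W] [Module ℂ W] (U : Submodule ℂ W) :
    IsClosed[zariski W] (U : Set W) := by
  refine isClosed_zariski_iff.2 fun w hw => ?_
  by_contra hwU
  obtain ⟨φ, hφ, hφU⟩ := Submodule.exists_le_ker_of_notMem hwU
  exact hφ (hw _ (dual_mem_polyFun φ) fun v hv => hφU hv)

section Isometry

variable {V : Type*} [AddCommGroup V] [Module ℂ V]

/-! ### Adjoints -/

/-- The adjoint of an endomorphism for a non-degenerate bilinear form. -/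
def adj [FiniteDimensional ℂ V] {B : LinearMap.BilinForm ℂ V} (hB : B.Nondegenerate) :
    End ℂ V →ₗ[ℂ] End ℂ V :=
  (LinearEquiv.conj (B.toDual hB).symm).toLinearMap ∘ₗ Module.Dual.transpose

variable {B : LinearMap.BilinForm ℂ V}

theorem End.eq_of_form (hB : B.Nondegenerate) {f g : End ℂ V}
    (h : ∀ v w, B (f v) w = B (g v) w) : f = g := by
  ext v
  have : B (f v) = B (g v) := LinearMap.ext (h v)
  exact LinearMap.ker_eq_bot.1 hB.ker_eq_bot this

variable [FiniteDimensional ℂ V] (hB : B.Nondegenerate)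

theorem form_adj (f : End ℂ V) (v w : V) : B (adj hB f v) w = B v (f w) := by
  have : adj hB f v = (B.toDual hB).symm ((B.toDual hB v).comp f) := rfl
  rw [this, LinearMap.BilinForm.apply_toDual_symm_apply]
  rfl

theorem adj_eq_iff {f g : End ℂ V} : adj hB f = g ↔ ∀ v w, B (g v) w = B v (f w) :=
  ⟨fun h v w => by rw [← h, form_adj], fun h => End.eq_of_form hB fun v w => by rw [form_adj, h]⟩

theorem adj_mul (f g : End ℂ V) : adj hB (f * g) = adj hB g * adj hB f :=
  (adj_eq_iff hB).2 fun v w => by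
    rw [Module.End.mul_apply, form_adj, form_adj, Module.End.mul_apply]

theorem adj_one : adj hB 1 = 1 := (adj_eq_iff hB).2 fun _ _ => rfl

theorem det_adj (f : End ℂ V) : LinearMap.det (adj hB f) = LinearMap.det f := by
  have : adj hB f = ((B.toDual hB).symm : Dual ℂ V →ₗ[ℂ] V) ∘ₗ f.dualMap ∘ₗ
      ((B.toDual hB).symm.symm : V →ₗ[ℂ] Dual ℂ V) := rfl
  rw [this, LinearMap.det_conj, LinearMap.det_dualMap]

theorem form_adj_right (hs : ∀ v w, B v w = B w v) (f : End ℂ V) (v w : V) :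
    B v (adj hB f w) = B (f v) w := by
  rw [hs, form_adj, hs]

theorem adj_adj (hs : ∀ v w, B v w = B w v) (f : End ℂ V) : adj hB (adj hB f) = f :=
  (adj_eq_iff hB).2 fun v w => (form_adj_right hB hs f v w).symm

theorem isometry_iff {g : End ℂ V} : (∀ v w, B (g v) (g w) = B v w) ↔ adj hB g * g = 1 := by
  constructor
  · intro h
    exact End.eq_of_form hB fun v w => by
      rw [Module.End.mul_apply, form_adj, h, Module.End.one_apply]
  · intro h v w
    rw [← form_adj hB, ← Module.End.mul_apply, h, Module.End.one_apply]

/-! ### Isometries and skew endomorphisms commuting with `x` -/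

variable (B) in
/-- The isometries of determinant one that commute with `x`. -/
def specialIsom (x : End ℂ V) : Set (End ℂ V) :=
  {g | (∀ v w, B (g v) (g w) = B v w) ∧ LinearMap.det g = 1 ∧ g * x = x * g}

variable (B) in
/-- The skew-adjoint endomorphisms that commute with `x`. -/
def skewCent (x : End ℂ V) : Submodule ℂ (End ℂ V) where
  carrier := {a | (∀ v w, B (a v) w = -B v (a w)) ∧ a * x = x * a}
  add_mem' {a b} ha hb := ⟨fun v w => by simp [ha.1, hb.1]; ring, by rw [add_mul, mul_add, ha.2, hb.2]⟩
  zero_mem' := ⟨fun v w => by simp, by simp⟩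
  smul_mem' c a ha := ⟨fun v w => by simp [ha.1], by simp [ha.2]⟩

theorem mem_skewCent {a x : End ℂ V} : a ∈ skewCent B x ↔ adj hB a = -a ∧ a * x = x * a := by
  refine and_congr_left fun _ => ?_
  rw [adj_eq_iff]
  refine forall₂_congr fun v w => ?_
  rw [LinearMap.neg_apply, map_neg, LinearMap.neg_apply, neg_eq_iff_eq_neg]

theorem isClosed_specialIsom (x : End ℂ V) : IsClosed[zariski (End ℂ V)] (specialIsom B x) := by
  let _ := zariski (End ℂ V)
  have h1 : ∀ v : V, IsPolyMap fun g : End ℂ V => g v := fun v =>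
    isPolyMap_linear (LinearMap.applyₗ v : End ℂ V →ₗ[ℂ] V)
  refine IsClosed.inter ?_ (IsClosed.inter ?_ ?_)
  · have h2 : {g : End ℂ V | ∀ v w, B (g v) (g w) = B v w} =
        ⋂ v, ⋂ w, {g : End ℂ V | B (g v) (g w) = B v w} := by ext; simp
    change IsClosed {g : End ℂ V | ∀ v w, B (g v) (g w) = B v w}
    rw [h2]
    exact isClosed_iInter fun v => isClosed_iInter fun w => isClosed_eq_of_isPolyMap
      (IsPolyMap.bilin B (h1 v) (h1 w)) (isPolyMap_const _)
  · exact isClosed_eq_of_isPolyMap (isPolyMap_of_mem det_mem_polyFun) (isPolyMap_const _)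
  · exact isClosed_eq_of_isPolyMap (isPolyMap_id.mul (isPolyMap_const x))
      ((isPolyMap_const x).mul isPolyMap_id)

theorem det_one_add_mem_polyFun :
    (fun a : End ℂ V => LinearMap.det (1 + a)) ∈ polyFun (End ℂ V) :=
  ((isPolyMap_const _).add isPolyMap_id).comp_mem det_mem_polyFun

theorem exists_mul_eq_one_of_det_ne_zero {a : End ℂ V} (ha : LinearMap.det a ≠ 0) :
    ∃ c, a * c = 1 :=
  ((LinearMap.isUnit_iff_isUnit_det a).2 (isUnit_iff_ne_zero.2 ha)).exists_right_inv

/-- The Cayley transform `s ↦ 2 (1 + s)⁻¹ - 1 = (1 - s) (1 + s)⁻¹` preserves dimensions. -/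
theorem DimGE.cayley {S : Set (End ℂ V)} (hS : IsClosed[zariski (End ℂ V)] S) {d : ℕ}
    (h : DimGE {s | s ∈ S ∧ LinearMap.det (1 + s) ≠ 0} d) :
    DimGE {g | ∃ s ∈ S, ∃ c, (1 + s) * c = 1 ∧ (1 - s) * c = g} d := by
  let P : Set (End ℂ V × End ℂ V) := {p | p.1 ∈ S ∧ (1 + p.1) * p.2 = 1}
  let f : End ℂ V × End ℂ V → End ℂ V := fun p => (1 - p.1) * p.2
  have hf : IsPolyMap f := ((isPolyMap_const 1).sub isPolyMap_id.fst).mul isPolyMap_id.snd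
  have hP : IsClosed[zariski (End ℂ V × End ℂ V)] P := by
    let _ := zariski (End ℂ V × End ℂ V)
    exact (isClosed_preimage_of_isPolyMap isPolyMap_id.fst hS).inter (isClosed_eq_of_isPolyMap
      (((isPolyMap_const 1).add isPolyMap_id.fst).mul isPolyMap_id.snd) (isPolyMap_const 1))
  have h1 : DimGE P d := by
    refine DimGE.of_image (p := Prod.fst) isPolyMap_id.fst (h.mono ?_)
    rintro s ⟨hs, hs'⟩
    obtain ⟨c, hc⟩ := exists_mul_eq_one_of_det_ne_zero hs'
    exact ⟨(s, c), ⟨hs, hc⟩, rfl⟩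
  have h2 : ∀ p ∈ P, f p = (2 : ℂ) • p.2 - 1 := fun p hp => by
    have h3 : f p = (2 : ℂ) • p.2 - (1 + p.1) * p.2 := by
      simp only [f, sub_mul, add_mul, one_mul, two_smul]; abel
    rw [h3, hp.2]
  have hinj : Set.InjOn f P := by
    rintro ⟨s, c⟩ hp ⟨s', c'⟩ hp' heq
    rw [h2 _ hp, h2 _ hp', sub_left_inj] at heq
    obtain rfl : c = c' := smul_right_injective _ (two_ne_zero (α := ℂ)) heq
    have h4 : c * (1 + s) = 1 := mul_eq_one_comm.1 hp.2
    have h5 : 1 + s = 1 + s' := by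
      calc 1 + s = (1 + s') * c * (1 + s) := by rw [show (1 + s') * c = 1 from hp'.2, one_mul]
        _ = 1 + s' := by rw [mul_assoc, h4, mul_one]
    rw [add_right_inj] at h5
    rw [h5]
  refine (h1.image_of_injOn (isPolyImage_of_isClosed hP) hf hinj).mono ?_
  rintro _ ⟨⟨s, c⟩, ⟨hs, hc⟩, rfl⟩
  exact ⟨s, hs, c, hc, rfl⟩

include hB in
/-- The Cayley transform `(1 - a)(1 + a)⁻¹` of a skew-adjoint endomorphism is an isometry, automatically
of determinant one. -/
theorem cayley_mem_specialIsom {x a c : End ℂ V} (ha : a ∈ skewCent B x) (hc : (1 + a) * c = 1) :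
    (1 - a) * c ∈ specialIsom B x := by
  rw [mem_skewCent hB] at ha
  obtain ⟨ha, hax⟩ := ha
  have hc' : c * (1 + a) = 1 := mul_eq_one_comm.1 hc
  have h1 : adj hB (1 + a) = 1 - a := by rw [map_add, adj_one, ha, sub_eq_add_neg]
  have h1' : adj hB (1 - a) = 1 + a := by rw [map_sub, adj_one, ha, sub_neg_eq_add]
  have h2 : adj hB c * (1 - a) = 1 := by rw [← h1, ← adj_mul, hc, adj_one]
  refine ⟨(isometry_iff hB).2 ?_, ?_, ?_⟩
  · rw [adj_mul, h1']
    calc adj hB c * (1 + a) * ((1 - a) * c) = adj hB c * (1 - a) * ((1 + a) * c) := by noncomm_ring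
      _ = 1 := by rw [h2, hc, one_mul]
  · rw [map_mul, ← h1, det_adj, ← map_mul, hc, map_one]
  · have hcx : c * x = x * c := by
      calc c * x = c * (x * (1 + a)) * c := by rw [mul_assoc, mul_assoc, hc, mul_one]
        _ = c * (1 + a) * (x * c) := by rw [mul_add, mul_one, ← hax]; noncomm_ring
        _ = x * c := by rw [hc', one_mul]
    calc (1 - a) * c * x = (1 - a) * (x * c) := by rw [mul_assoc, hcx]
      _ = (x - a * x) * c := by noncomm_ring
      _ = x * ((1 - a) * c) := by rw [hax]; noncomm_ring

include hB in
/-- The Cayley transform of an isometry is skew-adjoint. -/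
theorem cayley_mem_skewCent {x k c : End ℂ V} (hk : k ∈ specialIsom B x) (hc : (1 + k) * c = 1) :
    (1 - k) * c ∈ skewCent B x := by
  obtain ⟨hk, -, hkx⟩ := hk
  rw [isometry_iff hB] at hk
  have hc' : c * (1 + k) = 1 := mul_eq_one_comm.1 hc
  have h1 : adj hB c * (1 + adj hB k) = 1 := by
    rw [← adj_one hB, ← map_add, ← adj_mul, hc]
  have h1' : (1 + adj hB k) * adj hB c = 1 := mul_eq_one_comm.1 h1
  rw [mem_skewCent hB]
  constructor
  · rw [adj_mul, map_sub, adj_one]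
    calc adj hB c * (1 - adj hB k) = adj hB c * ((1 - adj hB k) * (1 + k)) * c := by
          rw [mul_assoc, mul_assoc, hc, mul_one]
      _ = adj hB c * (-((1 + adj hB k) * (1 - k))) * c := by
          congr 2
          have : adj hB k * k = 1 := hk
          calc (1 - adj hB k) * (1 + k) = 1 + k - adj hB k - adj hB k * k := by noncomm_ring
            _ = -(1 - k + adj hB k - adj hB k * k) := by rw [this]; abel
            _ = _ := by noncomm_ring
      _ = -(adj hB c * (1 + adj hB k) * ((1 - k) * c)) := by noncomm_ring
      _ = -((1 - k) * c) := by rw [h1, one_mul]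
  · have hcx : c * x = x * c := by
      calc c * x = c * (x * (1 + k)) * c := by rw [mul_assoc, mul_assoc, hc, mul_one]
        _ = c * (1 + k) * (x * c) := by rw [mul_add, mul_one, ← hkx]; noncomm_ring
        _ = x * c := by rw [hc', one_mul]
    calc (1 - k) * c * x = (1 - k) * (x * c) := by rw [mul_assoc, hcx]
      _ = (x - k * x) * c := by noncomm_ring
      _ = x * ((1 - k) * c) := by rw [hkx]; noncomm_ring

include hB in
/-- The Cayley transform embeds an open subset of the Lie algebra in the stabilizer of `x`. -/
theorem dimGE_specialIsom (x : End ℂ V) : DimGE (specialIsom B x) (finrank ℂ (skewCent B x)) := by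
  have h1 := dimGE_submodule_open (skewCent B x) det_one_add_mem_polyFun (w₀ := 0) (zero_mem _)
    (by simp)
  refine (DimGE.cayley (isClosed_submodule _) h1).mono ?_
  rintro _ ⟨s, hs, c, hc, rfl⟩
  exact cayley_mem_specialIsom hB hs hc

include hB in
/-- The Cayley transform embeds an open subset of each component of the stabilizer of `x`, translated so
as to contain the identity, in the Lie algebra. -/
theorem dimLE_specialIsom (x : End ℂ V) : DimLE (specialIsom B x) (finrank ℂ (skewCent B x)) := by
  intro D hD
  let _ := zariski (End ℂ V)
  have hD' : DimGE (id '' specialIsom B x) D := by rwa [Set.image_id]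
  obtain ⟨C, hC, hCc, hCi, hCD⟩ := hD'.exists_irreducible (isClosed_specialIsom x)
  rw [Set.image_id] at hCD
  obtain ⟨g, hg⟩ := hCi.nonempty
  have hgO := (isometry_iff hB).1 (hC hg).1
  have hgO' : g * adj hB g = 1 := mul_eq_one_comm.1 hgO
  -- translate so that the component contains the identity
  have hl : ∀ a : End ℂ V, IsPolyMap fun k : End ℂ V => a * k := fun a =>
    (isPolyMap_const a).mul isPolyMap_id
  have himg : (fun k => adj hB g * k) '' C = (fun k => g * k) ⁻¹' C := by
    ext k
    constructor
    · rintro ⟨c, hc, rfl⟩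
      change g * (adj hB g * c) ∈ C
      rwa [← mul_assoc, hgO', one_mul]
    · intro hk
      exact ⟨g * k, hk, by change adj hB g * (g * k) = k; rw [← mul_assoc, hgO, one_mul]⟩
  have hCi' := hCi.image (fun k => adj hB g * k) (hl _).continuous.continuousOn
  have hCD' : DimGE ((fun k => adj hB g * k) '' C) D :=
    hCD.image_of_leftInv (hl g) fun k _ => by rw [← mul_assoc, hgO', one_mul]
  rw [himg] at hCi' hCD'
  have h1 := hCD'.principalOpen hCi' det_one_add_mem_polyFun ⟨1, by simpa using hg, by
    rw [one_add_one_eq_two, ← map_ofNat (algebraMap ℂ (End ℂ V)) 2, Algebra.algebraMap_eq_smul_one,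
      LinearMap.det_smul, map_one, mul_one]
    exact pow_ne_zero _ two_ne_zero⟩
  refine dimLE_submodule (skewCent B x) D
    ((DimGE.cayley (isClosed_preimage_of_isPolyMap (hl g) hCc) h1).mono ?_)
  rintro _ ⟨s, hs, c, hc, rfl⟩
  refine cayley_mem_skewCent hB ⟨?_, ?_, ?_⟩ hc
  · obtain ⟨h2, -, -⟩ := hC hs
    obtain ⟨h3, -, -⟩ := hC hg
    exact fun v w => (h3 _ _).symm.trans (h2 v w)
  · have h2 := (hC hs).2.1
    rwa [map_mul, (hC hg).2.1, one_mul] at h2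
  · have h2 := (hC hs).2.2
    have h3 := (hC hg).2.2
    calc s * x = adj hB g * (g * s * x) := by rw [mul_assoc, ← mul_assoc, hgO, one_mul]
      _ = adj hB g * (g * x) * s := by rw [h2, h3]; noncomm_ring
      _ = x * s := by rw [← mul_assoc, hgO, one_mul]

/-! ### Dimensions of orbits -/

/-- The orbit of `x` under the special isometries. -/
def orbitSet (x : End ℂ V) : Set (End ℂ V) := (fun k => k * x * adj hB k) '' specialIsom B 0

theorem isPolyMap_conj (x : End ℂ V) : IsPolyMap fun k => k * x * adj hB k :=
  (isPolyMap_id.mul (isPolyMap_const x)).mul (isPolyMap_linear (adj hB))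

/-- The fibres of the orbit map are the cosets of the stabilizer. -/
theorem fibre_conj_eq (x : End ℂ V) {k₀ : End ℂ V} (hk₀ : k₀ ∈ specialIsom B 0) :
    {s | s ∈ specialIsom B 0 ∧ s * x * adj hB s = k₀ * x * adj hB k₀} =
      (fun k => k₀ * k) '' specialIsom B x := by
  have h0 : adj hB k₀ * k₀ = 1 := (isometry_iff hB).1 hk₀.1
  have h0' : k₀ * adj hB k₀ = 1 := mul_eq_one_comm.1 h0
  ext s
  constructor
  · rintro ⟨hs, hsx⟩
    have h1 : adj hB s * s = 1 := (isometry_iff hB).1 hs.1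
    have h1' : s * adj hB s = 1 := mul_eq_one_comm.1 h1
    refine ⟨adj hB k₀ * s, ⟨(isometry_iff hB).2 ?_, ?_, ?_⟩, ?_⟩
    · rw [adj_mul, mul_assoc, ← mul_assoc (adj hB (adj hB k₀))]
      have h2 : adj hB (adj hB k₀) * adj hB k₀ = 1 := by rw [← adj_mul, h0', adj_one]
      rw [h2, one_mul, h1]
    · rw [map_mul, det_adj, hk₀.2.1, hs.2.1, one_mul]
    · calc adj hB k₀ * s * x = adj hB k₀ * (s * x * adj hB s) * s := by
            simp only [mul_assoc, h1, mul_one]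
        _ = adj hB k₀ * k₀ * x * (adj hB k₀ * s) := by rw [hsx]; noncomm_ring
        _ = x * (adj hB k₀ * s) := by rw [h0, one_mul]
    · change k₀ * (adj hB k₀ * s) = s
      rw [← mul_assoc, h0', one_mul]
  · rintro ⟨k, hk, rfl⟩
    have h1 : adj hB k * k = 1 := (isometry_iff hB).1 hk.1
    have h1' : k * adj hB k = 1 := mul_eq_one_comm.1 h1
    refine ⟨⟨fun v w => (hk₀.1 _ _).trans (hk.1 v w), ?_, by simp⟩, ?_⟩
    · change LinearMap.det (k₀ * k) = 1
      rw [map_mul, hk₀.2.1, hk.2.1, one_mul]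
    · change k₀ * k * x * adj hB (k₀ * k) = _
      calc k₀ * k * x * adj hB (k₀ * k) = k₀ * (k * x) * adj hB k * adj hB k₀ := by
            rw [adj_mul]; noncomm_ring
        _ = k₀ * x * (k * adj hB k) * adj hB k₀ := by rw [hk.2.2]; noncomm_ring
        _ = k₀ * x * adj hB k₀ := by rw [h1', mul_one]

/-- The orbit-stabilizer formula for dimensions. -/
theorem exists_dim_orbitSet (x : End ℂ V) : ∃ o, o + finrank ℂ (skewCent B x) =
    finrank ℂ (skewCent B 0) ∧ DimGE (orbitSet hB x) o ∧ DimLE (orbitSet hB x) o := by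
  have hne : (orbitSet hB x).Nonempty := (dimGE_specialIsom hB 0).nonempty.image _
  have hl : ∀ a : End ℂ V, IsPolyMap fun k : End ℂ V => a * k := fun a =>
    (isPolyMap_const a).mul isPolyMap_id
  refine ⟨zdim (orbitSet hB x), le_antisymm ?_ ?_, dimGE_zdim hne, dimLE_zdim⟩
  · refine dimLE_specialIsom hB 0 _ ((dimGE_zdim hne).of_fibres (isPolyMap_conj hB x) ?_)
    rintro _ ⟨k₀, hk₀, rfl⟩
    rw [fibre_conj_eq hB x hk₀]
    refine (dimGE_specialIsom hB x).image_of_leftInv (hl (adj hB k₀)) fun k _ => ?_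
    rw [← mul_assoc, (isometry_iff hB).1 hk₀.1, one_mul]
  · refine (isPolyImage_of_isClosed (isClosed_specialIsom 0)).dimLE (isPolyMap_conj hB x) dimLE_zdim
      ?_ _ (dimGE_specialIsom hB 0)
    rintro _ ⟨k₀, hk₀, rfl⟩
    rw [fibre_conj_eq hB x hk₀]
    exact (dimLE_specialIsom hB x).image (hl k₀)

end Isometry

/-! ### Ranks of powers, block counts and centralizers -/

section Jordan

variable {V : Type*} [AddCommGroup V] [Module ℂ V]

/-- The number of Jordan blocks of size more than `j` of a nilpotent endomorphism, computed as a
difference of ranks. -/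
def blockCount (x : End ℂ V) (j : ℕ) : ℕ :=
  finrank ℂ (LinearMap.range (x ^ j)) - finrank ℂ (LinearMap.range (x ^ (j + 1)))

/-- The centralizer of an endomorphism, as a subspace. -/
def cent (x : End ℂ V) : Submodule ℂ (End ℂ V) where
  carrier := {a | a * x = x * a}
  add_mem' {a b} ha hb := by
    change (a + b) * x = x * (a + b)
    rw [add_mul, mul_add, show a * x = x * a from ha, show b * x = x * b from hb]
  zero_mem' := by simp
  smul_mem' c a ha := by
    change (c • a) * x = x * (c • a)
    rw [smul_mul_assoc, mul_smul_comm, show a * x = x * a from ha]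

theorem mem_cent {a x : End ℂ V} : a ∈ cent x ↔ a * x = x * a := Iff.rfl

section JordanBasis

variable {x : End ℂ V} {s : ℕ} {lam : Fin s → ℕ} {b : Basis (Σ i : Fin s, Fin (lam i)) ℂ V}

/-- The members of the strings of a Jordan basis, continued by zero. -/
def jordanVec (b : Basis (Σ i : Fin s, Fin (lam i)) ℂ V) (i : Fin s) (k : ℕ) : V :=
  if h : k < lam i then b ⟨i, ⟨k, h⟩⟩ else 0

theorem jordanVec_coe (i : Fin s) (k : Fin (lam i)) : jordanVec b i k = b ⟨i, k⟩ :=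
  dif_pos k.2

variable (hb : ∀ (i : Fin s) (j : Fin (lam i)),
    x (b ⟨i, j⟩) = if h : (j : ℕ) + 1 < lam i then b ⟨i, ⟨j + 1, h⟩⟩ else 0)

include hb in
theorem pow_jordanVec (i : Fin s) (k j : ℕ) : (x ^ j) (jordanVec b i k) = jordanVec b i (k + j) := by
  have h1 : ∀ k, x (jordanVec b i k) = jordanVec b i (k + 1) := by
    intro k
    by_cases h : k < lam i
    · rw [jordanVec, dif_pos h, hb]
      rfl
    · rw [jordanVec, dif_neg h, map_zero, jordanVec, dif_neg (by omega)]
  induction j with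
  | zero => rfl
  | succ j ih => rw [pow_succ', Module.End.mul_apply, ih, h1, add_assoc]

include hb in
/-- A string of length `l` contributes `l - j` vectors (none if `l ≤ j`) to a basis of the range of
`x ^ j`. -/
theorem finrank_range_pow_of_jordan (j : ℕ) :
    finrank ℂ (LinearMap.range (x ^ j)) = ∑ i, (lam i - j) := by
  let f : (Σ i : Fin s, Fin (lam i - j)) → V := fun p => jordanVec b p.1 (p.2 + j)
  have hf : LinearIndependent ℂ f := by
    let g : (Σ i : Fin s, Fin (lam i - j)) → Σ i : Fin s, Fin (lam i) :=
      fun p => ⟨p.1, ⟨p.2 + j, by have := p.2.2; omega⟩⟩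
    have hg : Function.Injective g := by
      rintro ⟨i, k⟩ ⟨i', k'⟩ h
      simp only [g, Sigma.mk.injEq] at h
      obtain ⟨rfl, h⟩ := h
      have := congrArg Fin.val (eq_of_heq h)
      simp only [Nat.add_right_cancel_iff] at this
      rw [Fin.ext this]
    have := b.linearIndependent.comp g hg
    convert this using 1
    ext p
    have h1 := p.2.2
    simp only [f, g, jordanVec, Function.comp]
    rw [dif_pos (by omega)]
  have hspan : LinearMap.range (x ^ j) = Submodule.span ℂ (Set.range f) := by
    rw [LinearMap.range_eq_map, ← b.span_eq, Submodule.map_span, ← Set.range_comp]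
    apply le_antisymm <;> rw [Submodule.span_le]
    · rintro _ ⟨⟨i, k⟩, rfl⟩
      change (x ^ j) (b ⟨i, k⟩) ∈ _
      rw [← jordanVec_coe, pow_jordanVec hb]
      by_cases h : k + j < lam i
      · exact Submodule.subset_span ⟨⟨i, ⟨k, by omega⟩⟩, rfl⟩
      · rw [jordanVec, dif_neg h]
        exact zero_mem _
    · rintro _ ⟨⟨i, k⟩, rfl⟩
      refine Submodule.subset_span ⟨⟨i, ⟨k, by omega⟩⟩, ?_⟩
      change (x ^ j) (b ⟨i, _⟩) = _
      rw [← jordanVec_coe, pow_jordanVec hb]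
  rw [hspan, finrank_span_eq_card hf]
  simp

include hb in
theorem finrank_ker_pow_of_jordan (j : ℕ) :
    finrank ℂ (LinearMap.ker (x ^ j)) = ∑ i, min (lam i) j := by
  have : FiniteDimensional ℂ V := .of_basis b
  have h1 := LinearMap.finrank_range_add_finrank_ker (x ^ j)
  rw [finrank_range_pow_of_jordan hb, finrank_eq_card_basis b] at h1
  have h2 : ∑ i, lam i = ∑ i, (lam i - j) + ∑ i, min (lam i) j := by
    rw [← Finset.sum_add_distrib]
    exact Finset.sum_congr rfl fun i _ => by omega
  simp only [Fintype.card_sigma, Fintype.card_fin] at h1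
  omega

include hb in
theorem blockCount_of_jordan (j : ℕ) : blockCount x j = ∑ i, if j < lam i then 1 else 0 := by
  rw [blockCount, finrank_range_pow_of_jordan hb, finrank_range_pow_of_jordan hb]
  have h2 : ∑ i, (lam i - j) = ∑ i, (lam i - (j + 1)) + ∑ i, if j < lam i then 1 else 0 := by
    rw [← Finset.sum_add_distrib]
    exact Finset.sum_congr rfl fun i _ => by split_ifs <;> omega
  omega

include hb in
/-- An endomorphism commuting with `x` is determined by its values on the generators of the strings,
and the generator of a string of length `l` may go to any vector killed by `x ^ l`. -/
theorem finrank_cent_of_jordan : finrank ℂ (cent x) = ∑ i, ∑ k, min (lam k) (lam i) := by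
  have : FiniteDimensional ℂ V := .of_basis b
  let Φ : cent x →ₗ[ℂ] (i : Fin s) → LinearMap.ker (x ^ lam i) :=
    LinearMap.pi fun i => LinearMap.codRestrict _
      ((LinearMap.applyₗ (jordanVec b i 0)).comp (cent x).subtype) fun a => by
        have h1 : Commute a.1 (x ^ lam i) := Commute.pow_right a.2 _
        have h2 := LinearMap.congr_fun h1.eq (jordanVec b i 0)
        rw [Module.End.mul_apply, Module.End.mul_apply, pow_jordanVec hb] at h2
        rw [LinearMap.mem_ker]
        refine h2.symm.trans ?_
        rw [jordanVec, dif_neg (by omega), map_zero]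
  have hΦ : ∀ a i, (Φ a i : V) = a.1 (jordanVec b i 0) := fun a i => rfl
  have hinj : Function.Injective Φ := by
    intro a a' h
    refine Subtype.ext (b.ext ?_)
    rintro ⟨i, k⟩
    have h1 : ∀ a : cent x, a.1 (b ⟨i, k⟩) = (x ^ (k : ℕ)) (Φ a i : V) := fun a => by
      have h1 : Commute a.1 (x ^ (k : ℕ)) := Commute.pow_right a.2 _
      rw [hΦ, ← Module.End.mul_apply, ← h1.eq, Module.End.mul_apply, pow_jordanVec hb, zero_add,
        jordanVec_coe]
    rw [h1, h1, h]
  have hsurj : Function.Surjective Φ := by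
    intro u
    let a : End ℂ V := b.constr ℂ fun p => (x ^ (p.2 : ℕ)) (u p.1 : V)
    have ha : ∀ i (k : Fin (lam i)), a (b ⟨i, k⟩) = (x ^ (k : ℕ)) (u i : V) := fun i k =>
      b.constr_basis ℂ _ _
    have hu : ∀ i, (x ^ lam i) (u i : V) = 0 := fun i => (u i).2
    have hax : a * x = x * a := by
      refine b.ext ?_
      rintro ⟨i, k⟩
      rw [Module.End.mul_apply, Module.End.mul_apply, hb, ha, ← Module.End.mul_apply, ← pow_succ']
      split_ifs with h
      · rw [ha]
      · rw [map_zero, show (k : ℕ) + 1 = lam i by omega, hu]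
    refine ⟨⟨a, hax⟩, funext fun i => Subtype.ext ?_⟩
    rw [hΦ]
    change a (jordanVec b i 0) = _
    rw [jordanVec]
    split_ifs with h
    · rw [ha]; rfl
    · rw [map_zero]
      have h0 : ∀ (l : ℕ) (v : V), l = 0 → (x ^ l) v = 0 → v = 0 := by
        rintro _ v rfl hv
        exact hv
      exact (h0 _ _ (by omega) (hu i)).symm
  rw [(LinearEquiv.ofBijective Φ ⟨hinj, hsurj⟩).finrank_eq, finrank_pi_fintype]
  exact Finset.sum_congr rfl fun i _ => finrank_ker_pow_of_jordan hb _

end JordanBasis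

theorem HasJordanType.blockCount {x : End ℂ V} {s : ℕ} {lam : Fin s → ℕ}
    (h : HasJordanType x lam) (j : ℕ) : blockCount x j = ∑ i, if j < lam i then 1 else 0 :=
  let ⟨_, hb⟩ := h
  blockCount_of_jordan hb j

theorem HasJordanType.finrank_eq {x : End ℂ V} {s : ℕ} {lam : Fin s → ℕ}
    (h : HasJordanType x lam) : finrank ℂ V = ∑ i, lam i := by
  obtain ⟨b, -⟩ := h
  rw [finrank_eq_card_basis b]
  simp

theorem sum_indicator_lt {m : ℕ} {a : ℕ} (ha : a ≤ m) :
    ∑ j ∈ Finset.range m, (if j < a then 1 else 0) = a := by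
  rw [← Finset.sum_filter, Finset.sum_const, smul_eq_mul, mul_one]
  have : Finset.filter (fun j => j < a) (Finset.range m) = Finset.range a := by
    ext j; simp; omega
  rw [this, Finset.card_range]

theorem HasJordanType.le_finrank {x : End ℂ V} {s : ℕ} {lam : Fin s → ℕ}
    (h : HasJordanType x lam) (i : Fin s) : lam i ≤ finrank ℂ V := by
  rw [h.finrank_eq]
  exact Finset.single_le_sum (f := lam) (fun _ _ => Nat.zero_le _) (Finset.mem_univ i)

theorem HasJordanType.sum_blockCount {x : End ℂ V} {s : ℕ} {lam : Fin s → ℕ}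
    (h : HasJordanType x lam) :
    ∑ j ∈ Finset.range (finrank ℂ V), SymResolution.blockCount x j = finrank ℂ V := by
  simp only [h.blockCount]
  rw [Finset.sum_comm]
  conv_rhs => rw [h.finrank_eq]
  exact Finset.sum_congr rfl fun i _ => sum_indicator_lt (h.le_finrank i)

/-- The dimension of the centralizer in terms of the block counts: the classical `∑ r_j²`. -/
theorem HasJordanType.finrank_cent {x : End ℂ V} {s : ℕ} {lam : Fin s → ℕ}
    (h : HasJordanType x lam) : finrank ℂ (cent x) =
      ∑ j ∈ Finset.range (finrank ℂ V), SymResolution.blockCount x j ^ 2 := by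
  obtain ⟨b, hb⟩ := id h
  rw [finrank_cent_of_jordan hb]
  have key : ∀ i k, min (lam k) (lam i) = ∑ j ∈ Finset.range (finrank ℂ V),
      (if j < lam i then 1 else 0) * (if j < lam k then 1 else 0) := fun i k => by
    rw [← sum_indicator_lt (m := finrank ℂ V) (a := min (lam k) (lam i))
      ((min_le_right _ _).trans (h.le_finrank i))]
    refine Finset.sum_congr rfl fun j _ => ?_
    by_cases h1 : j < lam i <;> by_cases h2 : j < lam k <;> simp [h1, h2]
  simp only [h.blockCount, sq, Finset.sum_mul_sum, key]
  have h1 : ∀ i, ∑ k, ∑ j ∈ Finset.range (finrank ℂ V), (if j < lam i then 1 else 0) *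
      (if j < lam k then 1 else 0) = ∑ j ∈ Finset.range (finrank ℂ V), ∑ k,
      (if j < lam i then 1 else 0) * (if j < lam k then 1 else 0) := fun i => Finset.sum_comm
  simp only [h1]
  exact Finset.sum_comm

end Jordan

/-! ### The trace form and the dimension of the stabilizer -/

theorem finrank_range_flip {M N : Type*} [AddCommGroup M] [Module ℂ M] [AddCommGroup N] [Module ℂ N]
    [FiniteDimensional ℂ M] [FiniteDimensional ℂ N] (β : M →ₗ[ℂ] N →ₗ[ℂ] ℂ) :
    finrank ℂ (LinearMap.range β.flip) = finrank ℂ (LinearMap.range β) := by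
  have h : β.flip = LinearMap.comp (LinearMap.dualMap β) (evalEquiv ℂ N).toLinearMap := by
    ext n m
    rfl
  rw [h, LinearMap.range_comp_of_range_eq_top _ (LinearEquiv.range _),
    LinearMap.finrank_range_dualMap_eq_finrank_range]

section Trace

variable {V : Type*} [AddCommGroup V] [Module ℂ V] {B : LinearMap.BilinForm ℂ V}

variable (B) in
/-- The self-adjoint endomorphisms that commute with `x`. -/
def symCent (x : End ℂ V) : Submodule ℂ (End ℂ V) where
  carrier := {a | (∀ v w, B (a v) w = B v (a w)) ∧ a * x = x * a}
  add_mem' {a b} ha hb := ⟨fun v w => by simp [ha.1, hb.1], by rw [add_mul, mul_add, ha.2, hb.2]⟩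
  zero_mem' := ⟨fun v w => by simp, by simp⟩
  smul_mem' c a ha := ⟨fun v w => by simp [ha.1], by simp [ha.2]⟩

variable [FiniteDimensional ℂ V] (hB : B.Nondegenerate)

theorem mem_symCent {a x : End ℂ V} : a ∈ symCent B x ↔ adj hB a = a ∧ a * x = x * a := by
  refine and_congr_left fun _ => ?_
  rw [adj_eq_iff]

theorem trace_adj (f : End ℂ V) : LinearMap.trace ℂ V (adj hB f) = LinearMap.trace ℂ V f := by
  have : adj hB f = (B.toDual hB).symm.conj f.dualMap := rfl
  rw [this, LinearMap.trace_conj']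
  exact LinearMap.trace_transpose' f

theorem eq_zero_of_trace_mul {b : End ℂ V} (h : ∀ a, LinearMap.trace ℂ V (b * a) = 0) : b = 0 := by
  ext v
  rw [LinearMap.zero_apply, ← Module.forall_dual_apply_eq_zero_iff ℂ]
  intro φ
  have h1 : b * dualTensorHom ℂ V V (φ ⊗ₜ v) = dualTensorHom ℂ V V (φ ⊗ₜ b v) := by
    ext w
    simp
  have h2 := h (dualTensorHom ℂ V V (φ ⊗ₜ v))
  rwa [h1, LinearMap.trace_eq_contract_apply, contractLeft_apply] at h2

/-- The trace form is non-degenerate on the self-adjoint endomorphisms (`ε = 1`) and on the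
skew-adjoint ones (`ε = -1`). -/
theorem eq_zero_of_trace_mul_of_adj (hs : ∀ v w, B v w = B w v) {ε : ℂ} (hε : ε * ε = 1)
    {b : End ℂ V} (hb : adj hB b = ε • b)
    (h : ∀ a, adj hB a = ε • a → LinearMap.trace ℂ V (b * a) = 0) : b = 0 := by
  refine eq_zero_of_trace_mul fun a => ?_
  have h1 : LinearMap.trace ℂ V (b * adj hB a) = ε * LinearMap.trace ℂ V (b * a) := by
    rw [← trace_adj hB, adj_mul, adj_adj hB hs, hb, mul_smul_comm, map_smul, smul_eq_mul,
      LinearMap.trace_mul_comm]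
  have h2 := h (a + ε • adj hB a) (by
    rw [map_add, map_smul, adj_adj hB hs, smul_add, smul_smul, hε, one_smul, add_comm])
  rw [mul_add, mul_smul_comm, map_add, map_smul, h1, smul_eq_mul, ← mul_assoc, hε, one_mul,
    ← two_mul] at h2
  exact (mul_eq_zero.1 h2).resolve_left two_ne_zero

include hB in
/-- For a self-adjoint `x`, the centralizer is stable under adjunction, so that it is the sum of its
self-adjoint and skew-adjoint parts. -/
theorem finrank_symCent_add_finrank_skewCent (hs : ∀ v w, B v w = B w v) {x : End ℂ V}
    (hx : adj hB x = x) :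
    finrank ℂ (symCent B x) + finrank ℂ (skewCent B x) = finrank ℂ (cent x) := by
  rw [← Submodule.finrank_sup_add_finrank_inf_eq]
  have h1 : symCent B x ⊓ skewCent B x = ⊥ := by
    rw [eq_bot_iff]
    rintro a ⟨ha, ha'⟩
    have h1 := ((mem_symCent hB).1 ha).1
    have h2 := ((mem_skewCent hB).1 ha').1
    have h3 : (2 : ℂ) • a = 0 := by
      rw [two_smul]
      exact add_eq_zero_iff_eq_neg.2 (h1.symm.trans h2)
    exact (smul_eq_zero.1 h3).resolve_left two_ne_zero
  have h2 : symCent B x ⊔ skewCent B x = cent x := by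
    apply le_antisymm
    · exact sup_le (fun a ha => ha.2) fun a ha => ha.2
    · intro a ha
      have ha' : adj hB a * x = x * adj hB a := by
        have := congrArg (adj hB) (mem_cent.1 ha)
        rw [adj_mul, adj_mul, hx] at this
        exact this.symm
      rw [show a = (2⁻¹ : ℂ) • (a + adj hB a) + (2⁻¹ : ℂ) • (a - adj hB a) by
        rw [← smul_add, add_add_sub_cancel, ← two_smul ℂ a, inv_smul_smul₀ two_ne_zero]]
      refine Submodule.add_mem_sup (Submodule.smul_mem _ _ ((mem_symCent hB).2 ⟨?_, ?_⟩))
        (Submodule.smul_mem _ _ ((mem_skewCent hB).2 ⟨?_, ?_⟩))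
      · rw [map_add, adj_adj hB hs, add_comm]
      · rw [add_mul, mul_add, mem_cent.1 ha, ha']
      · rw [map_sub, adj_adj hB hs, neg_sub]
      · rw [sub_mul, mul_sub, mem_cent.1 ha, ha']
  rw [h1, h2, finrank_bot, add_zero]

include hB in
/-- The commutator with `x` maps skew-adjoint to self-adjoint endomorphisms and conversely, and these
two maps are transposes of each other up to sign, for the trace form. -/
theorem finrank_symCent_sub (hs : ∀ v w, B v w = B w v) {x : End ℂ V} (hx : adj hB x = x) :
    finrank ℂ (skewCent B 0) + finrank ℂ (symCent B x) =
      finrank ℂ (symCent B 0) + finrank ℂ (skewCent B x) := by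
  let t : End ℂ V →ₗ[ℂ] End ℂ V →ₗ[ℂ] ℂ :=
    (LinearMap.mul ℂ (End ℂ V)).compr₂ (LinearMap.trace ℂ V)
  let c : End ℂ V →ₗ[ℂ] End ℂ V := LinearMap.mulLeft ℂ x - LinearMap.mulRight ℂ x
  have hc : ∀ a, c a = x * a - a * x := fun a => rfl
  have ht : ∀ a b, t a b = LinearMap.trace ℂ V (a * b) := fun a b => rfl
  let β : skewCent B 0 →ₗ[ℂ] symCent B 0 →ₗ[ℂ] ℂ :=
    (t.comp c).domRestrict₁₂ (skewCent B 0) (symCent B 0)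
  have hβ : ∀ a b, β a b = LinearMap.trace ℂ V ((x * a.1 - a.1 * x) * b.1) := fun a b => rfl
  have hβ' : ∀ a b, β a b = - LinearMap.trace ℂ V ((x * b.1 - b.1 * x) * a.1) := fun a b => by
    have h1 : LinearMap.trace ℂ V (a.1 * x * b.1) = LinearMap.trace ℂ V (x * b.1 * a.1) := by
      rw [mul_assoc, LinearMap.trace_mul_comm]
    have h2 : LinearMap.trace ℂ V (x * a.1 * b.1) = LinearMap.trace ℂ V (b.1 * x * a.1) := by
      rw [LinearMap.trace_mul_comm, mul_assoc]
    rw [hβ, sub_mul, sub_mul, map_sub, map_sub, h1, h2, neg_sub]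
  have hker : (LinearMap.ker β).map (skewCent B 0).subtype = skewCent B x := by
    ext a
    constructor
    · rintro ⟨a, ha, rfl⟩
      refine ⟨a.2.1, ?_⟩
      have ha1 := ((mem_skewCent hB).1 a.2).1
      have h0 : x * a.1 - a.1 * x = 0 := by
        refine eq_zero_of_trace_mul_of_adj hB hs (ε := 1) (one_mul 1) ?_ fun b hb => ?_
        · rw [map_sub, adj_mul, adj_mul, hx, ha1, one_smul]
          noncomm_ring
        · rw [one_smul] at hb
          exact LinearMap.congr_fun ha ⟨b, (mem_symCent hB).2 ⟨hb, by simp⟩⟩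
      exact (sub_eq_zero.1 h0).symm
    · rintro ⟨h1, h2⟩
      refine ⟨⟨a, h1, by simp⟩, ?_, rfl⟩
      refine LinearMap.ext fun b => ?_
      rw [hβ, LinearMap.zero_apply]
      change LinearMap.trace ℂ V ((x * a - a * x) * b.1) = 0
      rw [h2, sub_self, zero_mul, map_zero]
  have hker' : (LinearMap.ker β.flip).map (symCent B 0).subtype = symCent B x := by
    ext b
    constructor
    · rintro ⟨b, hb, rfl⟩
      refine ⟨b.2.1, ?_⟩
      have hb1 := ((mem_symCent hB).1 b.2).1
      have h0 : x * b.1 - b.1 * x = 0 := by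
        refine eq_zero_of_trace_mul_of_adj hB hs (ε := -1) (by norm_num) ?_ fun a ha => ?_
        · rw [map_sub, adj_mul, adj_mul, hx, hb1, neg_one_smul, neg_sub]
        · rw [neg_one_smul] at ha
          have h3 : β ⟨a, (mem_skewCent hB).2 ⟨ha, by simp⟩⟩ b = 0 :=
            LinearMap.congr_fun hb ⟨a, (mem_skewCent hB).2 ⟨ha, by simp⟩⟩
          rw [hβ', neg_eq_zero] at h3
          exact h3
      exact (sub_eq_zero.1 h0).symm
    · rintro ⟨h1, h2⟩
      refine ⟨⟨b, h1, by simp⟩, ?_, rfl⟩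
      refine LinearMap.ext fun a => ?_
      rw [LinearMap.flip_apply, hβ', LinearMap.zero_apply]
      change -LinearMap.trace ℂ V ((x * b - b * x) * a.1) = 0
      rw [h2, sub_self, zero_mul, map_zero, neg_zero]
  have e1 := LinearMap.finrank_range_add_finrank_ker β
  have e2 := LinearMap.finrank_range_add_finrank_ker β.flip
  rw [finrank_range_flip] at e2
  have e3 := (Submodule.equivMapOfInjective _ (skewCent B 0).injective_subtype
    (LinearMap.ker β)).finrank_eq
  have e4 := (Submodule.equivMapOfInjective _ (symCent B 0).injective_subtype
    (LinearMap.ker β.flip)).finrank_eq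
  rw [hker] at e3
  rw [hker'] at e4
  omega

omit [FiniteDimensional ℂ V] in
include hB in
/-- If the self-adjoint endomorphism `x` has a cyclic vector, every endomorphism commuting with it is
self-adjoint. -/
theorem skewCent_eq_bot_of_cyclic (hs : ∀ v w, B v w = B w v) {x : End ℂ V}
    (hx : ∀ v w, B (x v) w = B v (x w)) (u : V)
    (hu : Submodule.span ℂ (Set.range fun k => (x ^ k) u) = ⊤) : skewCent B x = ⊥ := by
  have hx' : ∀ (k : ℕ) v w, B ((x ^ k) v) w = B v ((x ^ k) w) := by
    intro k
    induction k with
    | zero => exact fun _ _ => rfl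
    | succ k ih =>
      intro v w
      rw [pow_succ, Module.End.mul_apply, ih, hx, ← Module.End.mul_apply, ← pow_succ', ← pow_succ]
  rw [eq_bot_iff]
  rintro a ⟨ha, hax⟩
  have hak : ∀ k v, a ((x ^ k) v) = (x ^ k) (a v) := fun k v => by
    rw [← Module.End.mul_apply, (Commute.pow_right hax k).eq, Module.End.mul_apply]
  have h1 : ∀ i j, B (a ((x ^ i) u)) ((x ^ j) u) = 0 := by
    intro i j
    have h2 := ha ((x ^ i) u) ((x ^ j) u)
    have h3 : B ((x ^ i) u) (a ((x ^ j) u)) = B (a ((x ^ i) u)) ((x ^ j) u) := by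
      have h4 : (x ^ i) ((x ^ j) (a u)) = (x ^ j) ((x ^ i) (a u)) :=
        LinearMap.congr_fun (Commute.pow_pow (Commute.refl x) i j).eq (a u)
      rw [hak, hak, hx', hs, ← hx', h4]
    rw [h3] at h2
    exact self_eq_neg.1 h2
  have h4 : a = 0 := by
    refine LinearMap.ext_on_range hu fun i => ?_
    have h5 : B (a ((x ^ i) u)) = 0 := LinearMap.ext_on_range hu fun j => h1 i j
    exact LinearMap.ker_eq_bot.1 hB.ker_eq_bot (h5.trans (map_zero B).symm)
  exact h4

include hB in
/-- There is a self-adjoint endomorphism with a single nilpotent Jordan block: the shift along a basis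
with antidiagonal Gram matrix. No non-zero skew-adjoint endomorphism commutes with it. -/
theorem exists_regular_nilpotent (hs : ∀ v w, B v w = B w v) :
    ∃ x : End ℂ V, (∀ v w, B (x v) w = B v (x w)) ∧ HasJordanType x (fun _ : Fin 1 => finrank ℂ V) ∧
      skewCent B x = ⊥ := by
  let N := finrank ℂ V
  let b := finBasis ℂ V
  let B₁ : LinearMap.BilinForm ℂ V := ∑ i, (LinearMap.mul ℂ ℂ).compl₁₂ (b.coord i) (b.coord i.rev)
  have hB₁ : ∀ v w, B₁ v w = ∑ i, b.coord i v * b.coord i.rev w := fun v w => by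
    simp [B₁, LinearMap.sum_apply]
  have hs₁ : ∀ v w, B₁ v w = B₁ w v := fun v w => by
    rw [hB₁, hB₁, ← Equiv.sum_comp Fin.revPerm]
    exact Finset.sum_congr rfl fun i _ => by rw [Fin.revPerm_apply, Fin.rev_rev, mul_comm]
  have hassoc : ∀ B : LinearMap.BilinForm ℂ V, (∀ v w, B v w = B w v) →
      QuadraticMap.associated (R := ℂ) B.toQuadraticMap = B := fun B hs => by
    exact QuadraticMap.associated_left_inverse ℂ hs
  obtain ⟨e⟩ := QuadraticForm.equivalent_of_isAlgClosed B₁.toQuadraticMap B.toQuadraticMap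
    (by
      rw [hassoc _ hs₁]
      intro v hv
      refine b.ext_elem fun i => ?_
      have h1 := hv (b i.rev)
      rw [hB₁, Finset.sum_eq_single i (fun j _ hj => ?_) (by simp)] at h1
      · simpa using h1
      · rw [Basis.coord_apply, Basis.coord_apply, Basis.repr_self, Finsupp.single_eq_of_ne, mul_zero]
        simpa using hj)
    (by rw [hassoc _ hs]; exact hB.1)
  have he : ∀ v w, B (e v) (e w) = B₁ v w := fun v w => by
    have h1 := LinearMap.congr_fun₂ (hassoc _ hs) (e v) (e w)
    have h2 := LinearMap.congr_fun₂ (hassoc _ hs₁) v w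
    rw [QuadraticMap.associated_apply] at h1 h2
    rw [← h1, ← h2, ← map_add, e.map_app, e.map_app, e.map_app]
  -- the basis in which the Gram matrix is the antidiagonal one
  let c : Basis (Fin N) ℂ V := b.map e.toLinearEquiv
  have hc : ∀ i j : Fin N, B (c i) (c j) = if (i : ℕ) + j + 1 = N then 1 else 0 := fun i j => by
    have h1 : ∀ i, c i = e (b i) := fun i => Basis.map_apply _ _ _
    rw [h1, h1, he, hB₁, Finset.sum_eq_single i (fun k _ hk => ?_) (by simp)]
    · rw [Basis.coord_apply, Basis.coord_apply, Basis.repr_self, Basis.repr_self,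
        Finsupp.single_eq_same, one_mul, Finsupp.single_apply]
      refine if_congr ?_ rfl rfl
      rw [Fin.ext_iff, Fin.val_rev]
      omega
    · rw [Basis.coord_apply, Basis.repr_self, Finsupp.single_eq_of_ne hk, zero_mul]
  let x : End ℂ V := c.constr ℂ fun i => if h : (i : ℕ) + 1 < N then c ⟨i + 1, h⟩ else 0
  have hxc : ∀ i, x (c i) = if h : (i : ℕ) + 1 < N then c ⟨i + 1, h⟩ else 0 := fun i =>
    c.constr_basis ℂ _ _
  have hx : ∀ v w, B (x v) w = B v (x w) := by
    have h1 : B.comp x LinearMap.id = B.comp LinearMap.id x := by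
      refine LinearMap.BilinForm.ext_basis c fun i j => ?_
      change B (x (c i)) (c j) = B (c i) (x (c j))
      rw [hxc, hxc]
      split_ifs with h1 h2 h2
      · rw [hc, hc]
        exact if_congr (by simp only; omega) rfl rfl
      · rw [hc, map_zero, if_neg (by simp only; omega)]
      · rw [hc, map_zero, LinearMap.zero_apply, if_neg (by simp only; omega)]
      · rw [map_zero, map_zero, LinearMap.zero_apply]
    exact fun v w => LinearMap.congr_fun₂ h1 v w
  let c' : Basis (Σ _ : Fin 1, Fin N) ℂ V := c.reindex
    ⟨fun j => ⟨0, j⟩, fun p => p.2, fun _ => rfl, fun p => Sigma.ext (Subsingleton.elim _ _) HEq.rfl⟩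
  have hc' : ∀ i j, c' ⟨i, j⟩ = c j := fun i j => by
    rw [Basis.reindex_apply]; rfl
  have hj : ∀ (i : Fin 1) (j : Fin N), x (c' ⟨i, j⟩) =
      if h : (j : ℕ) + 1 < N then c' ⟨i, ⟨j + 1, h⟩⟩ else 0 := fun i j => by
    simp only [hc', hxc]
  refine ⟨x, hx, ⟨c', hj⟩, ?_⟩
  refine skewCent_eq_bot_of_cyclic hB hs hx (jordanVec c' 0 0) ?_
  rw [eq_top_iff, ← c'.span_eq, Submodule.span_le]
  rintro _ ⟨⟨i, j⟩, rfl⟩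
  refine Submodule.subset_span ⟨j, ?_⟩
  change (x ^ (j : ℕ)) (jordanVec c' 0 0) = _
  rw [pow_jordanVec hj, zero_add, Subsingleton.elim 0 i, jordanVec_coe]

include hB in
/-- The dimension of the Lie algebra of the stabilizer of `x`. -/
theorem two_mul_finrank_skewCent (hs : ∀ v w, B v w = B w v) {x : End ℂ V}
    (hx : ∀ v w, B (x v) w = B v (x w)) {s : ℕ} {lam : Fin s → ℕ} (h : HasJordanType x lam) :
    2 * finrank ℂ (skewCent B x) =
      ∑ j ∈ Finset.range (finrank ℂ V), blockCount x j * (blockCount x j - 1) := by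
  obtain ⟨x₀, hx₀, hj₀, hz₀⟩ := exists_regular_nilpotent hB hs
  have e1 := finrank_symCent_sub hB hs ((adj_eq_iff hB).2 hx₀)
  have e2 := finrank_symCent_sub hB hs ((adj_eq_iff hB).2 hx)
  have e3 := finrank_symCent_add_finrank_skewCent hB hs ((adj_eq_iff hB).2 hx₀)
  have e4 := finrank_symCent_add_finrank_skewCent hB hs ((adj_eq_iff hB).2 hx)
  have e5 : finrank ℂ (cent x₀) = finrank ℂ V := by
    obtain ⟨b, hb⟩ := hj₀
    rw [finrank_cent_of_jordan hb]
    simp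
  rw [hz₀, finrank_bot] at e1 e3
  have e6 := h.finrank_cent
  have e7 := h.sum_blockCount
  have e8 : ∑ j ∈ Finset.range (finrank ℂ V), blockCount x j ^ 2 =
      ∑ j ∈ Finset.range (finrank ℂ V), blockCount x j * (blockCount x j - 1) +
      ∑ j ∈ Finset.range (finrank ℂ V), blockCount x j := by
    rw [← Finset.sum_add_distrib]
    refine Finset.sum_congr rfl fun j _ => ?_
    rcases blockCount x j with _ | r
    · rfl
    · rw [Nat.add_sub_cancel]; ring
  omega

end Trace

/-! ### Square roots, conjugacy and Jordan bases -/

section Sqrt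

open Polynomial

theorem prod_X_sub_C_dvd_pow {h : ℂ[X]} (s : Multiset ℂ) (hs : ∀ a ∈ s, h.IsRoot a) :
    (s.map fun a => X - C a).prod ∣ h ^ s.card := by
  induction s using Multiset.induction_on with
  | empty => simp
  | cons a s ih =>
    rw [Multiset.map_cons, Multiset.prod_cons, Multiset.card_cons, pow_succ']
    exact mul_dvd_mul (dvd_iff_isRoot.2 (hs a (Multiset.mem_cons_self a s)))
      (ih fun b hb => hs b (Multiset.mem_cons_of_mem hb))

/-- An invertible endomorphism has a square root which is a polynomial in it: interpolate square
roots of the eigenvalues, and correct the result by Newton's method. -/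
theorem exists_sq_aeval_eq {V : Type*} [AddCommGroup V] [Module ℂ V] [FiniteDimensional ℂ V]
    {s : End ℂ V} (hs : IsUnit s) : ∃ p : ℂ[X], aeval s p * aeval s p = s := by
  let m := minpoly ℂ s
  have hm : m.Monic := minpoly.monic (Algebra.IsIntegral.isIntegral s)
  have hroot : ∀ a ∈ m.roots, a ≠ 0 := by
    rintro a ha rfl
    have h1 : m.IsRoot 0 := (mem_roots'.1 ha).2
    have h2 := End.hasEigenvalue_of_isRoot h1
    obtain ⟨v, hv⟩ := h2.exists_hasEigenvector
    have h3 := hv.apply_eq_smul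
    rw [zero_smul] at h3
    obtain ⟨t, ht⟩ := hs.exists_left_inv
    have h4 := LinearMap.congr_fun ht v
    rw [Module.End.mul_apply, h3, map_zero] at h4
    exact hv.2 h4.symm
  choose r hr using fun a : ℂ => IsAlgClosed.exists_pow_nat_eq a (n := 2) (by norm_num)
  let q : ℂ[X] := Lagrange.interpolate m.roots.toFinset id r
  have hq : ∀ a ∈ m.roots, q.eval a = r a := fun a ha =>
    Lagrange.eval_interpolate_at_node r (Set.injOn_id _) (Multiset.mem_toFinset.2 ha)
  have hdvd : m ∣ (q ^ 2 - X) ^ m.roots.card := by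
    have h1 := prod_X_sub_C_dvd_pow (h := q ^ 2 - X) m.roots fun a ha => by
      rw [IsRoot, eval_sub, eval_pow, eval_X, hq a ha, hr, sub_self]
    rwa [← (IsAlgClosed.splits m).eq_prod_roots_of_monic hm] at h1
  have hcop : IsCoprime q m := by
    rw [isCoprime_iff_aeval_ne_zero_of_isAlgClosed ℂ ℂ]
    intro a
    by_cases ha : a ∈ m.roots
    · left
      rw [coe_aeval_eq_eval, hq a ha]
      intro h0
      have := hr a
      rw [h0] at this
      exact hroot a ha (by rw [← this]; simp)
    · right
      rw [coe_aeval_eq_eval]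
      exact fun h => ha (mem_roots'.2 ⟨hm.ne_zero, h⟩)
  let P : (AdjoinRoot m)[X] := X ^ 2 - C (AdjoinRoot.root m)
  have h1 : IsNilpotent (aeval (AdjoinRoot.mk m q) P) := by
    refine ⟨m.roots.card, ?_⟩
    have : aeval (AdjoinRoot.mk m q) P = AdjoinRoot.mk m (q ^ 2 - X) := by
      simp [P]
    rw [this, ← map_pow]
    exact AdjoinRoot.mk_eq_zero.2 hdvd
  have h2 : IsUnit (aeval (AdjoinRoot.mk m q) (derivative P)) := by
    have h3 : aeval (AdjoinRoot.mk m q) (derivative P) = AdjoinRoot.mk m (C 2 * q) := by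
      rw [map_mul, show (C 2 : ℂ[X]) = 2 from rfl, map_ofNat]
      simp [P, one_add_one_eq_two]
    rw [h3, map_mul]
    obtain ⟨a, b, hab⟩ := hcop
    refine IsUnit.mul (((isUnit_iff_ne_zero.2 (two_ne_zero (α := ℂ))).map C).map (AdjoinRoot.mk m)) ?_
    refine IsUnit.of_mul_eq_one (AdjoinRoot.mk m a) ?_
    rw [← map_mul, ← map_one (AdjoinRoot.mk m), ← hab, map_add, map_mul _ b m, AdjoinRoot.mk_self,
      mul_zero, add_zero, mul_comm]
  obtain ⟨t, ⟨-, ht⟩, -⟩ := existsUnique_nilpotent_sub_and_aeval_eq_zero h1 h2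
  obtain ⟨p, rfl⟩ := AdjoinRoot.mk_surjective t
  refine ⟨p, ?_⟩
  have h4 : AdjoinRoot.mk m (p ^ 2 - X) = 0 := by
    simpa [P] using ht
  have h5 := aeval_eq_zero_of_dvd_aeval_eq_zero (AdjoinRoot.mk_eq_zero.1 h4) (minpoly.aeval ℂ s)
  rw [map_sub, map_pow, aeval_X, sub_eq_zero, sq] at h5
  exact h5

end Sqrt

section Conjugacy

variable {V : Type*} [AddCommGroup V] [Module ℂ V] {B : LinearMap.BilinForm ℂ V}

theorem commute_aeval {s x : End ℂ V} (h : x * s = s * x) (p : Polynomial ℂ) :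
    x * Polynomial.aeval s p = Polynomial.aeval s p * x := by
  induction p using Polynomial.induction_on' with
  | add p q hp hq => rw [map_add, mul_add, add_mul, hp, hq]
  | monomial n a =>
    rw [Polynomial.aeval_monomial, ← mul_assoc, ← Algebra.commutes, mul_assoc, mul_assoc,
      (Commute.pow_right (show Commute x s from h) n).eq]

variable [FiniteDimensional ℂ V] (hB : B.Nondegenerate)

theorem adj_pow (f : End ℂ V) (k : ℕ) : adj hB (f ^ k) = adj hB f ^ k := by
  induction k with
  | zero => rw [pow_zero, pow_zero, adj_one]
  | succ k ih => rw [pow_succ, adj_mul, ih, pow_succ']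

theorem adj_aeval (f : End ℂ V) (p : Polynomial ℂ) :
    adj hB (Polynomial.aeval f p) = Polynomial.aeval (adj hB f) p := by
  induction p using Polynomial.induction_on' with
  | add p q hp hq => rw [map_add, map_add, hp, hq, map_add]
  | monomial n a =>
    rw [Polynomial.aeval_monomial, Polynomial.aeval_monomial, Algebra.algebraMap_eq_smul_one,
      smul_mul_assoc, one_mul, map_smul, adj_pow, smul_mul_assoc, one_mul]

/-- Self-adjoint endomorphisms that are conjugate under the linear group are conjugate under the
special orthogonal group in odd dimension. -/
theorem exists_specialIsom_conj (hs : ∀ v w, B v w = B w v) (hV : Odd (finrank ℂ V)) {x x' : End ℂ V}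
    (hx : adj hB x = x) (hx' : adj hB x' = x') {g : End ℂ V} (hg : IsUnit g) (hgx : g * x = x' * g) :
    ∃ k ∈ specialIsom B 0, x' = k * x * adj hB k := by
  let σ := adj hB g * g
  have hadj : ∀ {f : End ℂ V}, IsUnit f → IsUnit (adj hB f) := fun {f} hf => by
    rw [LinearMap.isUnit_iff_isUnit_det, det_adj]
    exact (LinearMap.isUnit_iff_isUnit_det f).1 hf
  have hσ : IsUnit σ := (hadj hg).mul hg
  have hσadj : adj hB σ = σ := by rw [adj_mul, adj_adj hB hs]
  have hxσ : x * σ = σ * x := by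
    have h1 := congrArg (adj hB) hgx
    rw [adj_mul, adj_mul, hx, hx'] at h1
    rw [← mul_assoc, h1, mul_assoc, ← hgx, mul_assoc]
  obtain ⟨p, hp⟩ := exists_sq_aeval_eq hσ
  let t := Polynomial.aeval σ p
  have htadj : adj hB t = t := by rw [adj_aeval, hσadj]
  have hxt : x * t = t * x := commute_aeval hxσ p
  have ht : IsUnit t := by
    rw [LinearMap.isUnit_iff_isUnit_det] at hσ ⊢
    rw [← hp, map_mul] at hσ
    exact isUnit_of_mul_isUnit_left hσ
  obtain ⟨τ, hτ⟩ := ht.exists_right_inv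
  have hτ' : τ * t = 1 := mul_eq_one_comm.1 hτ
  have hτadj : adj hB τ = τ := by
    have h1 := congrArg (adj hB) hτ
    rw [adj_mul, htadj, adj_one] at h1
    calc adj hB τ = adj hB τ * (t * τ) := by rw [hτ, mul_one]
      _ = τ := by rw [← mul_assoc, h1, one_mul]
  have hxτ : x * τ = τ * x := by
    calc x * τ = τ * t * x * τ := by rw [hτ', one_mul]
      _ = τ * (x * t) * τ := by rw [hxt]; noncomm_ring
      _ = τ * x := by rw [mul_assoc, mul_assoc, hτ, mul_one]
  -- with `t² = g* g` self-adjoint, `k = g t⁻¹` is an isometry: the polar decomposition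
  let k := g * τ
  have hk : adj hB k * k = 1 := by
    calc adj hB k * k = τ * σ * τ := by rw [adj_mul, hτadj]; noncomm_ring
      _ = τ * t * (t * τ) := by rw [← hp]; noncomm_ring
      _ = 1 := by rw [hτ, hτ', one_mul]
  have hk' : k * adj hB k = 1 := mul_eq_one_comm.1 hk
  have hkx : x' = k * x * adj hB k := by
    calc x' = x' * g * τ * adj hB k := by rw [mul_assoc x', mul_assoc, hk', mul_one]
      _ = g * (x * τ) * adj hB k := by rw [← hgx]; noncomm_ring
      _ = k * x * adj hB k := by rw [hxτ]; noncomm_ring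
  have hdet : LinearMap.det k = 1 ∨ LinearMap.det k = -1 := by
    have h1 := congrArg LinearMap.det hk
    rw [map_mul, det_adj, map_one] at h1
    exact mul_self_eq_one_iff.1 h1
  rcases hdet with hdet | hdet
  · exact ⟨k, ⟨(isometry_iff hB).2 hk, hdet, by simp⟩, hkx⟩
  -- in odd dimension, the sign of `k` corrects its determinant
  · refine ⟨-k, ⟨(isometry_iff hB).2 (by rw [map_neg, neg_mul_neg, hk]), ?_, by simp⟩,
      by rw [map_neg, mul_neg, neg_mul, neg_mul, neg_neg, hkx]⟩
    rw [← neg_one_smul ℂ, LinearMap.det_smul, hdet, hV.neg_one_pow]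
    norm_num

end Conjugacy

section JordanExistence

open Polynomial

variable {V : Type*} [AddCommGroup V] [Module ℂ V] [FiniteDimensional ℂ V]

omit [FiniteDimensional ℂ V] in
/-- The powers of `X` form a basis of `ℂ[X] / (X ^ k)`, on which multiplication by `X` is a Jordan
block. -/
theorem exists_basis_quotient_X_pow (k : ℕ) :
    ∃ b : Basis (Fin k) ℂ (ℂ[X] ⧸ (ℂ[X] ∙ (X : ℂ[X]) ^ k)),
      ∀ j, b j = Submodule.Quotient.mk (X ^ (j : ℕ)) := by
  let v : Fin k → ℂ[X] ⧸ (ℂ[X] ∙ (X : ℂ[X]) ^ k) := fun j => Submodule.Quotient.mk (X ^ (j : ℕ))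
  have hsum : ∀ c : Fin k → ℂ, ∑ j, c j • v j =
      Submodule.Quotient.mk (∑ j, c j • (X : ℂ[X]) ^ (j : ℕ)) := fun c => by
    rw [← Submodule.mkQ_apply, map_sum]
    rfl
  have hcoeff : ∀ (c : Fin k → ℂ) (i : Fin k),
      (∑ j, c j • (X : ℂ[X]) ^ (j : ℕ)).coeff i = c i := fun c i => by
    rw [finsetSum_coeff, Finset.sum_eq_single i]
    · simp
    · intro j _ hj
      rw [coeff_smul, coeff_X_pow, if_neg (fun h => hj (Fin.ext h.symm)), smul_zero]
    · simp
  have hli : LinearIndependent ℂ v := by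
    rw [Fintype.linearIndependent_iff]
    intro c hc i
    rw [hsum, Submodule.Quotient.mk_eq_zero, Submodule.mem_span_singleton] at hc
    obtain ⟨q, hq⟩ := hc
    have h1 := X_pow_dvd_iff.1 (⟨q, by rw [← hq, smul_eq_mul, mul_comm]⟩ :
      (X : ℂ[X]) ^ k ∣ ∑ j, c j • (X : ℂ[X]) ^ (j : ℕ)) i i.2
    rwa [hcoeff] at h1
  have hspan : ⊤ ≤ Submodule.span ℂ (Set.range v) := by
    rintro p -
    obtain ⟨p, rfl⟩ := Submodule.Quotient.mk_surjective _ p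
    have h1 : (Submodule.Quotient.mk p : ℂ[X] ⧸ (ℂ[X] ∙ (X : ℂ[X]) ^ k)) =
        ∑ j : Fin k, p.coeff j • v j := by
      rw [hsum, Submodule.Quotient.eq, Submodule.mem_span_singleton]
      have h2 : (X : ℂ[X]) ^ k ∣ p - ∑ j : Fin k, p.coeff j • (X : ℂ[X]) ^ (j : ℕ) := by
        rw [X_pow_dvd_iff]
        intro i hi
        rw [coeff_sub, hcoeff (fun j => p.coeff j) ⟨i, hi⟩, sub_self]
      obtain ⟨q, hq⟩ := h2
      exact ⟨q, by rw [hq, smul_eq_mul, mul_comm]⟩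
    rw [h1]
    exact Submodule.sum_mem _ fun j _ => Submodule.smul_mem _ _ (Submodule.subset_span ⟨j, rfl⟩)
  exact ⟨Basis.mk hli hspan, fun j => Basis.mk_apply _ _ _⟩

/-- Jordan form of a nilpotent endomorphism, from the structure theorem for torsion modules over
`ℂ[X]`. -/
theorem exists_jordan_basis {x : End ℂ V} (hx : IsNilpotent x) : ∃ (d : ℕ) (k : Fin d → ℕ)
    (b : Basis (Σ i, Fin (k i)) ℂ V), ∀ (i : Fin d) (j : Fin (k i)),
      x (b ⟨i, j⟩) = if h : (j : ℕ) + 1 < k i then b ⟨i, ⟨j + 1, h⟩⟩ else 0 := by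
  obtain ⟨m, hm⟩ := hx
  have htors : Module.IsTorsion' (Module.AEval' x) (Submonoid.powers (X : ℂ[X])) := by
    intro v
    refine ⟨⟨X ^ m, ⟨m, rfl⟩⟩, ?_⟩
    obtain ⟨v, rfl⟩ := (Module.AEval'.of x).surjective v
    change (X ^ m : ℂ[X]) • (Module.AEval'.of x v) = 0
    rw [Module.AEval'.X_pow_smul_of, hm, zero_smul, map_zero]
  obtain ⟨d, k, ⟨e⟩⟩ := Module.torsion_by_prime_power_decomposition (irreducible_X (R := ℂ)) htors
  choose pb hpb using fun i => exists_basis_quotient_X_pow (k i)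
  let e' : V ≃ₗ[ℂ] DirectSum (Fin d) fun i => ℂ[X] ⧸ (ℂ[X] ∙ (X : ℂ[X]) ^ k i) :=
    (Module.AEval'.of x).trans (e.restrictScalars ℂ)
  have he : ∀ v, e' (x v) = (X : ℂ[X]) • e' v := fun v => by
    change e (Module.AEval'.of x (x v)) = (X : ℂ[X]) • e (Module.AEval'.of x v)
    rw [← map_smul, Module.AEval'.X_smul_of]
  let bD : Basis (Σ i, Fin (k i)) ℂ (DirectSum (Fin d) fun i => ℂ[X] ⧸ (ℂ[X] ∙ (X : ℂ[X]) ^ k i)) :=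
    DFinsupp.basis pb
  have hbD : ∀ i j, bD ⟨i, j⟩ = DirectSum.of _ i (Submodule.Quotient.mk (X ^ (j : ℕ))) := fun i j => by
    rw [← hpb, Basis.apply_eq_iff]
    ext ⟨i', j'⟩
    change (pb i').repr (DirectSum.of (fun i => ℂ[X] ⧸ (ℂ[X] ∙ (X : ℂ[X]) ^ k i)) i (pb i j) i') j' = _
    by_cases hi : i = i'
    · subst hi
      rw [DirectSum.of_eq_same, Basis.repr_self, Finsupp.single_apply, Finsupp.single_apply]
      exact if_congr (by simp) rfl rfl
    · rw [DirectSum.of_eq_of_ne _ _ _ (Ne.symm hi), map_zero, Finsupp.single_eq_of_ne]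
      · rfl
      · rintro ⟨⟩
        exact hi rfl
  let b : Basis (Σ i, Fin (k i)) ℂ V := bD.map e'.symm
  have hb : ∀ i j, e' (b ⟨i, j⟩) = DirectSum.of _ i (Submodule.Quotient.mk (X ^ (j : ℕ))) :=
    fun i j => by rw [Basis.map_apply, LinearEquiv.apply_symm_apply, hbD]
  refine ⟨d, k, b, fun i j => e'.injective ?_⟩
  rw [he, hb]
  have h1 : (X : ℂ[X]) • DirectSum.of (fun i => ℂ[X] ⧸ (ℂ[X] ∙ (X : ℂ[X]) ^ k i)) i
      (Submodule.Quotient.mk (X ^ (j : ℕ))) =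
        DirectSum.of _ i (Submodule.Quotient.mk (X ^ ((j : ℕ) + 1))) := by
    rw [pow_succ', ← smul_eq_mul (X : ℂ[X]), Submodule.Quotient.mk_smul]
    exact (DirectSum.lof ℂ[X] (Fin d) (fun i => ℂ[X] ⧸ (ℂ[X] ∙ (X : ℂ[X]) ^ k i)) i).map_smul _ _ |>.symm
  rw [h1]
  split_ifs with h
  · rw [hb]
  · have h2 : (Submodule.Quotient.mk (X ^ ((j : ℕ) + 1)) : ℂ[X] ⧸ (ℂ[X] ∙ (X : ℂ[X]) ^ k i)) = 0 := by
      rw [show (j : ℕ) + 1 = k i by omega, Submodule.Quotient.mk_eq_zero]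
      exact Submodule.mem_span_singleton_self _
    rw [h2, map_zero, map_zero]

/-- A nilpotent endomorphism has a Jordan basis, with strings of positive lengths. -/
theorem exists_hasJordanType {x : End ℂ V} (hx : IsNilpotent x) :
    ∃ (s : Fin (finrank ℂ V + 1)) (lam : Fin s → Fin (finrank ℂ V + 1)),
      HasJordanType x (fun i => (lam i : ℕ)) := by
  obtain ⟨d, k, b, hb⟩ := exists_jordan_basis hx
  have hle : ∀ i, k i ≤ finrank ℂ V := fun i => (show HasJordanType x k from ⟨b, hb⟩).le_finrank i
  let ι := {i : Fin d // 0 < k i}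
  have hcard : Fintype.card ι ≤ finrank ℂ V := by
    rw [finrank_eq_card_basis b]
    refine Fintype.card_le_of_injective (fun i : ι => ⟨i.1, ⟨0, i.2⟩⟩) fun i i' h => ?_
    exact Subtype.ext (congrArg Sigma.fst h)
  let ε : Fin (Fintype.card ι) ≃ ι := (Fintype.equivFin ι).symm
  let f : (Σ i : Fin (Fintype.card ι), Fin (k (ε i).1)) → Σ i, Fin (k i) := fun p => ⟨(ε p.1).1, p.2⟩
  have hf : Function.Bijective f := by
    constructor
    · rintro ⟨i, j⟩ ⟨i', j'⟩ h
      obtain rfl : i = i' := ε.injective (Subtype.ext (congrArg Sigma.fst h))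
      have h2 : j = j' := eq_of_heq (Sigma.mk.inj h).2
      rw [h2]
    · rintro ⟨i, j⟩
      obtain ⟨i', hi'⟩ := ε.surjective ⟨i, by have := j.2; omega⟩
      obtain rfl : (ε i').1 = i := congrArg Subtype.val hi'
      exact ⟨⟨i', j⟩, rfl⟩
  let b' := b.reindex (Equiv.ofBijective f hf).symm
  have hb' : ∀ i j, b' ⟨i, j⟩ = b ⟨(ε i).1, j⟩ := fun i j => by
    rw [Basis.reindex_apply]
    rfl
  refine ⟨⟨Fintype.card ι, by omega⟩, fun i => ⟨k (ε i).1, by have := hle (ε i).1; omega⟩, b', ?_⟩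
  intro i j
  change x (b' ⟨i, j⟩) = if h : (j : ℕ) + 1 < k (ε i).1 then b' ⟨i, ⟨j + 1, h⟩⟩ else 0
  simp only [hb', hb]

omit [FiniteDimensional ℂ V] in
theorem HasJordanType.exists_conj {x x' : End ℂ V} {s : ℕ} {lam : Fin s → ℕ}
    (h : HasJordanType x lam) (h' : HasJordanType x' lam) : ∃ g : End ℂ V, IsUnit g ∧ g * x = x' * g := by
  obtain ⟨b, hb⟩ := h
  obtain ⟨b', hb'⟩ := h'
  let g := b.equiv b' (Equiv.refl _)
  have hg : ∀ p, g (b p) = b' p := fun p => b.equiv_apply _ _ _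
  refine ⟨g, ?_, b.ext ?_⟩
  · exact ⟨⟨g, g.symm, by ext; simp, by ext; simp⟩, rfl⟩
  · rintro ⟨i, j⟩
    change g (x (b ⟨i, j⟩)) = x' (g (b ⟨i, j⟩))
    rw [hb, hg, hb']
    split_ifs with h
    · rw [hg]
    · rw [map_zero]

end JordanExistence

/-! ### Reduction along a hyperbolic pair -/

section Rank

variable {V V₂ : Type*} [AddCommGroup V] [Module ℂ V] [FiniteDimensional ℂ V]
  [AddCommGroup V₂] [Module ℂ V₂]

theorem finrank_map_add_finrank_ker_inf (f : V →ₗ[ℂ] V₂) (p : Submodule ℂ V) :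
    finrank ℂ (p.map f) + finrank ℂ (LinearMap.ker f ⊓ p : Submodule ℂ V) = finrank ℂ p := by
  have h1 := LinearMap.finrank_range_add_finrank_ker (f.domRestrict p)
  rw [LinearMap.range_domRestrict, LinearMap.ker_domRestrict] at h1
  rw [← h1]
  congr 1
  have h2 := (Submodule.equivMapOfInjective _ p.injective_subtype
    ((LinearMap.ker f).comap p.subtype)).finrank_eq
  rw [h2, Submodule.map_comap_subtype, inf_comm]

theorem finrank_map_ker_of_le {f : V →ₗ[ℂ] V₂} {φ : Dual ℂ V} (hφ : φ ≠ 0)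
    (h : LinearMap.ker f ≤ LinearMap.ker φ) :
    finrank ℂ ((LinearMap.ker φ).map f) + 1 = finrank ℂ (LinearMap.range f) := by
  have h1 := finrank_map_add_finrank_ker_inf f (LinearMap.ker φ)
  have h2 := LinearMap.finrank_range_add_finrank_ker f
  have h3 := Module.Dual.finrank_ker_add_one_of_ne_zero hφ
  rw [inf_eq_left.2 h] at h1
  omega

omit [FiniteDimensional ℂ V] in
theorem map_ker_of_not_le {f : V →ₗ[ℂ] V₂} {φ : Dual ℂ V}
    (h : ¬ LinearMap.ker f ≤ LinearMap.ker φ) : (LinearMap.ker φ).map f = LinearMap.range f := by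
  obtain ⟨z, hz, hzφ⟩ := SetLike.not_le_iff_exists.1 h
  rw [LinearMap.mem_ker] at hz hzφ
  refine le_antisymm LinearMap.map_le_range ?_
  rintro _ ⟨a, rfl⟩
  refine ⟨a - (φ a / φ z) • z, ?_, ?_⟩
  · change φ _ = 0
    rw [map_sub, map_smul, smul_eq_mul, div_mul_cancel₀ _ hzφ, sub_self]
  · rw [map_sub, map_smul, hz, smul_zero, sub_zero]

theorem blockCount_add (x : End ℂ V) (j : ℕ) :
    blockCount x j + finrank ℂ (LinearMap.range (x ^ (j + 1))) =
      finrank ℂ (LinearMap.range (x ^ j)) := by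
  refine Nat.sub_add_cancel (Submodule.finrank_mono ?_)
  rintro _ ⟨v, rfl⟩
  exact ⟨x v, by rw [← Module.End.mul_apply, ← pow_succ]⟩

/-- The block counts are also the dimensions of the subspaces `ker x ⊓ range (x ^ j)`. -/
theorem blockCount_eq_finrank (x : End ℂ V) (j : ℕ) :
    blockCount x j = finrank ℂ (LinearMap.ker x ⊓ LinearMap.range (x ^ j) : Submodule ℂ V) := by
  have h1 := finrank_map_add_finrank_ker_inf x (LinearMap.range (x ^ j))
  have h2 : (LinearMap.range (x ^ j)).map x = LinearMap.range (x ^ (j + 1)) := by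
    rw [← LinearMap.range_comp, pow_succ']
    rfl
  have := blockCount_add x j
  rw [h2] at h1
  omega

omit [FiniteDimensional ℂ V] in
theorem range_pow_antitone (x : End ℂ V) {i j : ℕ} (h : i ≤ j) :
    LinearMap.range (x ^ j) ≤ LinearMap.range (x ^ i) := by
  obtain ⟨k, rfl⟩ := Nat.exists_eq_add_of_le h
  rintro _ ⟨v, rfl⟩
  exact ⟨(x ^ k) v, by rw [← Module.End.mul_apply, ← pow_add]⟩

theorem blockCount_antitone (x : End ℂ V) : Antitone (blockCount x) := fun i j h => by
  rw [blockCount_eq_finrank, blockCount_eq_finrank]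
  exact Submodule.finrank_mono (inf_le_inf_left _ (range_pow_antitone x h))

theorem sum_blockCount_add (x : End ℂ V) (M : ℕ) :
    ∑ j ∈ Finset.range M, blockCount x j + finrank ℂ (LinearMap.range (x ^ M)) = finrank ℂ V := by
  induction M with
  | zero =>
    rw [Finset.sum_range_zero, zero_add, pow_zero, Module.End.one_eq_id, LinearMap.range_id,
      finrank_top]
  | succ M ih =>
    rw [Finset.sum_range_succ, add_assoc, blockCount_add, ih]

theorem sum_blockCount_of_pow_eq_zero {x : End ℂ V} {M : ℕ} (hM : x ^ M = 0) :
    ∑ j ∈ Finset.range M, blockCount x j = finrank ℂ V := by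
  have := sum_blockCount_add x M
  rwa [hM, LinearMap.range_zero, finrank_bot, add_zero] at this

omit [FiniteDimensional ℂ V] in
theorem blockCount_eq_zero_of_le {x : End ℂ V} {M j : ℕ} (hM : x ^ M = 0) (hj : M ≤ j) :
    blockCount x j = 0 := by
  rw [blockCount, pow_eq_zero_of_le hj hM, LinearMap.range_zero, finrank_bot, Nat.zero_sub]

end Rank

section Reduction

variable {V : Type*} [AddCommGroup V] [Module ℂ V] {B : LinearMap.BilinForm ℂ V}

theorem form_pow {x : End ℂ V} (hx : ∀ v w, B (x v) w = B v (x w)) (k : ℕ) :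
    ∀ v w, B ((x ^ k) v) w = B v ((x ^ k) w) := by
  induction k with
  | zero => exact fun _ _ => rfl
  | succ k ih =>
    intro v w
    rw [pow_succ, Module.End.mul_apply, ih, hx, ← Module.End.mul_apply, ← pow_succ', ← pow_succ]

/-- The range of a self-adjoint endomorphism is the orthogonal of its kernel. -/
theorem mem_range_iff_of_selfAdjoint [FiniteDimensional ℂ V] (hB : B.Nondegenerate) {f : End ℂ V}
    (hf : ∀ v w, B (f v) w = B v (f w)) (v : V) :
    v ∈ LinearMap.range f ↔ LinearMap.ker f ≤ LinearMap.ker (B v) := by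
  constructor
  · rintro ⟨u, rfl⟩ z hz
    rw [LinearMap.mem_ker] at hz ⊢
    rw [hf, hz, map_zero]
  · intro h
    have h1 : B v ∈ LinearMap.range f.dualMap := by
      rw [LinearMap.range_dualMap_eq_dualAnnihilator_ker, Submodule.mem_dualAnnihilator]
      exact fun z hz => h hz
    obtain ⟨ψ, hψ⟩ := h1
    obtain ⟨y, rfl⟩ := (B.toDual hB).surjective ψ
    refine ⟨y, ?_⟩
    refine LinearMap.ker_eq_bot.1 hB.ker_eq_bot (LinearMap.ext fun z => ?_)
    rw [hf, ← hψ]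
    rfl

variable (B) in
/-- A hyperbolic pair for the symmetric form `B`. -/
structure IsHyperbolicPair (v w : V) : Prop where
  symm : ∀ v w, B v w = B w v
  left : B v v = 0
  right : B w w = 0
  pair : B v w = 1

/-- A non-zero isotropic vector is the first member of a hyperbolic pair. -/
theorem exists_isHyperbolicPair (hB : B.Nondegenerate) (hs : ∀ v w, B v w = B w v) {v : V}
    (hv : v ≠ 0) (hvv : B v v = 0) : ∃ w, IsHyperbolicPair B v w := by
  have h1 : B v ≠ 0 := fun h => hv (LinearMap.ker_eq_bot.1 hB.ker_eq_bot (h.trans (map_zero B).symm))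
  obtain ⟨w₀, hw₀⟩ := DFunLike.ne_iff.1 h1
  let w₁ := (B v w₀)⁻¹ • w₀
  rw [LinearMap.zero_apply] at hw₀
  have h2 : B v w₁ = 1 := by
    rw [map_smul, smul_eq_mul, inv_mul_cancel₀ hw₀]
  refine ⟨w₁ - (B w₁ w₁ / 2) • v, hs, hvv, ?_, ?_⟩
  · simp only [map_sub, map_smul, LinearMap.sub_apply, LinearMap.smul_apply, smul_eq_mul, hvv, h2,
      hs w₁ v]
    ring
  · rw [map_sub, h2, map_smul, hvv, smul_zero, sub_zero]

variable (B) in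
/-- The orthogonal of the span of two vectors. -/
def perpPair (v w : V) : Submodule ℂ V := LinearMap.ker (B v) ⊓ LinearMap.ker (B w)

namespace IsHyperbolicPair

variable {v w : V} (h : IsHyperbolicPair B v w)
include h

theorem swap_pair : B w v = 1 := (h.symm w v).trans h.pair

/-- The orthogonal projection to the orthogonal of a hyperbolic pair. -/
def proj : V →ₗ[ℂ] perpPair B v w :=
  LinearMap.codRestrict _ (LinearMap.id - (B w).smulRight v - (B v).smulRight w) fun z => by
    constructor <;> change _ = 0
    · simp [h.left, h.pair]
    · simp [h.right, h.swap_pair]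

theorem coe_proj (z : V) : (h.proj z : V) = z - B w z • v - B v z • w := rfl

theorem proj_coe (z : perpPair B v w) : h.proj z = z := by
  have h1 : B v z = 0 := z.2.1
  have h2 : B w z = 0 := z.2.2
  exact Subtype.ext (by rw [coe_proj, h1, h2, zero_smul, zero_smul, sub_zero, sub_zero])

theorem proj_left : h.proj v = 0 :=
  Subtype.ext (by
    rw [coe_proj, h.left, h.swap_pair, zero_smul, one_smul, sub_zero, sub_self]; rfl)

theorem eq_of_perp {e : V} (he : B v e = 0) : e = h.proj e + B w e • v := by
  rw [coe_proj, he, zero_smul, sub_zero, sub_add_cancel]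

theorem form_proj (z : V) (u : perpPair B v w) : B (h.proj z) u = B z u := by
  have h1 : B v u = 0 := u.2.1
  have h2 : B w u = 0 := u.2.2
  rw [coe_proj]
  simp [h1, h2]

theorem nondegenerate (hB : B.Nondegenerate) : (B.restrict (perpPair B v w)).Nondegenerate := by
  have h1 : ∀ u : perpPair B v w, (∀ u' : perpPair B v w, B u u' = 0) → u = 0 := by
    intro u hu
    refine Subtype.ext (LinearMap.ker_eq_bot.1 hB.ker_eq_bot (LinearMap.ext fun z => ?_))
    rw [Submodule.coe_zero, map_zero, LinearMap.zero_apply, h.symm, ← h.form_proj, h.symm, hu]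
  refine ⟨h1, fun u hu => h1 u fun u' => ?_⟩
  rw [h.symm]
  exact hu u'

theorem finrank_perpPair [FiniteDimensional ℂ V] : finrank ℂ (perpPair B v w) + 2 = finrank ℂ V := by
  let f : V →ₗ[ℂ] ℂ × ℂ := (B v).prod (B w)
  have h1 := LinearMap.finrank_range_add_finrank_ker f
  have h2 : LinearMap.range f = ⊤ := by
    rw [LinearMap.range_eq_top]
    rintro ⟨a, b⟩
    exact ⟨a • w + b • v, by simp [f, h.left, h.right, h.pair, h.swap_pair]⟩
  have h3 : LinearMap.ker f = perpPair B v w := LinearMap.ker_prod _ _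
  rw [h2, h3, finrank_top] at h1
  simp at h1
  omega

/-- The endomorphism induced by `x` on the orthogonal of a hyperbolic pair. -/
def induced (x : End ℂ V) : End ℂ (perpPair B v w) := h.proj ∘ₗ x ∘ₗ (perpPair B v w).subtype

theorem induced_apply (x : End ℂ V) (u : perpPair B v w) : h.induced x u = h.proj (x u) := rfl

theorem induced_selfAdjoint {x : End ℂ V} (hx : ∀ v w, B (x v) w = B v (x w))
    (u u' : perpPair B v w) :
    B.restrict (perpPair B v w) (h.induced x u) u' = B.restrict (perpPair B v w) u (h.induced x u') := by
  change B (h.induced x u) u' = B u (h.induced x u')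
  rw [induced_apply, induced_apply, form_proj, h.symm u, form_proj, h.symm _ (u : V), hx]

variable {x : End ℂ V} (hx : ∀ v w, B (x v) w = B v (x w)) (hxv : x v = 0)

omit h in
include hx hxv in
theorem form_map_eq_zero (e : V) : B v (x e) = 0 := by
  rw [← hx, hxv, map_zero, LinearMap.zero_apply]

include hxv in
theorem proj_map {e : V} (he : B v e = 0) : h.proj (x e) = h.induced x (h.proj e) := by
  conv_lhs => rw [h.eq_of_perp he, map_add, map_smul, hxv, smul_zero, add_zero]
  rfl

omit h in
include hx hxv in
theorem pow_perp (k : ℕ) {e : V} (he : B v e = 0) : B v ((x ^ k) e) = 0 := by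
  induction k with
  | zero => exact he
  | succ k ih => rw [pow_succ', Module.End.mul_apply]; exact form_map_eq_zero hx hxv _

include hx hxv

theorem proj_pow (k : ℕ) {e : V} (he : B v e = 0) :
    h.proj ((x ^ k) e) = (h.induced x ^ k) (h.proj e) := by
  induction k with
  | zero => rfl
  | succ k ih =>
    rw [pow_succ', Module.End.mul_apply, h.proj_map hxv (pow_perp hx hxv k he), ih, pow_succ',
      Module.End.mul_apply]

theorem induced_pow_eq_zero {M : ℕ} (hM : x ^ M = 0) : h.induced x ^ M = 0 := by
  ext1 u
  have hu : B v u = 0 := u.2.1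
  rw [← h.proj_coe u, ← h.proj_pow hx hxv M hu, hM, LinearMap.zero_apply, LinearMap.zero_apply,
    map_zero]

theorem range_induced_pow (k : ℕ) :
    LinearMap.range (h.induced x ^ k) = ((LinearMap.ker (B v)).map (x ^ k)).map h.proj := by
  ext u
  constructor
  · rintro ⟨u, rfl⟩
    have hu : B v u = 0 := u.2.1
    exact ⟨(x ^ k) u, ⟨u, hu, rfl⟩, by rw [h.proj_pow hx hxv k hu, proj_coe]⟩
  · rintro ⟨_, ⟨e, he, rfl⟩, rfl⟩
    exact ⟨h.proj e, (h.proj_pow hx hxv k he).symm⟩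

/-- The rank of a power of the induced endomorphism is that of the power of `x` restricted to `v^⊥`,
less one when `v` belongs to the image. -/
theorem finrank_range_induced_pow [FiniteDimensional ℂ V] (k : ℕ) [Decidable (∃ e, B v e = 0 ∧ (x ^ k) e = v)] :
    finrank ℂ (LinearMap.range (h.induced x ^ k)) + (if ∃ e, B v e = 0 ∧ (x ^ k) e = v then 1 else 0) =
      finrank ℂ ((LinearMap.ker (B v)).map (x ^ k)) := by
  rw [h.range_induced_pow hx hxv, ← finrank_map_add_finrank_ker_inf h.proj]
  congr 1
  have hv : v ≠ 0 := fun h0 => by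
    have := h.pair
    rw [h0, map_zero, LinearMap.zero_apply] at this
    exact zero_ne_one this
  have hmem : ∀ z ∈ LinearMap.ker h.proj ⊓ (LinearMap.ker (B v)).map (x ^ k), z = B w z • v := by
    rintro z ⟨hz, e, he, rfl⟩
    have h1 := h.eq_of_perp (pow_perp hx hxv k he)
    rw [show h.proj ((x ^ k) e) = 0 from hz, Submodule.coe_zero, zero_add] at h1
    exact h1
  split_ifs with h1
  · obtain ⟨e, he, hev⟩ := h1
    have h2 : LinearMap.ker h.proj ⊓ (LinearMap.ker (B v)).map (x ^ k) = ℂ ∙ v := by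
      apply le_antisymm
      · intro z hz
        exact Submodule.mem_span_singleton.2 ⟨_, (hmem z hz).symm⟩
      · rw [Submodule.span_singleton_le_iff_mem]
        exact ⟨h.proj_left, e, he, hev⟩
    rw [h2, finrank_span_singleton hv]
  · have h2 : LinearMap.ker h.proj ⊓ (LinearMap.ker (B v)).map (x ^ k) = ⊥ := by
      rw [eq_bot_iff]
      intro z hz
      have h3 := hmem z hz
      by_cases h4 : B w z = 0
      · rw [h4, zero_smul] at h3
        exact h3
      · refine absurd ?_ h1
        obtain ⟨e, he, hez⟩ := hz.2
        refine ⟨(B w z)⁻¹ • e, ?_, ?_⟩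
        · rw [map_smul, show B v e = 0 from he, smul_zero]
        · rw [map_smul, hez, inv_smul_eq_iff₀ h4]
          exact h3
    rw [h2, finrank_bot]

variable [FiniteDimensional ℂ V] (hB : B.Nondegenerate) {m : ℕ} {u : V} (hu : (x ^ m) u = v)
include hB hu

/-- The ranks of the powers of the induced endomorphism, below the depth of `v`. -/
theorem finrank_induced_of_lt {k : ℕ} (hk : k < m) :
    finrank ℂ (LinearMap.range (h.induced x ^ k)) + 2 = finrank ℂ (LinearMap.range (x ^ k)) := by
  classical
  have h1 := h.finrank_range_induced_pow hx hxv k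
  have hvE : B v ≠ 0 := fun h0 => by
    have := h.pair
    rw [h0, LinearMap.zero_apply] at this
    exact zero_ne_one this
  have h2 := finrank_map_ker_of_le (f := x ^ k) hvE
    ((mem_range_iff_of_selfAdjoint hB (form_pow hx k) v).1
      (range_pow_antitone x hk.le ⟨u, hu⟩))
  rw [if_pos] at h1
  · omega
  · obtain ⟨l, rfl⟩ := Nat.exists_eq_add_of_lt hk
    refine ⟨(x ^ (l + 1)) u, ?_, ?_⟩
    · rw [← form_pow hx, pow_succ, Module.End.mul_apply, hxv, map_zero, map_zero,
        LinearMap.zero_apply]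
    · rw [← Module.End.mul_apply, ← pow_add, ← add_assoc, hu]

/-- The rank at the depth of `v`. -/
theorem finrank_induced_of_eq [Decidable (B u v = 0)] :
    finrank ℂ (LinearMap.range (h.induced x ^ m)) + (if B u v = 0 then 2 else 1) =
      finrank ℂ (LinearMap.range (x ^ m)) := by
  classical
  have h1 := h.finrank_range_induced_pow hx hxv m
  have hvE : B v ≠ 0 := fun h0 => by
    have := h.pair
    rw [h0, LinearMap.zero_apply] at this
    exact zero_ne_one this
  have h2 := finrank_map_ker_of_le (f := x ^ m) hvE
    ((mem_range_iff_of_selfAdjoint hB (form_pow hx m) v).1 ⟨u, hu⟩)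
  have h3 : (∃ e, B v e = 0 ∧ (x ^ m) e = v) ↔ B u v = 0 := by
    constructor
    · rintro ⟨e, he, hev⟩
      have h4 : B (u - e) v = 0 := by
        rw [← hu, ← form_pow hx, map_sub, hu, hev, sub_self, map_zero, LinearMap.zero_apply]
      rw [map_sub, LinearMap.sub_apply, h.symm e, he, sub_zero] at h4
      exact h4
    · exact fun h0 => ⟨u, by rw [h.symm, h0], hu⟩
  by_cases h0 : B u v = 0
  · rw [if_pos (h3.2 h0)] at h1
    rw [if_pos h0]
    omega
  · rw [if_neg (fun hc => h0 (h3.1 hc))] at h1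
    rw [if_neg h0]
    omega

omit hu in
/-- The ranks above the depth of `v` do not change. -/
theorem finrank_induced_of_notMem {k : ℕ} (hk : v ∉ LinearMap.range (x ^ k)) :
    finrank ℂ (LinearMap.range (h.induced x ^ k)) = finrank ℂ (LinearMap.range (x ^ k)) := by
  classical
  have h1 := h.finrank_range_induced_pow hx hxv k
  rw [map_ker_of_not_le (mt (mem_range_iff_of_selfAdjoint hB (form_pow hx k) v).2 hk), if_neg,
    add_zero] at h1
  · exact h1
  · rintro ⟨e, -, he⟩
    exact hk ⟨e, he⟩

end IsHyperbolicPair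

end Reduction

/-! ### Strata of the kernel of a self-adjoint nilpotent endomorphism -/

theorem isIrreducible_univ_zariski {W : Type*} [AddCommGroup W] [Module ℂ W] [FiniteDimensional ℂ W] :
    @IsIrreducible W (zariski W) Set.univ := by
  let _ := zariski W
  refine ⟨⟨0, trivial⟩, isPreirreducible_iff_isClosed_union_isClosed.2 fun Z₁ Z₂ h1 h2 hcov => ?_⟩
  by_contra! hcon
  obtain ⟨⟨w₁, -, hw₁⟩, ⟨w₂, -, hw₂⟩⟩ := hcon.imp Set.not_subset.1 Set.not_subset.1
  have h1' := mt (isClosed_zariski_iff.1 h1 w₁) hw₁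
  have h2' := mt (isClosed_zariski_iff.1 h2 w₂) hw₂
  push Not at h1' h2'
  obtain ⟨f, hf, hfZ, hfw⟩ := h1'
  obtain ⟨g, hg, hgZ, hgw⟩ := h2'
  rw [exists_polyFun_eq_adjoin, Algebra.adjoin_range_eq_range_aeval] at hg
  obtain ⟨R, rfl⟩ := hg
  have hR : ∀ w, MvPolynomial.aeval (fun i => fun w : W => (finBasis ℂ W).coord i w) R w =
      MvPolynomial.eval (fun i => (finBasis ℂ W).coord i w) R := fun w =>
    algHom_aeval (Pi.evalAlgHom ℂ (fun _ : W => ℂ) w) _ R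
  have h0 : R = 0 := indepOnSet_coord hf hfw R fun w hw => by
    rw [← hR]
    rcases hcov (Set.mem_univ w) with h | h
    · exact absurd (hfZ w h) hw
    · exact hgZ w h
  apply hgw
  change MvPolynomial.aeval (fun i => fun w : W => (finBasis ℂ W).coord i w) R w₂ = 0
  rw [h0, map_zero]
  rfl

theorem isIrreducible_submodule {W : Type*} [AddCommGroup W] [Module ℂ W] [FiniteDimensional ℂ W]
    (U : Submodule ℂ W) : @IsIrreducible W (zariski W) (U : Set W) := by
  let _ := zariski W
  let _ : TopologicalSpace U := zariski U
  have h := isIrreducible_univ_zariski.image U.subtype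
    (isPolyMap_linear U.subtype).continuous.continuousOn
  rwa [Set.image_univ, Submodule.coe_subtype, Subtype.range_coe] at h

section Strata

variable {V : Type*} [AddCommGroup V] [Module ℂ V] {B : LinearMap.BilinForm ℂ V}

/-- A linear section of an endomorphism over its range. -/
theorem exists_section (f : End ℂ V) : ∃ σ : End ℂ V, ∀ v ∈ LinearMap.range f, f (σ v) = v := by
  obtain ⟨g, hg⟩ := f.rangeRestrict.exists_rightInverse_of_surjective f.range_rangeRestrict
  obtain ⟨σ, hσ⟩ := LinearMap.exists_extend g
  refine ⟨σ, fun v hv => ?_⟩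
  have h1 : σ v = g ⟨v, hv⟩ := LinearMap.congr_fun hσ ⟨v, hv⟩
  rw [h1]
  exact congrArg Subtype.val (LinearMap.congr_fun hg ⟨v, hv⟩)

/-- A chosen linear section of the `h`-th power of `x`. -/
def powSection (x : End ℂ V) (h : ℕ) : End ℂ V := (exists_section (x ^ h)).choose

theorem pow_powSection {x : End ℂ V} {h : ℕ} {v : V} (hv : v ∈ LinearMap.range (x ^ h)) :
    (x ^ h) (powSection x h v) = v := (exists_section (x ^ h)).choose_spec v hv

variable (B) in
/-- The quadratic form `⟨u, v⟩`, where `v = x ^ h u`, on the kernel of `x` in the range of `x ^ h`. -/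
def depthForm (x : End ℂ V) (h : ℕ) (v : V) : ℂ := B (powSection x h v) v

variable {x : End ℂ V} (hs : ∀ v w, B v w = B w v) (hx : ∀ v w, B (x v) w = B v (x w))

/-- The kernel of `x` in the range of `x ^ h`. -/
def depthSpace (x : End ℂ V) (h : ℕ) : Submodule ℂ V := LinearMap.ker x ⊓ LinearMap.range (x ^ h)

include hx in
theorem depthForm_eq {h : ℕ} {u v : V} (hu : (x ^ h) u = v) :
    depthForm B x h v = B u v := by
  have h1 : B (powSection x h v - u) v = 0 := by
    rw [← hu, ← form_pow hx, hu, map_sub, pow_powSection ⟨u, hu⟩, hu, sub_self, map_zero,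
      LinearMap.zero_apply]
  rw [map_sub, LinearMap.sub_apply, sub_eq_zero] at h1
  exact h1

theorem depthForm_mem_polyFun [FiniteDimensional ℂ V] (h : ℕ) : depthForm B x h ∈ polyFun V :=
  (IsPolyMap.bilin B (isPolyMap_linear (powSection x h)) isPolyMap_id).mem

include hs hx in
/-- The quadratic form on the kernel of `x` in the range of `x ^ h` does not vanish identically, unless
that kernel is contained in the range of `x ^ (h + 1)`. -/
theorem exists_depthForm_ne_zero [FiniteDimensional ℂ V] (hB : B.Nondegenerate) {h : ℕ} {v : V}
    (hv : v ∈ depthSpace x h) (hv' : v ∉ LinearMap.range (x ^ (h + 1))) :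
    ∃ v' ∈ depthSpace x h, depthForm B x h v' ≠ 0 := by
  by_contra! hcon
  refine hv' ((mem_range_iff_of_selfAdjoint hB (form_pow hx _) v).2 fun z hz => ?_)
  obtain ⟨u, hu⟩ := hv.2
  have hz' : (x ^ h) z ∈ depthSpace x h := by
    refine ⟨?_, z, rfl⟩
    change x ((x ^ h) z) = 0
    rw [← Module.End.mul_apply, ← pow_succ']
    exact hz
  have h1 := hcon v hv
  have h2 := hcon _ hz'
  have h3 := hcon _ (add_mem hv hz')
  rw [depthForm_eq hx hu] at h1
  rw [depthForm_eq hx (u := z) rfl] at h2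
  rw [depthForm_eq hx (u := u + z) (by rw [map_add, hu])] at h3
  -- polarise: the form vanishes at `v`, at `x ^ h z` and at their sum
  have h4 : B z v = B u ((x ^ h) z) := by
    rw [← hu, ← form_pow hx, hs]
  have h5 : B v z = B u ((x ^ h) z) := by rw [hs, h4]
  simp only [map_add, LinearMap.add_apply, h1, h2, h4] at h3
  change B v z = 0
  rw [h5]
  linear_combination h3 / 2

variable (B) in
/-- The vectors of depth `h` on which the quadratic form does not vanish: those at the end of a Jordan
block of size `h + 1` which is not isotropic. -/
def stratumA (x : End ℂ V) (h : ℕ) : Set V := {v | v ∈ depthSpace x h ∧ depthForm B x h v ≠ 0}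

variable (B) in
/-- The vectors of depth `h` on which the quadratic form vanishes. -/
def stratumB (x : End ℂ V) (h : ℕ) : Set V :=
  {v | v ∈ depthSpace x h ∧ depthForm B x h v = 0 ∧ v ∉ LinearMap.range (x ^ (h + 1))}

include hx in
theorem notMem_range_of_mem_stratumA {h : ℕ} {v : V} (hv : v ∈ stratumA B x h) :
    v ∉ LinearMap.range (x ^ (h + 1)) := by
  rintro ⟨y, hy⟩
  refine hv.2 ?_
  have h1 : (x ^ h) (x y) = v := by rw [← hy, pow_succ, Module.End.mul_apply]
  have h2 : x v = 0 := hv.1.1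
  rw [depthForm_eq hx h1, hx, h2, map_zero]

include hx in
theorem isotropic_of_mem_depthSpace {h : ℕ} {v : V} (hv : v ∈ depthSpace x (h + 1)) : B v v = 0 := by
  obtain ⟨h1, u, hu⟩ := hv
  have h3 : B ((x ^ (h + 1)) u) v = 0 := by
    rw [pow_succ', Module.End.mul_apply, hx, show x v = 0 from h1, map_zero]
  rwa [hu] at h3

include hx in
theorem depthForm_zero (v : V) : depthForm B x 0 v = B v v := depthForm_eq hx rfl

variable [FiniteDimensional ℂ V]

/-- The condition that the form does not vanish is made closed by adjoining an inverse of its value. -/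
theorem isPolyImage_stratumA (h : ℕ) : IsPolyImage (stratumA B x h) := by
  have h1 : IsClosed[zariski (V × ℂ)] {p : V × ℂ | p.1 ∈ depthSpace x h ∧
      depthForm B x h p.1 * p.2 = 1} := by
    let _ := zariski (V × ℂ)
    exact (isClosed_preimage_of_isPolyMap isPolyMap_id.fst (isClosed_submodule _)).inter
      (isClosed_eq_of_isPolyMap (isPolyMap_of_mem (mul_mem
        (isPolyMap_id.fst.comp_mem (depthForm_mem_polyFun h)) isPolyMap_id.snd.mem))
        (isPolyMap_const 1))
  refine (congrArg IsPolyImage ?_).mp (isPolyImage_image h1 isPolyMap_id.fst)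
  ext v
  constructor
  · rintro ⟨⟨v, t⟩, ⟨hv, ht⟩, rfl⟩
    exact ⟨hv, left_ne_zero_of_mul_eq_one ht⟩
  · rintro ⟨hv, hv'⟩
    exact ⟨(v, (depthForm B x h v)⁻¹), ⟨hv, mul_inv_cancel₀ hv'⟩, rfl⟩

include hx in
/-- The vector `v` lies outside the range of `x ^ (h + 1)` exactly when it pairs to one with some vector
of the kernel; adjoining that vector makes the condition closed. -/
theorem isPolyImage_stratumB (hB : B.Nondegenerate) (h : ℕ) : IsPolyImage (stratumB B x h) := by
  have h1 : IsClosed[zariski (V × V)] {p : V × V | p.1 ∈ depthSpace x h ∧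
      depthForm B x h p.1 = 0 ∧ p.2 ∈ LinearMap.ker (x ^ (h + 1)) ∧ B p.1 p.2 = 1} := by
    let _ := zariski (V × V)
    exact (isClosed_preimage_of_isPolyMap isPolyMap_id.fst (isClosed_submodule _)).inter
      ((isClosed_zeros (isPolyMap_id.fst.comp_mem (depthForm_mem_polyFun h))).inter
      ((isClosed_preimage_of_isPolyMap isPolyMap_id.snd (isClosed_submodule _)).inter
      (isClosed_eq_of_isPolyMap (IsPolyMap.bilin B isPolyMap_id.fst isPolyMap_id.snd)
        (isPolyMap_const 1))))
  refine (congrArg IsPolyImage ?_).mp (isPolyImage_image h1 isPolyMap_id.fst)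
  ext v
  have h2 := mem_range_iff_of_selfAdjoint hB (form_pow hx (h + 1)) v
  constructor
  · rintro ⟨⟨v, z⟩, ⟨hv, hv', hz, hvz⟩, rfl⟩
    refine ⟨hv, hv', fun h3 => ?_⟩
    have h4 : B v z = 0 := h2.1 h3 hz
    exact one_ne_zero (hvz.symm.trans h4)
  · rintro ⟨hv, hv', hv''⟩
    obtain ⟨z, hz, hvz⟩ := SetLike.not_le_iff_exists.1 (mt h2.2 hv'')
    rw [LinearMap.mem_ker] at hvz
    exact ⟨(v, (B v z)⁻¹ • z), ⟨hv, hv', Submodule.smul_mem _ _ hz, by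
      change B v ((B v z)⁻¹ • z) = 1
      rw [map_smul, smul_eq_mul, inv_mul_cancel₀ hvz]⟩, rfl⟩

theorem dimLE_stratumA (h : ℕ) : DimLE (stratumA B x h) (blockCount x h) := by
  rw [blockCount_eq_finrank]
  exact (dimLE_submodule (depthSpace x h)).mono fun v hv => hv.1

theorem dimGE_stratumA {h : ℕ} {v : V} (hv : v ∈ stratumA B x h) :
    DimGE (stratumA B x h) (blockCount x h) := by
  rw [blockCount_eq_finrank]
  exact dimGE_submodule_open (depthSpace x h) (depthForm_mem_polyFun h) hv.1 hv.2

include hs hx in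
/-- The second stratum lies in a proper quadric of `ker x ⊓ range (x ^ h)`. -/
theorem dimGE_stratumB_lt (hB : B.Nondegenerate) {h d : ℕ} (hd : DimGE (stratumB B x h) d) :
    d + 1 ≤ blockCount x h := by
  obtain ⟨v, hv⟩ := hd.nonempty
  obtain ⟨v', hv', hne⟩ := exists_depthForm_ne_zero hs hx hB hv.1 hv.2.2
  rw [blockCount_eq_finrank]
  exact dimLE_submodule (depthSpace x h) _ (hd.succ_of_irreducible
    (isIrreducible_submodule (depthSpace x h)) (fun v hv => hv.1) (depthForm_mem_polyFun h)
    (fun v hv => hv.2.1) ⟨v', hv', hne⟩)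

include hs hx in
/-- If there is a Jordan block of size `h + 1`, there is a vector at its end on which the form does not
vanish. -/
theorem exists_mem_stratumA (hB : B.Nondegenerate) {h : ℕ} (hlt : blockCount x (h + 1) < blockCount x h) :
    (stratumA B x h).Nonempty := by
  rw [blockCount_eq_finrank, blockCount_eq_finrank] at hlt
  have h1 : ¬ depthSpace x h ≤ depthSpace x (h + 1) := fun hle =>
    absurd (Submodule.finrank_mono hle) (not_le.2 hlt)
  obtain ⟨v, hv, hv'⟩ := SetLike.not_le_iff_exists.1 h1
  obtain ⟨v', hv', hne⟩ := exists_depthForm_ne_zero hs hx hB hv fun h2 => hv' ⟨hv.1, h2⟩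
  exact ⟨v', hv', hne⟩

omit [FiniteDimensional ℂ V] in
/-- Every non-zero vector of the kernel lies in one of the strata. -/
theorem exists_mem_stratum {M : ℕ} (hM : x ^ M = 0) {v : V} (hv : v ≠ 0) (hxv : x v = 0) :
    ∃ h < M, v ∈ stratumA B x h ∪ stratumB B x h := by
  classical
  have hex : ∃ k, v ∉ LinearMap.range (x ^ k) := ⟨M, by
    rw [hM, LinearMap.range_zero]; exact hv⟩
  obtain ⟨k, hk⟩ : ∃ k, Nat.find hex = k + 1 := Nat.exists_eq_succ_of_ne_zero fun h0 => by
    have := Nat.find_spec hex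
    rw [h0] at this
    exact this ⟨v, rfl⟩
  have h1 := Nat.find_spec hex
  rw [hk] at h1
  have h2 : v ∈ LinearMap.range (x ^ k) := not_not.1 (Nat.find_min hex (by omega))
  have h3 : Nat.find hex ≤ M := Nat.find_min' hex (by
    rw [hM, LinearMap.range_zero]; exact hv)
  refine ⟨k, by omega, ?_⟩
  by_cases h0 : depthForm B x k v = 0
  · exact Or.inr ⟨⟨hxv, h2⟩, h0, h1⟩
  · exact Or.inl ⟨⟨hxv, h2⟩, h0⟩

end Strata

section Reduced

variable {V : Type*} [AddCommGroup V] [Module ℂ V] [FiniteDimensional ℂ V]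
  {B : LinearMap.BilinForm ℂ V} {v w : V} (h : IsHyperbolicPair B v w) {x : End ℂ V}
  (hx : ∀ v w, B (x v) w = B v (x w)) (hB : B.Nondegenerate) {m : ℕ}

include hx hB in
/-- Reduction at a vector of a stratum of the first kind shortens a Jordan block of size `m + 1`
by two. -/
theorem blockCount_induced_of_mem_stratumA (hv : v ∈ stratumA B x m) (j : ℕ) :
    (blockCount (h.induced x) j : ℤ) = blockCount x j - if j = m ∨ j + 1 = m then 1 else 0 := by
  classical
  have hxv : x v = 0 := hv.1.1
  obtain ⟨u, hu⟩ := hv.1.2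
  have hne : B u v ≠ 0 := by rw [← depthForm_eq hx hu]; exact hv.2
  have hlt : ∀ k < m, _ := fun k hk => h.finrank_induced_of_lt hx hxv hB hu hk
  have heq := h.finrank_induced_of_eq hx hxv hB hu
  rw [if_neg hne] at heq
  have hgt : ∀ k, m < k → _ := fun k hk => h.finrank_induced_of_notMem hx hxv hB (k := k)
    fun hc => notMem_range_of_mem_stratumA hx hv (range_pow_antitone x hk hc)
  have e1 := blockCount_add x j
  have e2 := blockCount_add (h.induced x) j
  rcases lt_trichotomy j m with hj | rfl | hj
  · have e3 := hlt j hj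
    rcases (Nat.succ_le_of_lt hj).lt_or_eq with hj' | hj'
    · have e4 := hlt (j + 1) hj'
      rw [if_neg (by omega)]
      omega
    · rw [if_pos (Or.inr hj')]
      have hj'' : j + 1 = m := hj'
      rw [← hj''] at heq
      omega
  · have e4 := hgt (j + 1) (by omega)
    rw [if_pos (Or.inl rfl)]
    omega
  · have e3 := hgt j hj
    have e4 := hgt (j + 1) (by omega)
    rw [if_neg (by omega)]
    omega

include hx hB in
/-- Reduction at a vector of a stratum of the second kind shortens two Jordan blocks of size `m + 1`
by one. -/
theorem blockCount_induced_of_mem_stratumB (hv : v ∈ stratumB B x m) (j : ℕ) :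
    (blockCount (h.induced x) j : ℤ) = blockCount x j - if j = m then 2 else 0 := by
  classical
  have hxv : x v = 0 := hv.1.1
  obtain ⟨u, hu⟩ := hv.1.2
  have hz : B u v = 0 := by rw [← depthForm_eq hx hu]; exact hv.2.1
  have hlt : ∀ k < m, _ := fun k hk => h.finrank_induced_of_lt hx hxv hB hu hk
  have heq := h.finrank_induced_of_eq hx hxv hB hu
  rw [if_pos hz] at heq
  have hgt : ∀ k, m < k → _ := fun k hk => h.finrank_induced_of_notMem hx hxv hB (k := k)
    fun hc => hv.2.2 (range_pow_antitone x hk hc)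
  have e1 := blockCount_add x j
  have e2 := blockCount_add (h.induced x) j
  rcases lt_trichotomy j m with hj | rfl | hj
  · have e3 := hlt j hj
    rw [if_neg (by omega)]
    rcases (Nat.succ_le_of_lt hj).lt_or_eq with hj' | hj'
    · have e4 := hlt (j + 1) hj'
      omega
    · have hj'' : j + 1 = m := hj'
      rw [← hj''] at heq
      omega
  · have e4 := hgt (j + 1) (by omega)
    rw [if_pos rfl]
    omega
  · have e3 := hgt j hj
    have e4 := hgt (j + 1) (by omega)
    rw [if_neg (by omega)]
    omega

end Reduced

/-! ### Frames: bases of isotropic flags moved down by an endomorphism -/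

section Frames

variable {V : Type*} [AddCommGroup V] [Module ℂ V]

/-- A basis of a totally isotropic flag moved down by `x`: the vectors `f i` are linearly independent
and span a totally isotropic subspace, and `x` maps each of them into the span of the previous ones. -/
structure IsFrame (B : LinearMap.BilinForm ℂ V) (x : End ℂ V) {n : ℕ} (f : Fin n → V) : Prop where
  linearIndependent : LinearIndependent ℂ f
  isotropic : ∀ i j, B (f i) (f j) = 0
  map_mem : ∀ i, x (f i) ∈ Submodule.span ℂ (f '' Set.Iio i)

/-- The set of frames. -/
def frames (B : LinearMap.BilinForm ℂ V) (x : End ℂ V) (n : ℕ) : Set (Fin n → V) :=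
  {f | IsFrame B x f}

theorem LinearIndependent.exists_dual {n : ℕ} {f : Fin n → V} (hf : LinearIndependent ℂ f) :
    ∃ φ : Fin n → Dual ℂ V, ∀ i j, φ i (f j) = if i = j then 1 else 0 := by
  obtain ⟨g, hg⟩ := LinearMap.exists_leftInverse_of_injective (Fintype.linearCombination ℂ f)
    (LinearMap.ker_eq_bot.2 (hf.fintypeLinearCombination_injective))
  refine ⟨fun i => (LinearMap.proj i).comp g, fun i j => ?_⟩
  have h1 := LinearMap.congr_fun hg (Pi.single j 1)
  rw [LinearMap.comp_apply, Fintype.linearCombination_apply_single, one_smul] at h1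
  rw [LinearMap.comp_apply, h1]
  simp [Pi.single_apply]

theorem linearIndependent_of_dual {n : ℕ} {f : Fin n → V} {φ : Fin n → Dual ℂ V}
    (h : ∀ i j, φ i (f j) = if i = j then 1 else 0) : LinearIndependent ℂ f := by
  rw [Fintype.linearIndependent_iff]
  intro c hc i
  have h1 := congrArg (φ i) hc
  rw [map_sum, map_zero] at h1
  simpa [h] using h1

variable [FiniteDimensional ℂ V] {B : LinearMap.BilinForm ℂ V} {x : End ℂ V}

omit [FiniteDimensional ℂ V] in
theorem mem_span_image_Iio_iff {n : ℕ} {f : Fin n → V} {i : Fin n} {z : V} :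
    z ∈ Submodule.span ℂ (f '' Set.Iio i) ↔
      ∃ a : Fin n → ℂ, z = ∑ j, if j < i then a j • f j else 0 := by
  constructor
  · intro hz
    induction hz using Submodule.span_induction with
    | mem z hz =>
      obtain ⟨j, hj, rfl⟩ := hz
      refine ⟨Pi.single j 1, ?_⟩
      rw [Finset.sum_eq_single j]
      · rw [if_pos (show j < i from hj), Pi.single_eq_same, one_smul]
      · intro k _ hk
        rw [Pi.single_eq_of_ne hk, zero_smul, ite_self]
      · simp
    | zero => exact ⟨0, by simp⟩
    | add z z' _ _ hz hz' =>
      obtain ⟨a, rfl⟩ := hz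
      obtain ⟨a', rfl⟩ := hz'
      refine ⟨a + a', ?_⟩
      rw [← Finset.sum_add_distrib]
      refine Finset.sum_congr rfl fun j _ => ?_
      split_ifs
      · rw [Pi.add_apply, add_smul]
      · rw [add_zero]
    | smul c z _ hz =>
      obtain ⟨a, rfl⟩ := hz
      refine ⟨c • a, ?_⟩
      rw [Finset.smul_sum]
      refine Finset.sum_congr rfl fun j _ => ?_
      split_ifs
      · rw [Pi.smul_apply, smul_assoc]
      · rw [smul_zero]
  · rintro ⟨a, rfl⟩
    refine Submodule.sum_mem _ fun j _ => ?_
    split_ifs with hj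
    · exact Submodule.smul_mem _ _ (Submodule.subset_span ⟨j, hj, rfl⟩)
    · exact zero_mem _

/-- The conditions defining a frame become closed after adjoining a dual family, which witnesses linear
independence, and the coefficients of the vectors `x (f i)`. -/
theorem isPolyImage_frames (n : ℕ) : IsPolyImage (frames B x n) := by
  let W := (Fin n → V) × (Fin n → Dual ℂ V) × (Fin n → Fin n → ℂ)
  have hf : ∀ i, IsPolyMap fun p : W => p.1 i := fun i => isPolyMap_id.fst.apply i
  have hφ : ∀ i, IsPolyMap fun p : W => p.2.1 i := fun i => isPolyMap_id.snd.fst.apply i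
  have ha : ∀ i j, IsPolyMap fun p : W => p.2.2 i j := fun i j => (isPolyMap_id.snd.snd.apply i).apply j
  have h1 : IsClosed[zariski W] {p : W | (∀ i j, p.2.1 i (p.1 j) = if i = j then 1 else 0) ∧
      (∀ i j, B (p.1 i) (p.1 j) = 0) ∧
      ∀ i, x (p.1 i) = ∑ j, if j < i then p.2.2 i j • p.1 j else 0} := by
    let _ := zariski W
    rw [Set.ofPred_and, Set.ofPred_and]
    refine IsClosed.inter ?_ (IsClosed.inter ?_ ?_)
    · simp only [Set.ofPred_forall]
      exact isClosed_iInter fun i => isClosed_iInter fun j => isClosed_eq_of_isPolyMap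
        (IsPolyMap.bilin LinearMap.id (hφ i) (hf j)) (isPolyMap_const _)
    · simp only [Set.ofPred_forall]
      exact isClosed_iInter fun i => isClosed_iInter fun j => isClosed_eq_of_isPolyMap
        (IsPolyMap.bilin B (hf i) (hf j)) (isPolyMap_const _)
    · simp only [Set.ofPred_forall]
      refine isClosed_iInter fun i => isClosed_eq_of_isPolyMap ((hf i).linear x)
        (IsPolyMap.sum _ fun j => ?_)
      split_ifs
      · exact IsPolyMap.smul (ha i j).mem (hf j)
      · exact isPolyMap_const 0
  refine (congrArg IsPolyImage ?_).mp (isPolyImage_image h1 isPolyMap_id.fst)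
  ext f
  constructor
  · rintro ⟨⟨f, φ, a⟩, ⟨h1, h2, h3⟩, rfl⟩
    exact ⟨linearIndependent_of_dual h1, h2, fun i => mem_span_image_Iio_iff.2 ⟨_, h3 i⟩⟩
  · rintro ⟨h1, h2, h3⟩
    obtain ⟨φ, hφ⟩ := LinearIndependent.exists_dual h1
    choose a ha using fun i => mem_span_image_Iio_iff.1 (h3 i)
    exact ⟨(f, φ, a), ⟨hφ, h2, ha⟩, rfl⟩

/-! ### Frames with a given first vector -/

variable {v w : V} (h : IsHyperbolicPair B v w)

/-- The frame with first vector `v` built from a frame of the orthogonal of the hyperbolic pair and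
arbitrary components along `v`. -/
def consFrame (v w : V) {n : ℕ} (p : (Fin n → perpPair B v w) × (Fin n → ℂ)) : Fin (n + 1) → V :=
  Fin.cons v fun i => (p.1 i : V) + p.2 i • v

omit [FiniteDimensional ℂ V] in
theorem isPolyMap_consFrame {n : ℕ} : IsPolyMap (consFrame (B := B) v w (n := n)) := by
  refine IsPolyMap.pi fun i => ?_
  refine Fin.cases ?_ (fun i => ?_) i
  · exact isPolyMap_const v
  · exact ((isPolyMap_id.fst.apply i).linear (perpPair B v w).subtype).add
      (IsPolyMap.smul (isPolyMap_id.snd.apply i).mem (isPolyMap_const v))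

omit [FiniteDimensional ℂ V] in
include h in
/-- A frame of the orthogonal of a hyperbolic pair lifts to a frame with first vector `v`. -/
theorem isFrame_consFrame (hx : ∀ v w, B (x v) w = B v (x w)) (hxv : x v = 0) {n : ℕ}
    {p : (Fin n → perpPair B v w) × (Fin n → ℂ)}
    (hp : IsFrame (B.restrict (perpPair B v w)) (h.induced x) p.1) :
    IsFrame B x (consFrame v w p) := by
  have hz : ∀ i, B v (p.1 i) = 0 := fun i => (p.1 i).2.1
  refine ⟨?_, ?_, ?_⟩
  · rw [Fintype.linearIndependent_iff]
    intro c hc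
    have hc' : c 0 • v + ∑ i, c (Fin.succ i) • ((p.1 i : V) + p.2 i • v) = 0 := by
      rw [Fin.sum_univ_succ] at hc
      exact hc
    have h1 := congrArg h.proj hc'
    simp only [map_add, map_sum, map_smul, h.proj_left, smul_zero, zero_add, add_zero, h.proj_coe,
      map_zero] at h1
    have h2 := Fintype.linearIndependent_iff.1 hp.linearIndependent _ h1
    simp only [h2, zero_smul, Finset.sum_const_zero, add_zero] at hc'
    have hv : v ≠ 0 := fun h0 => by
      have := h.pair
      rw [h0, map_zero, LinearMap.zero_apply] at this
      exact zero_ne_one this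
    exact Fin.cases ((smul_eq_zero.1 hc').resolve_right hv) h2
  · have h1 : ∀ i j, B ((p.1 i : V) + p.2 i • v) ((p.1 j : V) + p.2 j • v) = 0 := fun i j => by
      have h2 : B (p.1 i : V) (p.1 j) = 0 := hp.isotropic i j
      simp [h2, hz, h.symm (p.1 i : V) v, h.left]
    intro i j
    refine Fin.cases ?_ (fun i => ?_) i <;> refine Fin.cases ?_ (fun j => ?_) j
    · exact h.left
    · change B v ((p.1 j : V) + p.2 j • v) = 0
      simp [hz, h.left]
    · change B ((p.1 i : V) + p.2 i • v) v = 0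
      rw [h.symm]
      simp [hz, h.left]
    · exact h1 i j
  · intro i
    refine Fin.cases ?_ (fun i => ?_) i
    · change x v ∈ _
      rw [hxv]
      exact zero_mem _
    · change x ((p.1 i : V) + p.2 i • v) ∈ _
      rw [map_add, map_smul, hxv, smul_zero, add_zero,
        h.eq_of_perp (IsHyperbolicPair.form_map_eq_zero hx hxv (p.1 i : V))]
      have hv : v ∈ Submodule.span ℂ (consFrame v w p '' Set.Iio i.succ) :=
        Submodule.subset_span ⟨0, Fin.succ_pos i, rfl⟩
      refine add_mem ?_ (Submodule.smul_mem _ _ hv)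
      have h1 : Submodule.span ℂ (p.1 '' Set.Iio i) ≤
          (Submodule.span ℂ (consFrame v w p '' Set.Iio i.succ)).comap (perpPair B v w).subtype := by
        rw [Submodule.span_le]
        rintro _ ⟨j, hj, rfl⟩
        change (p.1 j : V) ∈ Submodule.span ℂ (consFrame v w p '' Set.Iio i.succ)
        rw [← add_sub_cancel_right (p.1 j : V) (p.2 j • v)]
        exact sub_mem (Submodule.subset_span ⟨j.succ, Fin.succ_lt_succ_iff.2 hj, rfl⟩)
          (Submodule.smul_mem _ _ hv)
      exact h1 (hp.map_mem i)

omit [FiniteDimensional ℂ V] in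
include h in
/-- Every frame with first vector `v` comes from a frame of the orthogonal of the hyperbolic pair. -/
theorem exists_eq_consFrame (hxv : x v = 0) {n : ℕ} {f : Fin (n + 1) → V} (hf : IsFrame B x f)
    (hfv : f 0 = v) :
    IsFrame (B.restrict (perpPair B v w)) (h.induced x) (fun i => h.proj (f i.succ)) ∧
      f = consFrame v w (fun i => h.proj (f i.succ), fun i => B w (f i.succ)) := by
  have hperp : ∀ i, B v (f i) = 0 := fun i => by rw [← hfv]; exact hf.isotropic 0 i
  have heq : f = consFrame v w (fun i => h.proj (f i.succ), fun i => B w (f i.succ)) := by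
    funext i
    refine Fin.cases hfv (fun i => ?_) i
    exact h.eq_of_perp (hperp i.succ)
  refine ⟨⟨?_, ?_, ?_⟩, heq⟩
  · rw [Fintype.linearIndependent_iff]
    intro c hc i
    have h1 : h.proj (∑ i, c i • f i.succ) = 0 := by
      rw [map_sum, ← hc]
      simp only [map_smul]
    have h2 : B v (∑ i, c i • f i.succ) = 0 := by
      rw [map_sum]
      exact Finset.sum_eq_zero fun i _ => by rw [map_smul, hperp, smul_zero]
    have h3 := h.eq_of_perp h2
    rw [h1, Submodule.coe_zero, zero_add] at h3
    have h4 := Fintype.linearIndependent_iff.1 hf.linearIndependent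
      (Fin.cons (-(B w (∑ i, c i • f i.succ))) c) (by
        rw [Fin.sum_univ_succ, hfv]
        simp only [Fin.cons_zero, Fin.cons_succ]
        rw [neg_smul, ← h3, neg_add_cancel]) i.succ
    simpa using h4
  · intro i j
    change B (h.proj (f i.succ)) (h.proj (f j.succ) : V) = 0
    rw [h.coe_proj, h.coe_proj]
    simp [hf.isotropic, hperp, h.symm _ v, h.left]
  · intro i
    rw [← h.proj_map hxv (hperp _)]
    have h1 : Submodule.span ℂ (f '' Set.Iio i.succ) ≤
        (Submodule.span ℂ ((fun i => h.proj (f i.succ)) '' Set.Iio i)).comap h.proj := by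
      rw [Submodule.span_le]
      rintro _ ⟨j, hj, rfl⟩
      change h.proj (f j) ∈ Submodule.span ℂ ((fun i => h.proj (f i.succ)) '' Set.Iio i)
      induction j using Fin.cases with
      | zero => rw [hfv, h.proj_left]; exact zero_mem _
      | succ j => exact Submodule.subset_span ⟨j, Fin.succ_lt_succ_iff.1 hj, rfl⟩
    exact h1 (hf.map_mem i.succ)

omit [FiniteDimensional ℂ V] in
include h in
/-- The frames with first vector `v` form a trivial bundle over the frames of the induced endomorphism. -/
theorem frames_fibre_eq (hx : ∀ v w, B (x v) w = B v (x w)) (hxv : x v = 0) (n : ℕ) :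
    {f | f ∈ frames B x (n + 1) ∧ f 0 = v} =
      consFrame v w '' (frames (B.restrict (perpPair B v w)) (h.induced x) n ×ˢ Set.univ) := by
  ext f
  constructor
  · rintro ⟨hf, hfv⟩
    obtain ⟨h1, h2⟩ := exists_eq_consFrame h hxv hf hfv
    exact ⟨(fun i => h.proj (f i.succ), fun i => B w (f i.succ)), ⟨h1, trivial⟩, h2.symm⟩
  · rintro ⟨p, ⟨hp, -⟩, rfl⟩
    exact ⟨isFrame_consFrame h hx hxv hp, rfl⟩

include h in
theorem dimLE_frames_fibre (hx : ∀ v w, B (x v) w = B v (x w)) (hxv : x v = 0) {n d : ℕ}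
    (hd : DimLE (frames (B.restrict (perpPair B v w)) (h.induced x) n) d) :
    DimLE {f | f ∈ frames B x (n + 1) ∧ f 0 = v} (d + n) := by
  rw [frames_fibre_eq h hx hxv]
  refine DimLE.image isPolyMap_consFrame ?_
  have hun : IsPolyImage (Set.univ : Set (Fin n → ℂ)) := isPolyImage_of_isClosed (by
    let _ := zariski (Fin n → ℂ)
    exact isClosed_univ)
  refine ((isPolyImage_frames n).prod hun).dimLE isPolyMap_id.fst (hd.mono ?_) fun t _ => ?_
  · rintro _ ⟨p, hp, rfl⟩
    exact hp.1
  · have h1 : DimLE (Set.univ : Set (Fin n → ℂ)) n := by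
      have := dimLE_finrank (S := (Set.univ : Set (Fin n → ℂ)))
      rwa [finrank_fin_fun] at this
    refine (h1.image (p := fun a => (t, a)) ((isPolyMap_const t).prodMk isPolyMap_id)).mono ?_
    rintro ⟨u, a⟩ ⟨-, hu⟩
    exact ⟨a, trivial, by rw [← show u = t from hu]⟩

include h in
theorem dimGE_frames_fibre (hx : ∀ v w, B (x v) w = B v (x w)) (hxv : x v = 0) {n d : ℕ}
    (hd : DimGE (frames (B.restrict (perpPair B v w)) (h.induced x) n) d) :
    DimGE {f | f ∈ frames B x (n + 1) ∧ f 0 = v} (d + n) := by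
  rw [frames_fibre_eq h hx hxv]
  have h1 : DimGE (frames (B.restrict (perpPair B v w)) (h.induced x) n ×ˢ
      (Set.univ : Set (Fin n → ℂ))) (d + n) := by
    refine hd.of_fibres isPolyMap_id.fst fun t ht => ?_
    have h2 : DimGE (Set.univ : Set (Fin n → ℂ)) n := by
      have := dimGE_open (const_mem_polyFun (W := Fin n → ℂ) 1) (w₀ := 0) one_ne_zero
      rw [finrank_fin_fun] at this
      exact this.mono (Set.subset_univ _)
    refine (h2.image_of_leftInv (p := fun a => (t, a)) (q := Prod.snd) isPolyMap_id.snd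
      fun _ _ => rfl).mono ?_
    rintro _ ⟨a, -, rfl⟩
    exact ⟨⟨ht, trivial⟩, rfl⟩
  refine h1.image_of_leftInv (q := fun f => (fun i => h.proj (f i.succ), fun i => B w (f i.succ)))
    (IsPolyMap.prodMk (IsPolyMap.pi fun i => (isPolyMap_id.apply i.succ).linear h.proj)
      (IsPolyMap.pi fun i => (isPolyMap_id.apply i.succ).linear (B w))) ?_
  rintro ⟨u, a⟩ -
  refine Prod.ext (funext fun i => ?_) (funext fun i => ?_)
  · change h.proj ((u i : V) + a i • v) = u i
    rw [map_add, map_smul, h.proj_left, smul_zero, add_zero, h.proj_coe]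
  · change B w ((u i : V) + a i • v) = a i
    have h3 : B w (u i) = 0 := (u i).2.2
    rw [map_add, map_smul, h3, h.swap_pair, zero_add, smul_eq_mul, mul_one]

end Frames

/-! ### Combinatorics of block counts -/

section Combinatorics

/-- The excess `∑_{j < M} r_j (r_j - 1)` of a sequence of block counts, as an integer to avoid truncated
subtraction. For the block counts of a self-adjoint nilpotent endomorphism this is twice the dimension
of its skew-adjoint centralizer. -/
def excess (r : ℕ → ℕ) (M : ℕ) : ℤ := ∑ j ∈ Finset.range M, (r j : ℤ) * (r j - 1)

/-- The block counts of the partitions `(2p₁ + 1, 2p₂, 2p₃, …)`: they agree in pairs, except for one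
pair `(1, 0)`. -/
def IsPaired (r : ℕ → ℕ) : Prop :=
  ∀ i, r (2 * i) = r (2 * i + 1) ∨ (r (2 * i) = 1 ∧ r (2 * i + 1) = 0)

theorem excess_nonneg (r : ℕ → ℕ) (M : ℕ) : 0 ≤ excess r M := by
  refine Finset.sum_nonneg fun j _ => ?_
  rcases Nat.eq_zero_or_pos (r j) with h | h
  · simp [h]
  · exact mul_nonneg (by positivity) (by omega)

/-- The change of the excess when a block of size `m + 2` is shortened by two. -/
theorem excess_sub_one {r r' : ℕ → ℕ} {m M : ℕ} (hm : m + 1 < M)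
    (h : ∀ j, (r' j : ℤ) = r j - if j = m + 1 ∨ j + 1 = m + 1 then 1 else 0) :
    excess r' M = excess r M - 2 * (r m - 1) - 2 * (r (m + 1) - 1) := by
  have h1 : ∀ j, (r' j : ℤ) * (r' j - 1) = r j * (r j - 1) -
      ((if j = m then 2 * ((r j : ℤ) - 1) else 0) + if j = m + 1 then 2 * ((r j : ℤ) - 1) else 0) := by
    intro j
    rw [h j]
    by_cases h2 : j = m
    · rw [if_pos (Or.inr (by omega)), if_pos h2, if_neg (by omega)]
      ring
    · by_cases h3 : j = m + 1
      · rw [if_pos (Or.inl h3), if_neg h2, if_pos h3]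
        ring
      · rw [if_neg (by omega), if_neg h2, if_neg h3]
        ring
  unfold excess
  rw [Finset.sum_congr rfl fun j _ => h1 j, Finset.sum_sub_distrib, Finset.sum_add_distrib,
    Finset.sum_ite_eq' _ m, Finset.sum_ite_eq' _ (m + 1), if_pos (Finset.mem_range.2 (by omega)),
    if_pos (Finset.mem_range.2 hm)]
  ring

/-- The change of the excess when two blocks of size `m + 1` are shortened by one. -/
theorem excess_sub_two {r r' : ℕ → ℕ} {m M : ℕ} (hm : m < M)
    (h : ∀ j, (r' j : ℤ) = r j - if j = m then 2 else 0) :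
    excess r' M = excess r M - 4 * r m + 6 := by
  have h1 : ∀ j, (r' j : ℤ) * (r' j - 1) = r j * (r j - 1) -
      (if j = m then 4 * (r j : ℤ) - 6 else 0) := by
    intro j
    rw [h j]
    split_ifs <;> ring
  unfold excess
  rw [Finset.sum_congr rfl fun j _ => h1 j, Finset.sum_sub_distrib,
    Finset.sum_ite_eq' _ m, if_pos (Finset.mem_range.2 hm)]
  ring

/-- If shortening a block of size `m + 2` by two gives a paired sequence and `r (m + 1) = r m`, the
original sequence is paired. -/
theorem IsPaired.of_sub_one {r r' : ℕ → ℕ} {m : ℕ}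
    (h : ∀ j, (r' j : ℤ) = r j - if j = m + 1 ∨ j + 1 = m + 1 then 1 else 0)
    (hr : Antitone r) (hr' : Antitone r') (he : r (m + 1) = r m) (hp : IsPaired r') : IsPaired r := by
  have hm : r' m + 1 = r m := by have := h m; rw [if_pos (Or.inr rfl)] at this; omega
  have hm1 : r' (m + 1) + 1 = r (m + 1) := by have := h (m + 1); rw [if_pos (Or.inl rfl)] at this; omega
  have hne : ∀ j, j ≠ m → j ≠ m + 1 → r' j = r j := fun j h1 h2 => by
    have := h j; rw [if_neg (by omega)] at this; omega
  intro i
  have hpi := hp i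
  rcases Nat.even_or_odd' m with ⟨l, rfl | rfl⟩
  · by_cases hil : i = l
    · subst hil
      left
      omega
    · rw [← hne (2 * i) (by omega) (by omega), ← hne (2 * i + 1) (by omega) (by omega)]
      exact hpi
  · have hpl := hp l
    rw [hne (2 * l) (by omega) (by omega)] at hpl
    have h0 : r (2 * l + 1) ≤ r (2 * l) := hr (Nat.le_succ _)
    have h2 : r' (2 * l + 1 + 1 + 1) ≤ r' (2 * l + 1 + 1) := hr' (Nat.le_succ _)
    have h3 := hne (2 * l + 1 + 1 + 1) (by omega) (by omega)
    by_cases hil : i = l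
    · subst hil
      omega
    · by_cases hil' : i = l + 1
      · subst hil'
        right
        rw [show 2 * (l + 1) = 2 * l + 1 + 1 by ring]
        omega
      · rw [← hne (2 * i) (by omega) (by omega), ← hne (2 * i + 1) (by omega) (by omega)]
        exact hpi

theorem sum_range_two_mul (r : ℕ → ℕ) (M : ℕ) :
    ∑ j ∈ Finset.range (2 * M), r j = ∑ i ∈ Finset.range M, (r (2 * i) + r (2 * i + 1)) := by
  induction M with
  | zero => simp
  | succ M ih =>
    rw [show 2 * (M + 1) = 2 * M + 1 + 1 by ring, Finset.sum_range_succ, Finset.sum_range_succ, ih,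
      Finset.sum_range_succ]
    ring

/-- A paired sequence of odd sum has exactly one pair `(1, 0)`. -/
theorem IsPaired.exists_one_zero {r : ℕ → ℕ} (hp : IsPaired r) {M : ℕ}
    (h0 : ∀ j, M ≤ j → r j = 0) (hodd : Odd (∑ j ∈ Finset.range M, r j)) :
    ∃ p, r (2 * p) = 1 ∧ r (2 * p + 1) = 0 := by
  by_contra hcon
  push Not at hcon
  have h1 : ∑ j ∈ Finset.range (2 * M), r j = ∑ j ∈ Finset.range M, r j :=
    (Finset.sum_subset (Finset.range_mono (by omega)) fun j _ hj =>
      h0 j (not_lt.1 fun h => hj (Finset.mem_range.2 h))).symm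
  rw [← h1, sum_range_two_mul] at hodd
  refine (Nat.not_even_iff_odd.2 hodd) (Finset.even_sum _ fun i _ => ?_)
  rcases hp i with h | ⟨h, h'⟩
  · exact ⟨r (2 * i), by omega⟩
  · exact absurd h' (hcon i h)

/-- A paired sequence of odd sum at least `3` can be reduced, by shortening a block by `2`, to a paired
sequence. -/
theorem IsPaired.exists_reduction {r : ℕ → ℕ} (hp : IsPaired r) (hr : Antitone r) {M : ℕ}
    (h0 : ∀ j, M ≤ j → r j = 0) (hodd : Odd (∑ j ∈ Finset.range M, r j))
    (h1 : 1 < ∑ j ∈ Finset.range M, r j) :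
    ∃ m, r (m + 1 + 1) < r (m + 1) ∧ r (m + 1) = r m ∧ ∀ r' : ℕ → ℕ,
      (∀ j, (r' j : ℤ) = r j - if j = m + 1 ∨ j + 1 = m + 1 then 1 else 0) → IsPaired r' := by
  obtain ⟨p, hp1, hp0⟩ := hp.exists_one_zero h0 hodd
  obtain ⟨q, rfl⟩ : ∃ q, p = q + 1 := by
    refine Nat.exists_eq_succ_of_ne_zero fun hp' => ?_
    subst hp'
    refine absurd h1 (not_lt.2 ?_)
    rw [Finset.sum_eq_single_of_mem 0]
    · exact hp1.le
    · refine Finset.mem_range.2 (Nat.pos_of_ne_zero fun hM => ?_)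
      rw [hM] at h1
      simp at h1
    · intro j _ hj
      have h2 : r j ≤ r (2 * 0 + 1) := hr (by omega)
      omega
  rw [show 2 * (q + 1) = 2 * q + 1 + 1 by ring] at hp1 hp0
  have h2 : r (2 * q + 1 + 1) ≤ r (2 * q + 1) := hr (Nat.le_succ _)
  have hq := hp q
  have key : ∀ m, (m = 2 * q ∨ m = 2 * q + 1) → ∀ r' : ℕ → ℕ,
      (∀ j, (r' j : ℤ) = r j - if j = m + 1 ∨ j + 1 = m + 1 then 1 else 0) →
      (r' m : ℤ) = r m - 1 ∧ (r' (m + 1) : ℤ) = r (m + 1) - 1 ∧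
      ∀ j, j ≠ m → j ≠ m + 1 → r' j = r j := fun m _ r' h => by
    refine ⟨?_, ?_, fun j h1 h2 => ?_⟩
    · rw [h m, if_pos (Or.inr rfl)]
    · rw [h (m + 1), if_pos (Or.inl rfl)]
    · have := h j; rw [if_neg (by omega)] at this; omega
  by_cases h3 : r (2 * q + 1) = 1
  · refine ⟨2 * q + 1, by omega, by omega, fun r' h => ?_⟩
    obtain ⟨k1, k2, k3⟩ := key _ (Or.inr rfl) r' h
    intro i
    by_cases hi : i = q
    · subst hi
      have := k3 (2 * i) (by omega) (by omega)
      omega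
    · by_cases hi' : i = q + 1
      · subst hi'
        have := k3 (2 * q + 1 + 1 + 1) (by omega) (by omega)
        rw [show 2 * (q + 1) = 2 * q + 1 + 1 by ring]
        omega
      · rw [k3 (2 * i) (by omega) (by omega), k3 (2 * i + 1) (by omega) (by omega)]
        exact hp i
  · refine ⟨2 * q, by omega, by omega, fun r' h => ?_⟩
    obtain ⟨k1, k2, k3⟩ := key _ (Or.inl rfl) r' h
    intro i
    by_cases hi : i = q
    · subst hi
      omega
    · rw [k3 (2 * i) (by omega) (by omega), k3 (2 * i + 1) (by omega) (by omega)]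
      exact hp i

theorem eq_of_sum_eq_one {r : ℕ → ℕ} (hr : Antitone r) {M : ℕ}
    (h0 : ∀ j, M ≤ j → r j = 0) (h1 : ∑ j ∈ Finset.range M, r j = 1) :
    r 0 = 1 ∧ ∀ j, r (j + 1) = 0 := by
  have hM : 0 < M := Nat.pos_of_ne_zero fun hM => by rw [hM] at h1; simp at h1
  obtain ⟨M, rfl⟩ := Nat.exists_eq_succ_of_ne_zero hM.ne'
  rw [Finset.sum_range_succ'] at h1
  have h2 : r 0 ≠ 0 := fun h2 => by
    rw [Finset.sum_eq_zero fun j _ => Nat.le_zero.1 ((hr (Nat.zero_le _)).trans_eq h2), h2] at h1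
    omega
  refine ⟨by omega, fun j => ?_⟩
  by_cases hj : j < M
  · have h3 : r (j + 1) ≤ ∑ j ∈ Finset.range M, r (j + 1) :=
      Finset.single_le_sum (f := fun j => r (j + 1)) (fun _ _ => Nat.zero_le _) (Finset.mem_range.2 hj)
    omega
  · exact h0 _ (by omega)

end Combinatorics

/-! ### The dimension of the set of frames -/

section FirstVector

variable {V : Type*} [AddCommGroup V] [Module ℂ V] {B : LinearMap.BilinForm ℂ V} {x : End ℂ V}

theorem IsFrame.map_zero {n : ℕ} {f : Fin (n + 1) → V} (hf : IsFrame B x f) : x (f 0) = 0 := by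
  have h1 := hf.map_mem 0
  rwa [show Set.Iio (0 : Fin (n + 1)) = ∅ from Set.Iio_bot, Set.image_empty, Submodule.span_empty,
    Submodule.mem_bot] at h1

theorem frames_zero : frames B x 0 = Set.univ :=
  Set.eq_univ_of_forall fun _ => ⟨linearIndependent_empty_type, fun i => i.elim0, fun i => i.elim0⟩

theorem ne_zero_of_mem_stratum {h : ℕ} {v : V} (hv : v ∈ stratumA B x h ∪ stratumB B x h) :
    v ≠ 0 := by
  rintro rfl
  rcases hv with hv | hv
  · refine hv.2 ?_
    change B _ 0 = 0
    rw [map_zero]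
  · exact hv.2.2 (zero_mem _)

end FirstVector

/-- The dimension `D` of the set of frames satisfies `4 D ≤ 2 n (n + 1) + ∑ r_j (r_j - 1)`, where the
`r_j` are the block counts of `x`, with equality only if the block counts are paired. The proof
removes the first vector of a frame: it lies in one of the strata of the kernel of `x`, and the rest
of the frame is a frame of the endomorphism induced on the orthogonal of a hyperbolic pair. -/
theorem four_mul_le_of_dimGE_frames (M n : ℕ) : ∀ {V : Type*} [AddCommGroup V] [Module ℂ V] [FiniteDimensional ℂ V]
    {B : LinearMap.BilinForm ℂ V} {x : End ℂ V}, B.Nondegenerate → (∀ v w, B v w = B w v) →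
    (∀ v w, B (x v) w = B v (x w)) → x ^ M = 0 → finrank ℂ V = 2 * n + 1 →
    ∀ D, DimGE (frames B x n) D →
      (4 * D : ℤ) ≤ 2 * n * (n + 1) + excess (blockCount x) M ∧
      ((4 * D : ℤ) = 2 * n * (n + 1) + excess (blockCount x) M → IsPaired (blockCount x)) := by
  induction n with
  | zero =>
    intro V _ _ _ B x hB hs hx hM hV D hD
    have h1 : D ≤ 0 := by
      have := dimLE_finrank D hD
      rwa [finrank_zero_of_subsingleton] at this
    have h2 := excess_nonneg (blockCount x) M
    obtain ⟨h3, h4⟩ := eq_of_sum_eq_one (blockCount_antitone x)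
      (fun j hj => blockCount_eq_zero_of_le hM hj)
      ((sum_blockCount_of_pow_eq_zero hM).trans hV)
    refine ⟨by push_cast; omega, fun _ i => ?_⟩
    cases i with
    | zero => exact Or.inr ⟨h3, h4 0⟩
    | succ i => exact Or.inl (by rw [h4, show 2 * (i + 1) = 2 * i + 1 + 1 by ring, h4])
  | succ n ih =>
    intro V _ _ _ B x hB hs hx hM hV D hD
    have hcov : frames B x (n + 1) ⊆ ⋃ h ∈ Set.Iio M,
        (frames B x (n + 1) ∩ (fun f => f 0) ⁻¹' (stratumA B x h ∪ stratumB B x h)) := fun f hf => by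
      obtain ⟨h, hh, hv⟩ := exists_mem_stratum (B := B) hM (hf.linearIndependent.ne_zero 0) hf.map_zero
      exact Set.mem_biUnion (show h ∈ Set.Iio M from hh) ⟨hf, hv⟩
    obtain ⟨m, hm, hD⟩ := (hD.mono hcov).exists_of_biUnion (Set.finite_Iio M)
    rw [Set.preimage_union, Set.inter_union_distrib_left] at hD
    have hp : IsPolyMap fun f : Fin (n + 1) → V => f 0 := isPolyMap_id.apply 0
    -- the fibre over a vector `v`, in terms of the induced endomorphism
    have hfib : ∀ v ∈ stratumA B x m ∪ stratumB B x m, ∀ r T,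
        DimGE {f | f ∈ frames B x (n + 1) ∩ (fun f => f 0) ⁻¹' T ∧ f 0 = v} r → ∃ w,
          ∃ h : IsHyperbolicPair B v w, ∃ d, r ≤ d + n ∧
            (4 * d : ℤ) ≤ 2 * n * (n + 1) + excess (blockCount (h.induced x)) M ∧
            ((4 * d : ℤ) = 2 * n * (n + 1) + excess (blockCount (h.induced x)) M →
              IsPaired (blockCount (h.induced x))) := by
      intro v hv r T hr
      have hr' : DimGE {f | f ∈ frames B x (n + 1) ∧ f 0 = v} r := hr.mono fun f hf => ⟨hf.1.1, hf.2⟩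
      obtain ⟨f, hf, hfv⟩ := hr'.nonempty
      have hxv : x v = 0 := by rw [← hfv]; exact hf.map_zero
      have hvv : B v v = 0 := by rw [← hfv]; exact hf.isotropic 0 0
      obtain ⟨w, h⟩ := exists_isHyperbolicPair hB hs (ne_zero_of_mem_stratum hv) hvv
      have hle := dimLE_frames_fibre h hx hxv (dimLE_zdim (S := frames (B.restrict (perpPair B v w))
        (h.induced x) n)) r hr'
      have hne : (frames (B.restrict (perpPair B v w)) (h.induced x) n).Nonempty :=
        ⟨_, (exists_eq_consFrame h hxv hf hfv).1⟩
      have h1 := h.finrank_perpPair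
      obtain ⟨h2, h3⟩ := ih (h.nondegenerate hB) (fun u u' => hs _ _) (h.induced_selfAdjoint hx)
        (h.induced_pow_eq_zero hx hxv hM) (by omega) _ (dimGE_zdim hne)
      exact ⟨w, h, _, hle, h2, h3⟩
    rcases hD.union with hD | hD
    · obtain ⟨v, ⟨f, ⟨hf, hv⟩, hfv⟩, r, hDr, hr⟩ := ((isPolyImage_frames (n + 1)).inter_preimage
        (isPolyImage_stratumA m) hp).exists_fibre hp hD ((dimLE_stratumA m).mono (by
          rintro _ ⟨f, hf, rfl⟩
          exact hf.2))
      change f 0 = v at hfv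
      change f 0 ∈ stratumA B x m at hv
      have hvv : B v v = 0 := by rw [← hfv]; exact hf.isotropic 0 0
      rw [hfv] at hv
      obtain ⟨w, h, d, hrd, hd, hd'⟩ := hfib v (Or.inl hv) r _ hr
      -- an isotropic vector is not of depth zero with a non-vanishing form
      obtain ⟨m, rfl⟩ : ∃ l, m = l + 1 := Nat.exists_eq_succ_of_ne_zero fun hm0 => by
        subst hm0
        exact hv.2 ((depthForm_zero hx v).trans hvv)
      have hb := blockCount_induced_of_mem_stratumA h hx hB hv
      have he := excess_sub_one (show m + 1 < M from hm) hb
      have hanti := blockCount_antitone x (Nat.le_succ m)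
      rw [Nat.succ_eq_add_one] at hanti
      have hcast : (4 * D : ℤ) ≤ 4 * blockCount x (m + 1) + 4 * d + 4 * n := by
        exact_mod_cast (by omega : 4 * D ≤ 4 * blockCount x (m + 1) + 4 * d + 4 * n)
      have hanti' : (blockCount x (m + 1) : ℤ) ≤ blockCount x m := by exact_mod_cast hanti
      have hexp : (2 * (n + 1 : ℤ) * (n + 1 + 1)) = 2 * n * (n + 1) + 4 * n + 4 := by ring
      push_cast
      rw [hexp]
      refine ⟨by linarith, fun heq => ?_⟩
      refine IsPaired.of_sub_one hb (blockCount_antitone x) (blockCount_antitone _) ?_ (hd' ?_)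
      · have : (blockCount x (m + 1) : ℤ) = blockCount x m := by linarith
        exact_mod_cast this
      · linarith
    · obtain ⟨v, ⟨f, ⟨hf, hv⟩, hfv⟩, r, hDr, hr⟩ := ((isPolyImage_frames (n + 1)).inter_preimage
        (isPolyImage_stratumB hx hB m) hp).exists_fibre hp hD ((dimLE_zdim (S := stratumB B x m)).mono (by
          rintro _ ⟨f, hf, rfl⟩
          exact hf.2))
      change f 0 = v at hfv
      change f 0 ∈ stratumB B x m at hv
      rw [hfv] at hv
      obtain ⟨w, h, d, hrd, hd, hd'⟩ := hfib v (Or.inr hv) r _ hr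
      have hlt := dimGE_stratumB_lt hs hx hB (dimGE_zdim ⟨v, hv⟩)
      have he := excess_sub_two (show m < M from hm) (blockCount_induced_of_mem_stratumB h hx hB hv)
      -- the quadric has dimension at most `blockCount x m - 1`, which makes the inequality strict
      have hcast : (4 * D : ℤ) + 4 ≤ 4 * blockCount x m + 4 * d + 4 * n := by
        exact_mod_cast (by omega : 4 * D + 4 ≤ 4 * blockCount x m + 4 * d + 4 * n)
      have hexp : (2 * (n + 1 : ℤ) * (n + 1 + 1)) = 2 * n * (n + 1) + 4 * n + 4 := by ring
      push_cast
      rw [hexp]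
      exact ⟨by linarith, fun heq => by linarith⟩

/-- If the block counts are paired, the bound for the dimension of the set of frames is attained. -/
theorem exists_dimGE_frames (M n : ℕ) : ∀ {V : Type*} [AddCommGroup V] [Module ℂ V] [FiniteDimensional ℂ V]
    {B : LinearMap.BilinForm ℂ V} {x : End ℂ V}, B.Nondegenerate → (∀ v w, B v w = B w v) →
    (∀ v w, B (x v) w = B v (x w)) → x ^ M = 0 → finrank ℂ V = 2 * n + 1 →
    IsPaired (blockCount x) → ∃ D : ℕ, DimGE (frames B x n) D ∧
      (4 * D : ℤ) = 2 * n * (n + 1) + excess (blockCount x) M := by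
  induction n with
  | zero =>
    intro V _ _ _ B x hB hs hx hM hV _
    obtain ⟨h3, h4⟩ := eq_of_sum_eq_one (blockCount_antitone x)
      (fun j hj => blockCount_eq_zero_of_le hM hj)
      ((sum_blockCount_of_pow_eq_zero hM).trans hV)
    refine ⟨0, dimGE_zero ?_, ?_⟩
    · rw [frames_zero]
      exact Set.univ_nonempty
    · have h5 : excess (blockCount x) M = 0 := Finset.sum_eq_zero fun j _ => by
        cases j with
        | zero => rw [h3]; simp
        | succ j => rw [h4]; simp
      rw [h5]
      simp
  | succ n ih =>
    intro V _ _ _ B x hB hs hx hM hV hp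
    have hz : ∀ j, M ≤ j → blockCount x j = 0 := fun j hj => blockCount_eq_zero_of_le hM hj
    have hsum := (sum_blockCount_of_pow_eq_zero hM).trans hV
    obtain ⟨m, hlt, heq, hred⟩ := hp.exists_reduction (blockCount_antitone x) hz
      (by rw [hsum]; exact ⟨n + 1, rfl⟩) (by omega)
    have hm : m + 1 < M := not_le.1 fun hle => by
      rw [hz (m + 1) hle] at hlt
      omega
    -- the first vector ends a block of size `m + 2`, by the choice of `m`
    obtain ⟨v₀, hv₀⟩ := exists_mem_stratumA hs hx hB hlt
    -- over each vector of the stratum the fibre has the same dimension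
    have hfib : ∀ v ∈ stratumA B x (m + 1), ∃ d : ℕ, (4 * d : ℤ) = 2 * n * (n + 1) +
        (excess (blockCount x) M - 2 * (blockCount x m - 1) - 2 * (blockCount x (m + 1) - 1)) ∧
        DimGE {f | f ∈ frames B x (n + 1) ∧ f 0 = v} (d + n) := by
      intro v hv
      have hxv : x v = 0 := hv.1.1
      obtain ⟨w, h⟩ := exists_isHyperbolicPair hB hs (ne_zero_of_mem_stratum (Or.inl hv))
        (isotropic_of_mem_depthSpace hx hv.1)
      have hb := blockCount_induced_of_mem_stratumA h hx hB hv
      have h1 := h.finrank_perpPair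
      obtain ⟨d, hd, hd'⟩ := ih (h.nondegenerate hB) (fun u u' => hs _ _) (h.induced_selfAdjoint hx)
        (h.induced_pow_eq_zero hx hxv hM) (by omega) (hred _ hb)
      rw [excess_sub_one hm hb] at hd'
      exact ⟨d, hd', dimGE_frames_fibre h hx hxv hd⟩
    obtain ⟨d, hd, -⟩ := hfib v₀ hv₀
    refine ⟨blockCount x (m + 1) + (d + n), (dimGE_stratumA hv₀).of_fibres
      (f := fun f : Fin (n + 1) → V => f 0) (isPolyMap_id.apply 0) fun v hv => ?_, ?_⟩
    · obtain ⟨d', hd', h1⟩ := hfib v hv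
      obtain rfl : d' = d := by omega
      exact h1
    · have heq' : (blockCount x (m + 1) : ℤ) = blockCount x m := by exact_mod_cast heq
      push_cast
      linear_combination hd + 2 * heq'

/-! ### Bases of maximal isotropic subspaces -/

section Witt

variable {V : Type*} [AddCommGroup V] [Module ℂ V] [FiniteDimensional ℂ V]
  {B : LinearMap.BilinForm ℂ V}

/-- The Gram matrix of a sum of `n` hyperbolic planes and a unit vector. -/
def hyperbolicGram (n : ℕ) : (Fin n ⊕ Fin n ⊕ Unit) → (Fin n ⊕ Fin n ⊕ Unit) → ℂ
  | .inl i, .inr (.inl j) => if i = j then 1 else 0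
  | .inr (.inl i), .inl j => if i = j then 1 else 0
  | .inr (.inr _), .inr (.inr _) => 1
  | _, _ => 0

/-- A family dual to `f` for the form, corrected by combinations of the `f i` so that it becomes
totally isotropic. -/
theorem exists_isotropic_dual (hB : B.Nondegenerate) (hs : ∀ v w, B v w = B w v) {n : ℕ}
    {f : Fin n → V} (hf : LinearIndependent ℂ f) (hf0 : ∀ i j, B (f i) (f j) = 0) :
    ∃ g : Fin n → V, (∀ i j, B (g i) (f j) = if i = j then 1 else 0) ∧ ∀ i j, B (g i) (g j) = 0 := by
  obtain ⟨φ, hφ⟩ := LinearIndependent.exists_dual hf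
  let g₀ : Fin n → V := fun j => (B.toDual hB).symm (φ j)
  have hg₀ : ∀ i j, B (g₀ i) (f j) = if i = j then 1 else 0 := fun i j => by
    rw [LinearMap.BilinForm.apply_toDual_symm_apply, hφ]
  have hg₀' : ∀ i j, B (f j) (g₀ i) = if i = j then 1 else 0 := fun i j => by rw [hs, hg₀]
  refine ⟨fun j => g₀ j - (2⁻¹ : ℂ) • ∑ i, B (g₀ i) (g₀ j) • f i, fun i j => ?_, fun i j => ?_⟩
  · simp [hg₀, hf0, map_sum, LinearMap.sum_apply]
  · simp only [map_sub, map_smul, map_sum, LinearMap.sub_apply, LinearMap.smul_apply,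
      LinearMap.sum_apply, hg₀, hg₀', hf0, smul_eq_mul, mul_ite, mul_one, mul_zero,
      Finset.sum_ite_eq, Finset.mem_univ, if_true, Finset.sum_const_zero, sub_zero]
    rw [hs (g₀ j) (g₀ i)]
    ring

/-- A basis of a maximal totally isotropic subspace extends to a hyperbolic basis. -/
theorem exists_hyperbolic_basis (hB : B.Nondegenerate) (hs : ∀ v w, B v w = B w v) {n : ℕ}
    (hV : finrank ℂ V = 2 * n + 1) {f : Fin n → V} (hf : LinearIndependent ℂ f)
    (hf0 : ∀ i j, B (f i) (f j) = 0) :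
    ∃ b : Basis (Fin n ⊕ Fin n ⊕ Unit) ℂ V, (∀ i, b (.inl i) = f i) ∧
      ∀ s t, B (b s) (b t) = hyperbolicGram n s t := by
  obtain ⟨g, hgf, hg0⟩ := exists_isotropic_dual hB hs hf hf0
  have hfg : ∀ i j, B (f i) (g j) = if i = j then 1 else 0 := fun i j => by
    rw [hs, hgf]
    simp only [eq_comm]
  let Ψ : V →ₗ[ℂ] (Fin n → ℂ) × (Fin n → ℂ) :=
    (LinearMap.pi fun i => B (f i)).prod (LinearMap.pi fun i => B (g i))
  have hΨ : LinearMap.range Ψ = ⊤ := by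
    rw [LinearMap.range_eq_top]
    rintro ⟨a, a'⟩
    refine ⟨∑ i, a i • g i + ∑ i, a' i • f i, Prod.ext (funext fun i => ?_) (funext fun i => ?_)⟩
    · change B (f i) _ = a i
      simp [hfg, hf0]
    · change B (g i) _ = a' i
      simp [hgf, hg0]
  have hker : finrank ℂ (LinearMap.ker Ψ) = 1 := by
    have := LinearMap.finrank_range_add_finrank_ker Ψ
    rw [hΨ, finrank_top, finrank_prod, finrank_fin_fun] at this
    omega
  obtain ⟨⟨e, he⟩, he0, hspan⟩ := finrank_eq_one_iff'.1 hker
  have hef : ∀ i, B (f i) e = 0 := fun i => congrFun (congrArg Prod.fst he) i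
  have heg : ∀ i, B (g i) e = 0 := fun i => congrFun (congrArg Prod.snd he) i
  -- the orthogonal of the hyperbolic planes is a line, on which the form does not vanish
  have hee : B e e ≠ 0 := by
    intro h0
    refine he0 (Subtype.ext (LinearMap.ker_eq_bot.1 hB.ker_eq_bot (LinearMap.ext fun v => ?_)))
    rw [Submodule.coe_zero, map_zero, LinearMap.zero_apply]
    have h1 : v - ∑ i, B (g i) v • f i - ∑ i, B (f i) v • g i ∈ LinearMap.ker Ψ := by
      refine Prod.ext (funext fun i => ?_) (funext fun i => ?_)
      · change B (f i) _ = 0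
        simp [hfg, hf0]
      · change B (g i) _ = 0
        simp [hgf, hg0]
    obtain ⟨c, hc⟩ := hspan ⟨_, h1⟩
    have h2 : c • e = v - ∑ i, B (g i) v • f i - ∑ i, B (f i) v • g i := congrArg Subtype.val hc
    have h3 := congrArg (B e) h2
    simpa [h0, hs e, hef, heg] using h3.symm
  obtain ⟨c, hc⟩ := IsAlgClosed.exists_pow_nat_eq (B e e)⁻¹ two_pos
  let fam : (Fin n ⊕ Fin n ⊕ Unit) → V := Sum.elim f (Sum.elim g fun _ => c • e)
  have hfam : ∀ s t, B (fam s) (fam t) = hyperbolicGram n s t := by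
    have hce : B (c • e) (c • e) = 1 := by
      rw [map_smul, map_smul, LinearMap.smul_apply, smul_eq_mul, smul_eq_mul, ← mul_assoc, ← sq, hc,
        inv_mul_cancel₀ hee]
    have h1 : ∀ i, B (f i) (c • e) = 0 := fun i => by rw [map_smul, hef, smul_zero]
    have h2 : ∀ i, B (g i) (c • e) = 0 := fun i => by rw [map_smul, heg, smul_zero]
    rintro (i | i | i) (j | j | j)
    · exact hf0 i j
    · exact hfg i j
    · exact h1 i
    · exact hgf i j
    · exact hg0 i j
    · exact h2 i
    · exact (hs _ _).trans (h1 j)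
    · exact (hs _ _).trans (h2 j)
    · exact hce
  have hli : LinearIndependent ℂ fam := by
    rw [Fintype.linearIndependent_iff]
    intro a ha
    have h1 : ∀ s, ∑ t, a t * hyperbolicGram n s t = 0 := fun s => by
      have := congrArg (B (fam s)) ha
      rw [map_sum, map_zero] at this
      rw [← this]
      exact Finset.sum_congr rfl fun t _ => by rw [map_smul, hfam, smul_eq_mul]
    rintro (i | i | i)
    · simpa [hyperbolicGram] using h1 (.inr (.inl i))
    · simpa [hyperbolicGram] using h1 (.inl i)
    · simpa [hyperbolicGram] using h1 (.inr (.inr i))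
  refine ⟨basisOfLinearIndependentOfCardEqFinrank hli (by simp; omega), fun i => ?_, fun s t => ?_⟩
  · rw [coe_basisOfLinearIndependentOfCardEqFinrank]
    rfl
  · rw [coe_basisOfLinearIndependentOfCardEqFinrank]
    exact hfam s t

omit [FiniteDimensional ℂ V] in
theorem form_ext_basis {ι : Type*} [Fintype ι] {B' : LinearMap.BilinForm ℂ V} (b : Basis ι ℂ V)
    (h : ∀ s t, B (b s) (b t) = B' (b s) (b t)) (v w : V) : B v w = B' v w := by
  have : B = B' := b.ext fun s => b.ext fun t => h s t
  rw [this]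

theorem det_isometry (hB : B.Nondegenerate) {g : End ℂ V} (hg : ∀ v w, B (g v) (g w) = B v w) :
    LinearMap.det g = 1 ∨ LinearMap.det g = -1 := by
  have h1 := congrArg LinearMap.det ((isometry_iff hB).1 hg)
  rw [map_mul, det_adj, map_one] at h1
  exact mul_self_eq_one_iff.1 h1

/-- The special orthogonal group is transitive on the bases of maximal totally isotropic subspaces. -/
theorem exists_specialIsom_apply_eq (hB : B.Nondegenerate) (hs : ∀ v w, B v w = B w v) {n : ℕ}
    (hV : finrank ℂ V = 2 * n + 1) {f f' : Fin n → V} (hf : LinearIndependent ℂ f)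
    (hf0 : ∀ i j, B (f i) (f j) = 0) (hf' : LinearIndependent ℂ f')
    (hf0' : ∀ i j, B (f' i) (f' j) = 0) : ∃ k ∈ specialIsom B 0, ∀ i, k (f i) = f' i := by
  obtain ⟨b, hb, hbB⟩ := exists_hyperbolic_basis hB hs hV hf hf0
  obtain ⟨b', hb', hbB'⟩ := exists_hyperbolic_basis hB hs hV hf' hf0'
  let k : End ℂ V := b.constr ℂ b'
  have hk : ∀ s, k (b s) = b' s := fun s => b.constr_basis ℂ _ s
  have hkf : ∀ i, k (f i) = f' i := fun i => by rw [← hb, hk, hb']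
  have hkB : ∀ v w, B (k v) (k w) = B v w := fun v w =>
    form_ext_basis (B := B.compl₁₂ k k) b (fun s t => by
      rw [LinearMap.compl₁₂_apply, hk, hk, hbB, hbB']) v w
  -- the reflection in the anisotropic vector of the basis
  let d : (Fin n ⊕ Fin n ⊕ Unit) → ℂ := Sum.elim 1 (Sum.elim 1 (-1))
  let σ : End ℂ V := b.constr ℂ fun s => d s • b s
  have hσ : ∀ s, σ (b s) = d s • b s := fun s => b.constr_basis ℂ _ s
  have hσf : ∀ i, σ (f i) = f i := fun i => by
    rw [← hb, hσ]
    exact one_smul _ _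
  have hσB : ∀ v w, B (σ v) (σ w) = B v w := fun v w =>
    form_ext_basis (B := B.compl₁₂ σ σ) b (fun s t => by
      rw [LinearMap.compl₁₂_apply, hσ, hσ, map_smul, map_smul, LinearMap.smul_apply, hbB]
      rcases s with (s | s | s) <;> rcases t with (t | t | t) <;> simp [d, hyperbolicGram]) v w
  have hσd : LinearMap.det σ = -1 := by
    have h1 : LinearMap.toMatrix b b σ = Matrix.diagonal d := by
      ext s t
      rw [LinearMap.toMatrix_apply, hσ, map_smul, Finsupp.smul_apply, b.repr_self, Finsupp.single_apply,
        Matrix.diagonal_apply]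
      by_cases hst : s = t
      · subst hst
        simp
      · rw [if_neg (Ne.symm hst), if_neg hst, smul_zero]
    rw [← LinearMap.det_toMatrix b, h1, Matrix.det_diagonal, Fintype.prod_sum_type, Fintype.prod_sum_type]
    simp [d]
  rcases det_isometry hB hkB with h | h
  · exact ⟨k, ⟨hkB, h, by rw [mul_zero, zero_mul]⟩, hkf⟩
  · refine ⟨k * σ, ⟨fun v w => ?_, by rw [map_mul, h, hσd]; norm_num, by rw [mul_zero, zero_mul]⟩,
      fun i => ?_⟩
    · rw [Module.End.mul_apply, Module.End.mul_apply, hkB, hσB]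
    · rw [Module.End.mul_apply, hσf, hkf]

end Witt

/-! ### Flags stable under the involution -/

section Flag

variable {V : Type*} [AddCommGroup V] [Module ℂ V] [FiniteDimensional ℂ V]

namespace CompleteFlag

variable (F : CompleteFlag V)

theorem sub_zero : F.sub 0 = ⊥ := Submodule.finrank_eq_zero.1 (by simp [F.finrank_sub])

theorem sub_finrank : F.sub (finrank ℂ V) = ⊤ :=
  Submodule.eq_top_of_finrank_eq (by simp [F.finrank_sub])

/-- The subspaces stable under the Borel subgroup of a flag are the members of the flag. -/
theorem eq_sub_of_map_le {U : Submodule ℂ V}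
    (hU : ∀ g ∈ F.borel, U.map ((g : V ≃ₗ[ℂ] V) : V →ₗ[ℂ] V) ≤ U) : U = F.sub (finrank ℂ U) := by
  classical
  have hex : ∃ i, U ≤ F.sub i := ⟨_, le_top.trans F.sub_finrank.ge⟩
  have key : U = F.sub (Nat.find hex) := by
    -- let `i + 1` be the least index with `U ≤ F.sub (i + 1)`; then `F.sub i < U`
    refine le_antisymm (Nat.find_spec hex) ?_
    rcases h0 : Nat.find hex with _ | i
    · rw [F.sub_zero]
      exact bot_le
    · have hle : U ≤ F.sub (i + 1) := h0 ▸ Nat.find_spec hex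
      obtain ⟨u, hu, hui⟩ := SetLike.not_le_iff_exists.1 (Nat.find_min hex (show i < _ by omega))
      obtain ⟨φ, hφu, hφ⟩ := Submodule.exists_dual_map_eq_bot_of_notMem hui inferInstance
      have hφ' : ∀ z ∈ F.sub i, φ z = 0 := fun z hz => by
        have : φ z ∈ (F.sub i).map φ := ⟨z, hz, rfl⟩
        rwa [hφ] at this
      -- the transvections `v ↦ v + φ(v) z` with `z` in `F.sub i` preserve the flag
      have hlt : F.sub i ≤ U := fun z hz => by
        have hstab : ∀ j, (F.sub j).map (LinearEquiv.transvection (hφ' z hz) : V →ₗ[ℂ] V) ≤ F.sub j := by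
          rintro j _ ⟨w, hw, rfl⟩
          change w + φ w • z ∈ F.sub j
          rcases le_total j i with hji | hji
          · rw [hφ' w (F.mono hji hw), zero_smul, add_zero]
            exact hw
          · exact add_mem hw (Submodule.smul_mem _ _ (F.mono hji hz))
        let g : SpecialLinearGroup ℂ V :=
          ⟨LinearEquiv.transvection (hφ' z hz), LinearEquiv.transvection.det_eq_one _⟩
        have hg : g ∈ F.borel := fun j => Submodule.eq_of_le_of_finrank_eq (hstab j)
          (LinearEquiv.finrank_map_eq (g : V ≃ₗ[ℂ] V) (F.sub j))
        have h1 : u + φ u • z ∈ U := hU g hg ⟨u, hu, rfl⟩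
        have h2 : φ u • z ∈ U := by simpa using sub_mem h1 hu
        simpa [smul_smul, inv_mul_cancel₀ hφu] using U.smul_mem (φ u)⁻¹ h2
      have hlt' : F.sub i < U := lt_of_le_of_ne hlt fun h => hui (h ▸ hu)
      refine (Submodule.eq_of_le_of_finrank_le hle ?_).ge
      have h3 := Submodule.finrank_lt_finrank_of_lt hlt'
      have h4 := Submodule.finrank_mono hle
      rw [F.finrank_sub] at h3 h4 ⊢
      omega
  have h1 := F.finrank_sub (Nat.find hex)
  rw [← key] at h1
  rcases le_total (Nat.find hex) (finrank ℂ V) with h2 | h2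
  · rw [min_eq_left h2] at h1
    rw [h1, ← key]
  · rw [min_eq_right h2] at h1
    rw [h1, F.sub_finrank]
    exact Submodule.eq_top_of_finrank_eq h1

/-- A complete flag has an adapted basis, up to any index. -/
theorem exists_basis {n : ℕ} (hn : n ≤ finrank ℂ V) : ∃ f : Fin n → V, LinearIndependent ℂ f ∧
    ∀ i ≤ n, F.sub i = Submodule.span ℂ (f '' {j | (j : ℕ) < i}) := by
  have h1 : ∀ j : Fin n, ∃ v ∈ F.sub (j + 1), v ∉ F.sub j := fun j => by
    refine SetLike.not_le_iff_exists.1 fun hle => ?_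
    have := Submodule.finrank_mono hle
    rw [F.finrank_sub, F.finrank_sub] at this
    omega
  choose f hf hf' using h1
  have key : ∀ i ≤ n, F.sub i = Submodule.span ℂ (f '' {j | (j : ℕ) < i}) := by
    intro i
    induction i with
    | zero => intro _; simp [F.sub_zero]
    | succ i ih =>
      intro hi
      have hset : f '' {j : Fin n | (j : ℕ) < i + 1} = insert (f ⟨i, hi⟩) (f '' {j : Fin n | (j : ℕ) < i}) := by
        rw [← Set.image_insert_eq]
        congr 1
        ext j
        simp only [Set.mem_ofPred_eq, Set.mem_insert_iff, Fin.ext_iff]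
        omega
      rw [hset, Submodule.span_insert, ← ih (by omega)]
      refine (Submodule.eq_of_le_of_finrank_le (sup_le ?_ (F.mono (Nat.le_succ i))) ?_).symm
      · rw [Submodule.span_singleton_le_iff_mem]
        exact hf ⟨i, hi⟩
      · have h2 : F.sub i < (ℂ ∙ f ⟨i, hi⟩) ⊔ F.sub i := lt_of_le_of_ne le_sup_right fun h =>
          hf' ⟨i, hi⟩ (by
            change f ⟨i, hi⟩ ∈ F.sub i
            rw [h]
            exact Submodule.mem_sup_left (Submodule.mem_span_singleton_self (R := ℂ) (f ⟨i, hi⟩)))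
        have h3 := Submodule.finrank_lt_finrank_of_lt h2
        rw [F.finrank_sub] at h3 ⊢
        omega
  refine ⟨f, ?_, key⟩
  rw [linearIndependent_iff_card_eq_finrank_span, Set.finrank, ← Set.image_univ,
    show (Set.univ : Set (Fin n)) = {j : Fin n | (j : ℕ) < n} from
      (Set.eq_univ_of_forall fun j => j.2).symm,
    ← key n le_rfl, F.finrank_sub, Fintype.card_fin, min_eq_left hn]

end CompleteFlag

variable {Q : QuadraticForm ℂ V} (hQ : (form Q).Nondegenerate)

omit [FiniteDimensional ℂ V] in
theorem form_symm (v w : V) : form Q v w = form Q w v := by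
  simp [form, QuadraticMap.associated_apply, add_comm v w, sub_right_comm]

variable {F : CompleteFlag V} (hF : F.borel.map (theta Q hQ) = F.borel)
include hF

/-- The orthogonal of a member of a `θ`-stable flag is a member of the flag. -/
theorem orthogonal_sub (i : ℕ) : (form Q).orthogonal (F.sub i) = F.sub (finrank ℂ V - i) := by
  have h1 : (form Q).orthogonal (F.sub i) = F.sub (finrank ℂ ((form Q).orthogonal (F.sub i))) := by
    refine F.eq_sub_of_map_le fun g hg => ?_
    rw [← hF] at hg
    obtain ⟨g, hg, rfl⟩ := hg
    rintro _ ⟨v, hv, rfl⟩ w hw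
    have h2 : F.sub i ≤ (F.sub i).map ((g : V ≃ₗ[ℂ] V) : V →ₗ[ℂ] V) := (hg i).ge
    obtain ⟨w, hw', rfl⟩ := h2 hw
    have h3 : form Q (theta Q hQ g v) (g w) = form Q v w := form_theta Q hQ g v w
    change form Q (g w) (theta Q hQ g v) = 0
    rw [form_symm, h3, form_symm]
    exact hv w hw'
  rw [h1, LinearMap.BilinForm.finrank_orthogonal hQ, F.finrank_sub]
  congr 1
  omega

theorem mem_sub_iff {i j : ℕ} (hij : i + j = finrank ℂ V) {v : V} :
    v ∈ F.sub j ↔ ∀ u ∈ F.sub i, form Q u v = 0 := by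
  rw [show j = finrank ℂ V - i by omega, ← orthogonal_sub hQ hF]
  rfl

variable {n : ℕ} (hV : finrank ℂ V = 2 * n + 1)
include hV

theorem form_eq_zero_of_mem_sub {u v : V} (hu : u ∈ F.sub n) (hv : v ∈ F.sub (n + 1)) :
    form Q u v = 0 := (mem_sub_iff hQ hF (by omega)).1 hv u hu

/-- A nilpotent self-adjoint endomorphism lies in `𝔫₁` as soon as it moves down the isotropic half of
the flag. -/
theorem mem_nOne {y : End ℂ V} (hy : ∀ v w, form Q (y v) w = form Q v (y w)) (hn : IsNilpotent y)
    (h : ∀ i < n, ∀ v ∈ F.sub (i + 1), y v ∈ F.sub i) : y ∈ nOne Q F := by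
  refine ⟨fun i v hv => ?_, (LinearMap.isNilpotent_trace_of_isNilpotent hn).eq_zero, hy⟩
  have h' : ∀ i ≤ n, ∀ v ∈ F.sub i, y v ∈ F.sub (i - 1) := fun i hi v hv => by
    cases i with
    | zero =>
      rw [F.sub_zero, Submodule.mem_bot] at hv
      rw [hv, map_zero]
      exact zero_mem _
    | succ i => exact h i (by omega) v hv
  rcases lt_trichotomy i n with hi | rfl | hi
  · exact h i hi v hv
  · -- the flag has an anisotropic line `F.sub (n + 1) / F.sub n` in the middle
    have hmap : ∀ w ∈ F.sub (i + 1), y w ∈ F.sub (i + 1) := fun w hw => by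
      refine (mem_sub_iff hQ hF (i := i) (by omega)).2 fun u hu => ?_
      rw [← hy]
      exact form_eq_zero_of_mem_sub hQ hF hV (F.mono (Nat.sub_le i 1) (h' i le_rfl u hu)) hw
    have hmap' : ∀ w ∈ F.sub i, y w ∈ F.sub i := fun w hw =>
      F.mono (Nat.sub_le i 1) (h' i le_rfl w hw)
    by_cases hvi : v ∈ F.sub i
    · exact hmap' v hvi
    have hsup : (ℂ ∙ v) ⊔ F.sub i = F.sub (i + 1) := by
      refine Submodule.eq_of_le_of_finrank_le (sup_le ?_ (F.mono (Nat.le_succ i))) ?_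
      · rw [Submodule.span_singleton_le_iff_mem]
        exact hv
      · have h2 : F.sub i < (ℂ ∙ v) ⊔ F.sub i := lt_of_le_of_ne le_sup_right fun h =>
          hvi (by
            rw [h]
            exact Submodule.mem_sup_left (Submodule.mem_span_singleton_self (R := ℂ) v))
        have h3 := Submodule.finrank_lt_finrank_of_lt h2
        rw [F.finrank_sub] at h3 ⊢
        omega
    have hyv := hmap v hv
    rw [← hsup, Submodule.mem_sup] at hyv
    obtain ⟨_, hc, z, hz, hyv⟩ := hyv
    obtain ⟨c, rfl⟩ := Submodule.mem_span_singleton.1 hc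
    -- `c` is the eigenvalue of `y` on that line, so that it vanishes
    have hpow : ∀ k, (y ^ k) v - c ^ k • v ∈ F.sub i := fun k => by
      induction k with
      | zero => simp
      | succ k ih =>
        have h3 : (y ^ (k + 1)) v - c ^ (k + 1) • v = y ((y ^ k) v - c ^ k • v) + c ^ k • z := by
          rw [pow_succ' y, Module.End.mul_apply, map_sub, map_smul, ← hyv, smul_add, smul_smul, pow_succ]
          abel
        rw [h3]
        exact add_mem (hmap' _ ih) (Submodule.smul_mem _ _ hz)
    obtain ⟨k, hk⟩ := hn
    have h4 := hpow k
    rw [hk, LinearMap.zero_apply, _root_.zero_sub, neg_mem_iff] at h4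
    have h5 : c = 0 := by
      by_contra hc0
      have := (F.sub i).smul_mem (c ^ k)⁻¹ h4
      rw [smul_smul, inv_mul_cancel₀ (pow_ne_zero k hc0), one_smul] at this
      exact hvi this
    rw [← hyv, h5, zero_smul, zero_add]
    exact hz
  · by_cases hiN : finrank ℂ V ≤ i
    · exact F.mono hiN (F.sub_finrank.ge Submodule.mem_top)
    · refine (mem_sub_iff hQ hF (i := finrank ℂ V - i) (by omega)).2 fun u hu => ?_
      rw [← hy]
      exact (mem_sub_iff hQ hF (i := finrank ℂ V - i - 1) (by omega)).1 hv _ (h' _ (by omega) u hu)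

/-- An isometry preserves the flag as soon as it preserves its isotropic half. -/
theorem map_sub_le_of_isometry {g : End ℂ V} (hg : ∀ v w, form Q (g v) (g w) = form Q v w)
    (h : ∀ i ≤ n, ∀ v ∈ F.sub i, g v ∈ F.sub i) (i : ℕ) : (F.sub i).map g = F.sub i := by
  have hinj : Function.Injective g := by
    rw [← LinearMap.ker_eq_bot, LinearMap.ker_eq_bot']
    intro v hv
    refine LinearMap.ker_eq_bot.1 hQ.ker_eq_bot (LinearMap.ext fun w => ?_)
    change form Q v w = form Q 0 w
    rw [← hg, hv, map_zero]
    rfl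
  have heq : ∀ i, (∀ v ∈ F.sub i, g v ∈ F.sub i) → (F.sub i).map g = F.sub i := fun i hi =>
    Submodule.eq_of_le_of_finrank_eq (by rintro _ ⟨v, hv, rfl⟩; exact hi v hv)
      (LinearEquiv.finrank_eq (Submodule.equivMapOfInjective g hinj _)).symm
  refine heq i ?_
  rcases le_or_gt i n with hi | hi
  · exact h i hi
  · by_cases hiN : finrank ℂ V ≤ i
    · exact fun v _ => F.mono hiN (F.sub_finrank.ge Submodule.mem_top)
    · intro v hv
      refine (mem_sub_iff hQ hF (i := finrank ℂ V - i) (by omega)).2 fun u hu => ?_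
      rw [← heq _ (h (finrank ℂ V - i) (by omega))] at hu
      obtain ⟨u, hu, rfl⟩ := hu
      rw [hg]
      exact (mem_sub_iff hQ hF (by omega)).1 hv u hu

end Flag

/-! ### The Borel subgroup and the preimage of a fibre in the group -/

section Transporter

variable {V : Type*} [AddCommGroup V] [Module ℂ V] [FiniteDimensional ℂ V]
  {B : LinearMap.BilinForm ℂ V} (hB : B.Nondegenerate)

omit [FiniteDimensional ℂ V] in
theorem mul_mem_specialIsom_zero {k k' : End ℂ V} (hk : k ∈ specialIsom B 0)
    (hk' : k' ∈ specialIsom B 0) : k * k' ∈ specialIsom B 0 :=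
  ⟨fun v w => by rw [Module.End.mul_apply, Module.End.mul_apply, hk.1, hk'.1],
    by rw [map_mul, hk.2.1, hk'.2.1, one_mul], by rw [mul_zero, zero_mul]⟩

theorem adj_mul_self_of_mem {x k : End ℂ V} (hk : k ∈ specialIsom B x) : adj hB k * k = 1 :=
  (isometry_iff hB).1 hk.1

theorem self_mul_adj_of_mem {x k : End ℂ V} (hk : k ∈ specialIsom B x) : k * adj hB k = 1 :=
  mul_eq_one_comm.1 (adj_mul_self_of_mem hB hk)

theorem adj_mem_specialIsom_zero {k : End ℂ V} (hk : k ∈ specialIsom B 0) :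
    adj hB k ∈ specialIsom B 0 := by
  have h1 := self_mul_adj_of_mem hB hk
  refine ⟨fun v w => ?_, by rw [det_adj, hk.2.1], by rw [mul_zero, zero_mul]⟩
  rw [form_adj, ← Module.End.mul_apply, h1, Module.End.one_apply]

variable (B) in
/-- The elements of the special orthogonal group that move the frame `f` into the set `T`. -/
def transporter {n : ℕ} (f : Fin n → V) (T : Set (Fin n → V)) : Set (End ℂ V) :=
  {k | k ∈ specialIsom B 0 ∧ (fun i => k (f i)) ∈ T}

omit [FiniteDimensional ℂ V] in
theorem isPolyMap_apply_frame {n : ℕ} (f : Fin n → V) :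
    IsPolyMap fun (k : End ℂ V) i => k (f i) :=
  IsPolyMap.pi fun i => isPolyMap_linear (LinearMap.applyₗ (f i) : End ℂ V →ₗ[ℂ] V)

theorem isPolyMap_mul_left (k : End ℂ V) : IsPolyMap fun k' : End ℂ V => k * k' :=
  (isPolyMap_const k).mul isPolyMap_id

theorem isPolyImage_transporter {n : ℕ} (f : Fin n → V) {T : Set (Fin n → V)} (hT : IsPolyImage T) :
    IsPolyImage (transporter B f T) :=
  (isPolyImage_of_isClosed (isClosed_specialIsom 0)).inter_preimage hT (isPolyMap_apply_frame f)

include hB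

/-- By the transitivity of the group on frames, all fibres of the transporter over `T` are translates of
the stabilizer of `f`. -/
theorem dimGE_transporter (hs : ∀ v w, B v w = B w v) {n : ℕ}
    (hV : finrank ℂ V = 2 * n + 1) {f : Fin n → V} (hf : LinearIndependent ℂ f)
    (hf0 : ∀ i j, B (f i) (f j) = 0) {T : Set (Fin n → V)} (hT : ∀ t ∈ T, LinearIndependent ℂ t)
    (hT0 : ∀ t ∈ T, ∀ i j, B (t i) (t j) = 0) {D e : ℕ} (he : DimGE (transporter B f {f}) e)
    (hD : DimGE T D) : DimGE (transporter B f T) (D + e) := by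
  refine hD.of_fibres (isPolyMap_apply_frame f) fun t ht => ?_
  obtain ⟨k, hk, hkf⟩ := exists_specialIsom_apply_eq hB hs hV hf hf0 (hT t ht) (hT0 t ht)
  refine (he.image_of_leftInv (p := fun k' => k * k') (q := fun k' => adj hB k * k')
    (isPolyMap_mul_left _) fun k' _ => by
      rw [← mul_assoc, adj_mul_self_of_mem hB hk, one_mul]).mono ?_
  rintro _ ⟨k', ⟨hk', hk'f⟩, rfl⟩
  have h1 : (fun i => (k * k') (f i)) = t := funext fun i => by
    rw [Module.End.mul_apply, show k' (f i) = f i from congrFun hk'f i, hkf]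
  exact ⟨⟨mul_mem_specialIsom_zero hk hk', show (fun i => (k * k') (f i)) ∈ T by rw [h1]; exact ht⟩, h1⟩

theorem dimLE_transporter {n : ℕ} {f : Fin n → V} {T : Set (Fin n → V)}
    (hp : IsPolyImage (transporter B f T)) {D e : ℕ} (he : DimLE (transporter B f {f}) e)
    (hD : DimLE T D) : DimLE (transporter B f T) (D + e) := by
  refine hp.dimLE (isPolyMap_apply_frame f) (hD.mono ?_) ?_
  · rintro _ ⟨k, hk, rfl⟩
    exact hk.2
  · rintro _ ⟨k, hk, rfl⟩
    refine (he.image (p := fun k' => k * k') (isPolyMap_mul_left k)).mono ?_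
    rintro k' ⟨hk', hkk'⟩
    refine ⟨adj hB k * k', ⟨mul_mem_specialIsom_zero (adj_mem_specialIsom_zero hB hk.1) hk'.1,
      funext fun i => ?_⟩, ?_⟩
    · rw [Module.End.mul_apply, show k' (f i) = k (f i) from congrFun hkk' i, ← Module.End.mul_apply,
        adj_mul_self_of_mem hB hk.1, Module.End.one_apply]
    · change k * (adj hB k * k') = k'
      rw [← mul_assoc, self_mul_adj_of_mem hB hk.1, one_mul]

end Transporter

section FlagDimensions

variable {V : Type*} [AddCommGroup V] [Module ℂ V] [FiniteDimensional ℂ V]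

/-- The bases of the member `F.sub n` of a flag that are adapted to the flag. -/
def adaptedBases (F : CompleteFlag V) (n : ℕ) : Set (Fin n → V) :=
  {v | LinearIndependent ℂ v ∧ ∀ i : Fin n, v i ∈ F.sub (i + 1)}

theorem sum_fin_add_one (n : ℕ) : ∑ i : Fin n, ((i : ℕ) + 1) = n * (n + 1) / 2 := by
  rw [Fin.sum_univ_eq_sum_range (fun i => i + 1) n]
  induction n with
  | zero => rfl
  | succ n ih =>
    rw [Finset.sum_range_succ, ih, show (n + 1) * (n + 1 + 1) = n * (n + 1) + (n + 1) * 2 by ring,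
      Nat.add_mul_div_right _ _ two_pos]

theorem finrank_pi_sub (F : CompleteFlag V) {n : ℕ} (hn : n ≤ finrank ℂ V) :
    finrank ℂ (∀ i : Fin n, F.sub (i + 1)) = n * (n + 1) / 2 := by
  rw [finrank_pi_fintype, ← sum_fin_add_one]
  refine Finset.sum_congr rfl fun i _ => ?_
  rw [F.finrank_sub]
  omega

/-- The inclusion of the product of the members of a flag. -/
def piSubtype (F : CompleteFlag V) (n : ℕ) : (∀ i : Fin n, F.sub (i + 1)) →ₗ[ℂ] (Fin n → V) :=
  LinearMap.pi fun i => (F.sub (i + 1)).subtype ∘ₗ LinearMap.proj i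

theorem dimLE_adaptedBases (F : CompleteFlag V) {n : ℕ} (hn : n ≤ finrank ℂ V) :
    DimLE (adaptedBases F n) (n * (n + 1) / 2) := by
  rw [← finrank_pi_sub F hn]
  refine (dimLE_range_linearMap (piSubtype F n)).mono fun v hv => ?_
  exact ⟨fun i => ⟨v i, hv.2 i⟩, rfl⟩

/-- The linearly independent families form a non-empty open subset of the product of the members of the
flag. -/
theorem dimGE_adaptedBases (F : CompleteFlag V) {n : ℕ} (hn : n ≤ finrank ℂ V) :
    DimGE (adaptedBases F n) (n * (n + 1) / 2) := by
  obtain ⟨f, hf, hfF⟩ := F.exists_basis hn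
  obtain ⟨φ, hφ⟩ := LinearIndependent.exists_dual hf
  have hfm : ∀ i : Fin n, f i ∈ F.sub (i + 1) := fun i => by
    rw [hfF _ (by omega)]
    exact Submodule.subset_span ⟨i, Nat.lt_succ_self _, rfl⟩
  let d : (∀ i : Fin n, F.sub (i + 1)) → ℂ := fun v => (Matrix.of fun i j => φ i (v j)).det
  have hd : d ∈ polyFun (∀ i : Fin n, F.sub (i + 1)) := by
    have : d = ∑ σ : Equiv.Perm (Fin n), (fun _ => ((Equiv.Perm.sign σ : ℤ) : ℂ)) *
        ∏ i, fun v : ∀ i : Fin n, F.sub (i + 1) => φ (σ i) (v i) := by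
      ext v
      simp [d, Matrix.det_apply']
    rw [this]
    refine sum_mem fun σ _ => mul_mem (const_mem_polyFun _) (prod_mem fun i _ => ?_)
    exact dual_mem_polyFun (φ (σ i) ∘ₗ (F.sub (i + 1)).subtype ∘ₗ
      (LinearMap.proj i : (∀ i : Fin n, F.sub (i + 1)) →ₗ[ℂ] F.sub (i + 1)))
  have h1 : DimGE {v | d v ≠ 0} (n * (n + 1) / 2) := by
    rw [← finrank_pi_sub F hn]
    refine dimGE_open hd (w₀ := fun i => ⟨f i, hfm i⟩) ?_
    have : (Matrix.of fun i j => φ i (f j)) = 1 := by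
      ext i j
      rw [Matrix.of_apply, hφ, Matrix.one_apply]
    change (Matrix.of fun i j => φ i (f j)).det ≠ 0
    rw [this, Matrix.det_one]
    exact one_ne_zero
  have hinj : LinearMap.ker (piSubtype F n) = ⊥ := by
    rw [LinearMap.ker_eq_bot']
    intro v hv
    exact funext fun i => Subtype.ext (congrFun hv i)
  obtain ⟨l, hl⟩ := LinearMap.exists_leftInverse_of_injective _ hinj
  refine (h1.image_of_leftInv (p := piSubtype F n) (q := l) (isPolyMap_linear l)
    fun v _ => LinearMap.congr_fun hl v).mono ?_
  rintro _ ⟨v, hv, rfl⟩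
  refine ⟨?_, fun i => (v i).2⟩
  rw [Fintype.linearIndependent_iff]
  intro c hc
  have h2 : (Matrix.of fun i j => φ i (v j)).mulVec c = 0 := by
    ext i
    have := congrArg (φ i) hc
    rw [map_sum, map_zero] at this
    rw [Pi.zero_apply, ← this]
    change ∑ j, φ i (v j) * c j = _
    refine Finset.sum_congr rfl fun j _ => ?_
    rw [map_smul, smul_eq_mul, mul_comm]
    rfl
  exact congrFun (Matrix.eq_zero_of_mulVec_eq_zero hv h2)

variable (Q : QuadraticForm ℂ V) (hQ : (form Q).Nondegenerate) (F : CompleteFlag V)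

/-- The group `B_K`, as a set of endomorphisms. -/
def borelIsom : Set (End ℂ V) :=
  {g | g ∈ specialIsom (form Q) 0 ∧ ∀ i, ∀ v ∈ F.sub i, g v ∈ F.sub i}

/-- The elements `k` of `K` such that `Ad_{k⁻¹} x` lies in `𝔫₁`. -/
def springerSet (x : End ℂ V) : Set (End ℂ V) :=
  {k | k ∈ specialIsom (form Q) 0 ∧ adj hQ k * x * k ∈ nOne Q F}

theorem isClosed_borelIsom : IsClosed[zariski (End ℂ V)] (borelIsom Q F) := by
  let _ := zariski (End ℂ V)
  refine IsClosed.inter (s₂ := {g : End ℂ V | ∀ i, ∀ v ∈ F.sub i, g v ∈ F.sub i})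
    (isClosed_specialIsom 0) ?_
  simp only [Set.ofPred_forall]
  exact isClosed_iInter fun i => isClosed_iInter fun v => isClosed_iInter fun _ =>
    isClosed_preimage_of_isPolyMap (isPolyMap_linear (LinearMap.applyₗ v : End ℂ V →ₗ[ℂ] V))
      (isClosed_submodule _)

variable {Q F} (hF : F.borel.map (theta Q hQ) = F.borel) {n : ℕ} (hV : finrank ℂ V = 2 * n + 1)

omit [FiniteDimensional ℂ V] in
theorem mem_of_forall_mem_span {M : Submodule ℂ V} {S : Set V} {g : End ℂ V} (h : ∀ v ∈ S, g v ∈ M) {v : V}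
    (hv : v ∈ Submodule.span ℂ S) : g v ∈ M :=
  (Submodule.span_le (p := M.comap g)).2 h hv

include hF hV

/-- An isometry preserves the flag as soon as it preserves the isotropic half spanned by `f`. -/
theorem borelIsom_eq_transporter {f : Fin n → V} (hf : LinearIndependent ℂ f)
    (hfF : ∀ i ≤ n, F.sub i = Submodule.span ℂ (f '' {j | (j : ℕ) < i})) :
    borelIsom Q F = transporter (form Q) f (adaptedBases F n) := by
  ext g
  constructor
  · rintro ⟨hg, hgF⟩
    refine ⟨hg, ?_, fun i => hgF _ _ ?_⟩
    · refine hf.map' g (LinearMap.ker_eq_bot.2 fun v w hvw => ?_)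
      have h1 := congrArg (adj hQ g) hvw
      rwa [← Module.End.mul_apply, ← Module.End.mul_apply, adj_mul_self_of_mem hQ hg] at h1
    · rw [hfF _ (by omega)]
      exact Submodule.subset_span ⟨i, Nat.lt_succ_self _, rfl⟩
  · rintro ⟨hg, -, hgF⟩
    refine ⟨hg, fun i v hv => ?_⟩
    have h1 := map_sub_le_of_isometry hQ hF hV hg.1 (fun i hi v hv => ?_) i
    · rw [← h1]
      exact ⟨v, hv, rfl⟩
    · rw [hfF i hi] at hv
      refine mem_of_forall_mem_span ?_ hv
      rintro _ ⟨j, hj, rfl⟩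
      exact F.mono (Nat.succ_le_of_lt hj) (hgF j)

/-- The preimage in `K` of the fibre over `x` consists of the elements which move `f` to a frame for
`x`. -/
theorem springerSet_eq_transporter {f : Fin n → V} (hf : LinearIndependent ℂ f)
    (hfF : ∀ i ≤ n, F.sub i = Submodule.span ℂ (f '' {j | (j : ℕ) < i}))
    (hf0 : ∀ i j, form Q (f i) (f j) = 0)
    {x : End ℂ V} (hx : ∀ v w, form Q (x v) w = form Q v (x w)) (hn : IsNilpotent x) :
    springerSet Q hQ F x = transporter (form Q) f (frames (form Q) x n) := by
  have hset : ∀ i : Fin n, {j : Fin n | (j : ℕ) < i} = Set.Iio i := fun i => rfl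
  ext k
  refine and_congr_right fun hk => ?_
  have hk1 := adj_mul_self_of_mem hQ hk
  have hk2 := self_mul_adj_of_mem hQ hk
  -- both conditions say that `Ad_{k⁻¹} x` moves down the vectors of the frame `f`
  have hspan : ∀ i : Fin n, x (k (f i)) ∈ Submodule.span ℂ ((fun i => k (f i)) '' Set.Iio i) ↔
      (adj hQ k * x * k) (f i) ∈ F.sub i := fun i => by
    have h1 : Submodule.span ℂ ((fun i => k (f i)) '' Set.Iio i) = (F.sub i).map k := by
      rw [hfF i i.2.le, Submodule.map_span, hset, Set.image_image]
    rw [h1]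
    constructor
    · rintro ⟨v, hv, hvx⟩
      rw [mul_assoc, Module.End.mul_apply, Module.End.mul_apply, ← hvx, ← Module.End.mul_apply, hk1]
      exact hv
    · intro h
      refine ⟨_, h, ?_⟩
      rw [← Module.End.mul_apply, mul_assoc, ← mul_assoc, hk2, one_mul, Module.End.mul_apply]
  constructor
  · intro h
    refine ⟨?_, fun i j => by rw [hk.1, hf0], fun i => (hspan i).2 (h.1 i (f i) ?_)⟩
    · refine hf.map' k (LinearMap.ker_eq_bot.2 fun v w hvw => ?_)
      have h1 := congrArg (adj hQ k) hvw
      rwa [← Module.End.mul_apply, ← Module.End.mul_apply, hk1] at h1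
    · rw [hfF _ (by omega)]
      exact Submodule.subset_span ⟨i, Nat.lt_succ_self _, rfl⟩
  · intro h
    refine mem_nOne hQ hF hV (fun v w => ?_) ?_ fun i hi v hv => ?_
    · rw [mul_assoc, Module.End.mul_apply, Module.End.mul_apply, Module.End.mul_apply, form_adj, hx,
        form_adj_right hQ form_symm]
      rfl
    · obtain ⟨M, hM⟩ := hn
      refine ⟨M, ?_⟩
      have hpow : ∀ M, (adj hQ k * x * k) ^ M = adj hQ k * x ^ M * k := fun M => by
        induction M with
        | zero => rw [pow_zero, pow_zero, mul_one, hk1]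
        | succ M ih =>
          rw [pow_succ, ih, pow_succ]
          calc _ = adj hQ k * x ^ M * (k * adj hQ k) * x * k := by simp only [mul_assoc]
            _ = _ := by rw [hk2, mul_one]; simp only [mul_assoc]
      rw [hpow, hM, mul_zero, zero_mul]
    · rw [hfF _ (by omega)] at hv
      refine mem_of_forall_mem_span ?_ hv
      rintro _ ⟨j, hj, rfl⟩
      exact F.mono (Nat.le_of_lt_succ hj) ((hspan j).1 (h.map_mem j))

/-- The dimensions of `B_K` and of the preimage in `K` of the fibre over `x`. -/
theorem exists_dim_springerSet : ∃ e,
    DimGE (borelIsom Q F) (n * (n + 1) / 2 + e) ∧ DimLE (borelIsom Q F) (n * (n + 1) / 2 + e) ∧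
    ∀ x : End ℂ V, (∀ v w, form Q (x v) w = form Q v (x w)) → IsNilpotent x →
      ((springerSet Q hQ F x).Nonempty → (frames (form Q) x n).Nonempty) ∧
      ∀ D, (DimGE (frames (form Q) x n) D → DimGE (springerSet Q hQ F x) (D + e)) ∧
        (DimLE (frames (form Q) x n) D → DimLE (springerSet Q hQ F x) (D + e)) := by
  obtain ⟨f, hf, hfF⟩ := F.exists_basis (n := n) (by omega)
  have hiso : ∀ v ∈ adaptedBases F n, ∀ i j, form Q (v i) (v j) = 0 := fun v hv i j =>
    form_eq_zero_of_mem_sub hQ hF hV (F.mono (by omega) (hv.2 i)) (F.mono (by omega) (hv.2 j))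
  have hfB : f ∈ adaptedBases F n := ⟨hf, fun i => by
    rw [hfF _ (by omega)]
    exact Submodule.subset_span ⟨i, Nat.lt_succ_self _, rfl⟩⟩
  have hf0 := hiso f hfB
  have hne : (transporter (form Q) f {f}).Nonempty :=
    ⟨1, ⟨fun v w => rfl, map_one _, by rw [one_mul, mul_one]⟩, rfl⟩
  refine ⟨zdim (transporter (form Q) f {f}), ?_, ?_, fun x hx hn => ⟨?_, fun D => ⟨?_, ?_⟩⟩⟩
  · rw [borelIsom_eq_transporter hQ hF hV hf hfF]
    exact dimGE_transporter hQ form_symm hV hf hf0 (fun t ht => ht.1) hiso (dimGE_zdim hne)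
      (dimGE_adaptedBases F (by omega))
  · have h1 := isPolyImage_of_isClosed (isClosed_borelIsom Q F)
    rw [borelIsom_eq_transporter hQ hF hV hf hfF] at h1 ⊢
    exact dimLE_transporter hQ h1 dimLE_zdim (dimLE_adaptedBases F (by omega))
  all_goals rw [springerSet_eq_transporter hQ hF hV hf hfF hf0 hx hn]
  · rintro ⟨k, -, hk⟩
    exact ⟨_, hk⟩
  · exact dimGE_transporter hQ form_symm hV hf hf0 (fun t ht => ht.linearIndependent)
      (fun t ht => ht.isotropic) (dimGE_zdim hne)
  · exact dimLE_transporter hQ (isPolyImage_transporter f (isPolyImage_frames n)) dimLE_zdim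

end FlagDimensions

/-! ### The fibre as a quotient -/

section Fibre

theorem topologicalKrullDim_of_isEmpty {X : Type*} [TopologicalSpace X] [h : IsEmpty X] :
    topologicalKrullDim X = ⊥ :=
  have : IsEmpty (TopologicalSpace.IrreducibleCloseds X) :=
    ⟨fun Z => h.elim Z.isIrreducible.nonempty.some⟩
  Order.krullDim_eq_bot

variable {V : Type*} [AddCommGroup V] [Module ℂ V]

/-- An element of `SL(V)`, as an endomorphism. -/
abbrev toEnd (g : SpecialLinearGroup ℂ V) : End ℂ V := ((g : V ≃ₗ[ℂ] V) : V →ₗ[ℂ] V)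

theorem toEnd_injective : Function.Injective (toEnd (V := V)) := fun g h hgh =>
  SpecialLinearGroup.ext g h fun v => LinearMap.congr_fun hgh v

variable [FiniteDimensional ℂ V] {Q : QuadraticForm ℂ V}

omit [FiniteDimensional ℂ V] in
theorem toEnd_mem {g : SpecialLinearGroup ℂ V} (hg : g ∈ specialOrthogonal Q) :
    toEnd g ∈ specialIsom (form Q) 0 := by
  refine ⟨fun v w => form_isometry hg v w, ?_, by rw [mul_zero, zero_mul]⟩
  have h1 := LinearEquiv.coe_det (g : V ≃ₗ[ℂ] V)
  rw [g.2, Units.val_one] at h1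
  exact h1.symm

variable (hQ : (form Q).Nondegenerate)

include hQ in
theorem exists_toEnd_eq {k : End ℂ V} (hk : k ∈ specialIsom (form Q) 0) :
    ∃ g ∈ specialOrthogonal Q, toEnd g = k := by
  let e : V ≃ₗ[ℂ] V := LinearEquiv.ofLinearMap k (adj hQ k) (self_mul_adj_of_mem hQ hk)
    (adj_mul_self_of_mem hQ hk)
  have he : LinearEquiv.det e = 1 := by
    rw [← Units.val_inj, LinearEquiv.coe_det, Units.val_one]
    exact hk.2.1
  refine ⟨⟨e, he⟩, fun v => ?_, rfl⟩
  have h1 := hk.1 v v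
  rwa [QuadraticMap.associated_eq_self_apply, QuadraticMap.associated_eq_self_apply] at h1

theorem adj_toEnd {g : SpecialLinearGroup ℂ V} (hg : g ∈ specialOrthogonal Q) :
    adj hQ (toEnd g) = (((g : V ≃ₗ[ℂ] V).symm : V ≃ₗ[ℂ] V) : V →ₗ[ℂ] V) := by
  refine (adj_eq_iff hQ).2 fun v w => ?_
  have h1 := form_isometry hg ((g : V ≃ₗ[ℂ] V).symm v) w
  rw [show g ((g : V ≃ₗ[ℂ] V).symm v) = v from (g : V ≃ₗ[ℂ] V).apply_symm_apply v] at h1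
  exact h1.symm

theorem Ad_eq {g : SpecialLinearGroup ℂ V} (hg : g ∈ specialOrthogonal Q) (y : End ℂ V) :
    Ad g y = toEnd g * y * adj hQ (toEnd g) := by
  rw [adj_toEnd hQ hg]
  rfl

omit [FiniteDimensional ℂ V] in
theorem toEnd_mem_borelIsom {F : CompleteFlag V} {g : SpecialLinearGroup ℂ V}
    (hg : g ∈ F.borel ⊓ specialOrthogonal Q) : toEnd g ∈ borelIsom Q F :=
  ⟨toEnd_mem hg.2, fun i v hv => by
    rw [← hg.1 i]
    exact ⟨v, hv, rfl⟩⟩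

theorem mem_borel_of_toEnd_mem {F : CompleteFlag V} {g : SpecialLinearGroup ℂ V}
    (hg : ∀ i, ∀ v ∈ F.sub i, toEnd g v ∈ F.sub i) : g ∈ F.borel := fun i =>
  Submodule.eq_of_le_of_finrank_eq (by rintro _ ⟨v, hv, rfl⟩; exact hg i v hv)
    (LinearEquiv.finrank_map_eq (g : V ≃ₗ[ℂ] V) (F.sub i))

omit [FiniteDimensional ℂ V] in
theorem Ad_mem_nOne {F : CompleteFlag V} {g : SpecialLinearGroup ℂ V}
    (hg : g ∈ F.borel ⊓ specialOrthogonal Q) {y : End ℂ V} (hy : y ∈ nOne Q F) :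
    Ad g y ∈ nOne Q F := by
  refine ⟨fun i v hv => ?_, Ad_mem_gOne hg.2 hy.2⟩
  have h1 : (g : V ≃ₗ[ℂ] V).symm v ∈ F.sub (i + 1) := by
    rw [← (inv_mem hg.1 : g⁻¹ ∈ F.borel) (i + 1)]
    exact ⟨v, hv, rfl⟩
  rw [← hg.1 i]
  exact ⟨_, hy.1 i _ h1, rfl⟩

variable (F : CompleteFlag V) (x : NilCone Q)

/-- The preimage in `K × 𝔫₁` of the fibre of the resolution over `x`. -/
abbrev PreFibre : Type _ :=
  {p : PreResolution Q F // resolution Q F (Quotient.mk (resolutionSetoid Q F) p) = x}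

/-- The embedding of the preimage of the fibre into `End(V) × End(V)`. -/
def PreFibre.embed (p : PreFibre F x) : End ℂ V × End ℂ V := (toEnd p.1.1.1, p.1.2.1)

/-- The projection of the preimage of the fibre onto the fibre. -/
def PreFibre.proj (p : PreFibre F x) : resolution Q F ⁻¹' {x} := ⟨Quotient.mk _ p.1, p.2⟩

/-- The action of `B_K` on `K × 𝔫₁`. -/
def borelAct (p : (End ℂ V × End ℂ V) × End ℂ V) : End ℂ V × End ℂ V :=
  (p.1.1 * p.2, adj hQ p.2 * p.1.2 * p.2)

theorem PreFibre.range_embed : Set.range (PreFibre.embed F x) =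
    {p | p.1 ∈ specialIsom (form Q) 0 ∧ p.2 ∈ nOne Q F ∧ p.1 * p.2 * adj hQ p.1 = x.1} := by
  ext ⟨k, y⟩
  constructor
  · rintro ⟨⟨⟨⟨k, hk⟩, ⟨y, hy⟩⟩, hp⟩, h⟩
    cases h
    refine ⟨toEnd_mem hk, hy, ?_⟩
    rw [← congrArg Subtype.val hp]
    exact (Ad_eq hQ hk y).symm
  · rintro ⟨hk, hy, hkx⟩
    obtain ⟨k, hk', rfl⟩ := exists_toEnd_eq hQ hk
    exact ⟨⟨(⟨k, hk'⟩, ⟨y, hy⟩), Subtype.ext ((Ad_eq hQ hk' y).trans hkx)⟩, rfl⟩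

/-- The preimage of the fibre is the graph of `k ↦ Ad_{k⁻¹} x` over the set `springerSet`. -/
theorem PreFibre.range_embed_eq_image : Set.range (PreFibre.embed F x) =
    (fun k => (k, adj hQ k * x.1 * k)) '' springerSet Q hQ F x.1 := by
  rw [range_embed hQ]
  ext ⟨k, y⟩
  constructor
  · rintro ⟨hk, hy, hkx⟩
    have hk : k ∈ specialIsom (form Q) 0 := hk
    have h1 : adj hQ k * x.1 * k = y := by
      rw [← hkx]
      calc adj hQ k * (k * y * adj hQ k) * k = (adj hQ k * k) * y * (adj hQ k * k) := by
            simp only [mul_assoc]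
        _ = y := by rw [adj_mul_self_of_mem hQ hk, one_mul, mul_one]
    exact ⟨k, ⟨hk, by rw [h1]; exact hy⟩, Prod.ext rfl h1⟩
  · rintro ⟨k, ⟨hk, hy⟩, h⟩
    cases h
    refine ⟨hk, hy, ?_⟩
    change k * (adj hQ k * x.1 * k) * adj hQ k = x.1
    calc k * (adj hQ k * x.1 * k) * adj hQ k = (k * adj hQ k) * x.1 * (k * adj hQ k) := by
          simp only [mul_assoc]
      _ = x.1 := by rw [self_mul_adj_of_mem hQ hk, one_mul, mul_one]

theorem isPolyMap_borelAct : IsPolyMap (borelAct hQ) :=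
  IsPolyMap.prodMk (isPolyMap_id.fst.fst.mul isPolyMap_id.snd)
    (((isPolyMap_id.snd.linear (adj hQ)).mul isPolyMap_id.fst.snd).mul isPolyMap_id.snd)

/-- The fibre is the quotient by `B_K` of its preimage. -/
theorem isQuotientBy_preFibre {b : ℕ} (hb : DimGE (borelIsom Q F) b) (hb' : DimLE (borelIsom Q F) b) :
    IsQuotientBy (borelIsom Q F) (borelAct hQ) (PreFibre.embed F x) (PreFibre.proj F x) b where
  isInducing := by
    let _ := zariski (End ℂ V × End ℂ V)
    exact (IsInducing.induced (fun p : PreResolution Q F => (toEnd p.1.1, p.2.1))).comp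
      IsInducing.subtypeVal
  injective := by
    rintro ⟨⟨⟨k, hk⟩, ⟨y, hy⟩⟩, hp⟩ ⟨⟨⟨k', hk'⟩, ⟨y', hy'⟩⟩, hp'⟩ h
    obtain rfl : k = k' := toEnd_injective (congrArg Prod.fst h)
    obtain rfl : y = y' := congrArg Prod.snd h
    rfl
  isClosed_range := by
    let _ := zariski (End ℂ V × End ℂ V)
    rw [PreFibre.range_embed hQ]
    exact (isClosed_preimage_of_isPolyMap isPolyMap_id.fst (isClosed_specialIsom 0)).inter
      ((isClosed_preimage_of_isPolyMap isPolyMap_id.snd (isClosed_submodule _)).inter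
      (isClosed_eq_of_isPolyMap ((isPolyMap_id.fst.mul isPolyMap_id.snd).mul
        (isPolyMap_id.fst.linear (adj hQ))) (isPolyMap_const _)))
  continuous := (continuous_coinduced_rng.comp continuous_subtype_val).subtype_mk _
  surjective := by
    rintro ⟨z, hz⟩
    obtain ⟨p, rfl⟩ := Quotient.exists_rep z
    exact ⟨⟨p, hz⟩, rfl⟩
  isClosed := isClosed_borelIsom Q F
  isPolyMap := isPolyMap_borelAct hQ
  exists_mul := by
    rintro ⟨⟨⟨k, hk⟩, ⟨y, hy⟩⟩, hp⟩ β hβ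
    obtain ⟨b, hb, rfl⟩ := exists_toEnd_eq hQ hβ.1
    have hb' : b ∈ F.borel ⊓ specialOrthogonal Q := ⟨mem_borel_of_toEnd_mem hβ.2, hb⟩
    let p' : PreResolution Q F := (⟨k * b, mul_mem hk hb⟩, ⟨Ad b⁻¹ y, Ad_mem_nOne (inv_mem hb') hy⟩)
    have h1 : (Quotient.mk (resolutionSetoid Q F) p') =
        Quotient.mk (resolutionSetoid Q F) (⟨k, hk⟩, ⟨y, hy⟩) := by
      have h2 : y = Ad b (Ad b⁻¹ y) := by rw [← Ad_mul, mul_inv_cancel, Ad_one]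
      exact (Quotient.sound (s := resolutionSetoid Q F) ⟨b, hb', rfl, h2⟩).symm
    refine ⟨⟨p', (congrArg _ h1).trans hp⟩, Prod.ext rfl ?_, Subtype.ext h1⟩
    change Ad b⁻¹ y = adj hQ (toEnd b) * y * toEnd b
    rw [adj_toEnd hQ hb]
    rfl
  exists_of_eq := by
    rintro ⟨⟨⟨k, hk⟩, ⟨y, hy⟩⟩, hp⟩ ⟨⟨⟨k', hk'⟩, ⟨y', hy'⟩⟩, hp'⟩ h
    obtain ⟨b, hb, h1, h2⟩ := Quotient.exact (congrArg Subtype.val h)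
    have h1 : k' = k * b := h1
    have h2 : y = Ad b y' := h2
    refine ⟨toEnd b, toEnd_mem_borelIsom hb, Prod.ext (congrArg toEnd h1) ?_⟩
    change y' = adj hQ (toEnd b) * y * toEnd b
    rw [h2, Ad_eq hQ hb.2]
    have h3 := adj_mul_self_of_mem hQ (toEnd_mem hb.2)
    calc y' = (adj hQ (toEnd b) * toEnd b) * y' * (adj hQ (toEnd b) * toEnd b) := by
          rw [h3, one_mul, mul_one]
      _ = _ := by simp only [mul_assoc]
  isClosed_image := by
    intro A hA hsat
    have hY : IsClosed {p : PreResolution Q F |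
        resolution Q F (Quotient.mk (resolutionSetoid Q F) p) = x} := by
      let _ := zariski (End ℂ V × End ℂ V)
      have h1 : IsClosed {p : End ℂ V × End ℂ V | p.1 * p.2 * adj hQ p.1 = x.1} :=
        isClosed_eq_of_isPolyMap ((isPolyMap_id.fst.mul isPolyMap_id.snd).mul
          (isPolyMap_id.fst.linear (adj hQ))) (isPolyMap_const _)
      refine (congrArg IsClosed ?_).mp (h1.preimage (continuous_induced_dom
        (f := fun p : PreResolution Q F => (toEnd p.1.1, p.2.1))))
      ext p
      change toEnd p.1.1 * p.2.1 * adj hQ (toEnd p.1.1) = x.1 ↔ _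
      rw [← Ad_eq hQ p.1.2]
      exact (Subtype.ext_iff (a1 := resolution Q F (Quotient.mk (resolutionSetoid Q F) p))
        (a2 := x)).symm
    have h2 : IsClosed (Subtype.val '' A) := hY.isClosedMap_subtype_val A hA
    refine ⟨?_⟩
    refine ⟨(Quotient.mk (resolutionSetoid Q F) '' (Subtype.val '' A))ᶜ, ?_, ?_⟩
    · rw [isOpen_compl_iff]
      refine isClosed_coinduced.2 ((congrArg IsClosed ?_).mp h2)
      ext p
      constructor
      · intro hp
        exact ⟨p, hp, rfl⟩
      · rintro ⟨_, ⟨a, ha, rfl⟩, hap⟩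
        have h3 : resolution Q F (Quotient.mk (resolutionSetoid Q F) p) = x := by
          rw [← hap]; exact a.2
        exact ⟨⟨p, h3⟩, hsat a ha _ (Subtype.ext hap.symm), rfl⟩
    · ext z
      rw [Set.mem_preimage, Set.mem_compl_iff, Set.mem_compl_iff, not_iff_not]
      constructor
      · rintro ⟨_, ⟨a, ha, rfl⟩, haz⟩
        exact ⟨a, ha, Subtype.ext haz⟩
      · rintro ⟨a, ha, rfl⟩
        exact ⟨a.1, ⟨a, ha, rfl⟩, rfl⟩
  dimLE := by
    intro p
    rw [Set.singleton_prod, Set.image_image]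
    exact hb'.image ((isPolyMap_borelAct hQ).comp ((isPolyMap_const _).prodMk isPolyMap_id))
  dimGE := by
    intro p
    rw [Set.singleton_prod, Set.image_image]
    refine hb.image_of_leftInv (q := fun p' => adj hQ (toEnd p.1.1.1) * p'.1)
      ((isPolyMap_const _).mul isPolyMap_id.fst) fun β _ => ?_
    change adj hQ (toEnd p.1.1.1) * (toEnd p.1.1.1 * β) = β
    rw [← mul_assoc, adj_mul_self_of_mem hQ (toEnd_mem p.1.1.2), one_mul]

variable {F} (hF : F.borel.map (theta Q hQ) = F.borel) {n : ℕ} (hV : finrank ℂ V = 2 * n + 1)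

include hF hV

/-- The dimension of the fibre over `x` is that of the set of frames, minus that of the Borel subgroup
of `GL_n`. -/
theorem topologicalKrullDim_fibre :
    (frames (form Q) x.1 n = ∅ ∧ topologicalKrullDim (resolution Q F ⁻¹' {x}) = ⊥) ∨
    ∃ d : ℕ, topologicalKrullDim (resolution Q F ⁻¹' {x}) = d ∧
      DimGE (frames (form Q) x.1 n) (d + n * (n + 1) / 2) ∧
      DimLE (frames (form Q) x.1 n) (d + n * (n + 1) / 2) := by
  obtain ⟨e, hb, hb', hdim⟩ := exists_dim_springerSet hQ hF hV
  obtain ⟨hne, hD⟩ := hdim x.1 x.2.1.2 x.2.2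
  have hq := isQuotientBy_preFibre hQ F x hb hb'
  have hpm : IsPolyMap fun k : End ℂ V => (k, adj hQ k * x.1 * k) :=
    isPolyMap_id.prodMk (((isPolyMap_linear (adj hQ)).mul (isPolyMap_const _)).mul isPolyMap_id)
  rcases (frames (form Q) x.1 n).eq_empty_or_nonempty with h0 | h0
  · left
    refine ⟨h0, ?_⟩
    have : IsEmpty (resolution Q F ⁻¹' {x}) := by
      by_contra hcon
      rw [not_isEmpty_iff] at hcon
      obtain ⟨z⟩ := hcon
      obtain ⟨p, rfl⟩ := hq.surjective z
      have h1 : PreFibre.embed F x p ∈ Set.range (PreFibre.embed F x) := ⟨p, rfl⟩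
      rw [PreFibre.range_embed_eq_image hQ] at h1
      obtain ⟨k, hk, -⟩ := h1
      have := hne ⟨k, hk⟩
      rw [h0] at this
      exact Set.not_nonempty_empty this
    exact topologicalKrullDim_of_isEmpty
  · right
    have h1 := (hD _).1 (dimGE_zdim h0)
    have h2 := (hD _).2 dimLE_zdim
    have h3 : DimGE (Set.range (PreFibre.embed F x)) (zdim (frames (form Q) x.1 n) + e) := by
      rw [PreFibre.range_embed_eq_image hQ]
      exact h1.image_of_leftInv isPolyMap_id.fst fun k _ => rfl
    have h4 : DimLE (Set.range (PreFibre.embed F x)) (zdim (frames (form Q) x.1 n) + e) := by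
      rw [PreFibre.range_embed_eq_image hQ]
      exact h2.image hpm
    obtain ⟨_, ⟨p, rfl⟩⟩ := h3.nonempty
    have h5 : n * (n + 1) / 2 + e ≤ zdim (frames (form Q) x.1 n) + e := by
      refine h4 _ ((hq.dimGE p).mono ?_)
      rintro _ ⟨⟨w, β⟩, ⟨hw, hβ⟩, rfl⟩
      obtain rfl : w = _ := hw
      obtain ⟨y', hy', -⟩ := hq.exists_mul p β hβ
      exact ⟨y', hy'⟩
    obtain ⟨d, hd⟩ : ∃ d, zdim (frames (form Q) x.1 n) = d + n * (n + 1) / 2 :=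
      ⟨_, (Nat.sub_add_cancel (by omega)).symm⟩
    rw [show zdim (frames (form Q) x.1 n) + e = n * (n + 1) / 2 + e + d by omega] at h3 h4
    exact ⟨d, le_antisymm (hq.topologicalKrullDim_le h4) (hq.le_topologicalKrullDim h3),
      hd ▸ dimGE_zdim h0, hd ▸ dimLE_zdim⟩

end Fibre

/-! ### Partitions, orbits and the nilpotent cone -/

section Partitions

/-- The block counts of a partition are paired exactly when it has the form
`(2p₁ + 1, 2p₂, 2p₃, …)`. -/
theorem isPaired_iff {s n : ℕ} {lam : Fin s → ℕ} (hl : Antitone lam) (hsum : ∑ i, lam i = 2 * n + 1)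
    {r : ℕ → ℕ} (hr : ∀ j, r j = ∑ i, if j < lam i then 1 else 0) :
    IsPaired r ↔ ∃ p : Fin s → ℕ, Antitone p ∧ ∑ i, p i = n ∧
      ∀ i : Fin s, lam i = if (i : ℕ) = 0 then 2 * p i + 1 else 2 * p i := by
  obtain ⟨s, rfl⟩ : ∃ t, s = t + 1 := Nat.exists_eq_succ_of_ne_zero fun h => by
    subst h
    simp at hsum
  constructor
  · intro hp
    -- an odd part has to be the first one
    have heven : ∀ i : Fin s, Even (lam i.succ) := fun i => by
      by_contra hodd
      obtain ⟨m, hm⟩ := Nat.not_even_iff_odd.1 hodd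
      have h0 : lam i.succ ≤ lam 0 := hl (Fin.zero_le _)
      have h1 : r (2 * m + 1) < r (2 * m) := by
        rw [hr, hr]
        refine Finset.sum_lt_sum (fun k _ => ?_) ⟨i.succ, Finset.mem_univ _, ?_⟩
        · split_ifs <;> omega
        · rw [if_neg (by omega), if_pos (by omega)]
          exact zero_lt_one
      have h2 : 2 ≤ r (2 * m) := by
        rw [hr, Fin.sum_univ_succ, if_pos (by omega)]
        have h3 : 1 ≤ ∑ k : Fin s, if 2 * m < lam k.succ then 1 else 0 := by
          have := Finset.single_le_sum (f := fun k : Fin s => if 2 * m < lam k.succ then 1 else 0)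
            (fun _ _ => Nat.zero_le _) (Finset.mem_univ i)
          rwa [if_pos (by omega)] at this
        omega
      have := hp m
      omega
    have hlam : ∀ i : Fin s, lam i.succ = 2 * (lam i.succ / 2) := fun i =>
      (Nat.two_mul_div_two_of_even (heven i)).symm
    have hsum' := hsum
    rw [Fin.sum_univ_succ, Finset.sum_congr rfl fun i _ => hlam i, ← Finset.mul_sum] at hsum'
    refine ⟨fun i => lam i / 2, fun i j hij => Nat.div_le_div_right (hl hij), ?_, fun i => ?_⟩
    · rw [Fin.sum_univ_succ]
      omega
    · refine Fin.cases ?_ (fun i => ?_) i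
      · change lam 0 = 2 * (lam 0 / 2) + 1
        omega
      · rw [if_neg (by simp)]
        exact hlam i
  · rintro ⟨p, hp, -, hlam⟩ m
    have h0 : lam 0 = 2 * p 0 + 1 := by rw [hlam]; exact if_pos rfl
    have h1 : ∀ i : Fin s, lam i.succ = 2 * p i.succ := fun i => by rw [hlam, if_neg (by simp)]
    rw [hr, hr, Fin.sum_univ_succ, Fin.sum_univ_succ, h0]
    have h2 : ∀ i : Fin s, (if 2 * m < lam i.succ then 1 else 0) =
        if 2 * m + 1 < lam i.succ then 1 else 0 := fun i => by
      rw [h1]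
      split_ifs <;> omega
    rw [Finset.sum_congr rfl fun i _ => h2 i]
    by_cases hm : m = p 0
    · right
      have h3 : ∑ i : Fin s, (if 2 * m + 1 < lam i.succ then 1 else 0) = 0 :=
        Finset.sum_eq_zero fun i _ => if_neg (by
          have : p i.succ ≤ p 0 := hp (Fin.zero_le _)
          rw [h1]
          omega)
      rw [h3, if_pos (by omega), if_neg (by omega)]
      exact ⟨rfl, rfl⟩
    · left
      congr 1
      split_ifs <;> omega

end Partitions

section Nilpotent

variable {V : Type*} [AddCommGroup V] [Module ℂ V] [FiniteDimensional ℂ V]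

omit [FiniteDimensional ℂ V] in
theorem HasJordanType.pow_finrank_eq_zero {x : End ℂ V} {s : ℕ} {lam : Fin s → ℕ}
    (h : HasJordanType x lam) : x ^ finrank ℂ V = 0 := by
  obtain ⟨b, hb⟩ := h
  refine b.ext fun p => ?_
  have h1 := (show HasJordanType x lam from ⟨b, hb⟩).le_finrank p.1
  rw [← jordanVec_coe, pow_jordanVec hb, jordanVec, dif_neg (by omega), LinearMap.zero_apply]

theorem pow_finrank_eq_zero {x : End ℂ V} (hx : IsNilpotent x) : x ^ finrank ℂ V = 0 :=
  let ⟨_, _, h⟩ := exists_hasJordanType hx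
  h.pow_finrank_eq_zero

end Nilpotent

section Dimensions

variable {V : Type*} [AddCommGroup V] [Module ℂ V] [FiniteDimensional ℂ V] {Q : QuadraticForm ℂ V}
  (hQ : (form Q).Nondegenerate)

theorem range_orbit (x : NilCone Q) :
    Set.range (fun z : orbit x => (z.1.1 : End ℂ V)) = orbitSet hQ x.1 := by
  ext y
  constructor
  · rintro ⟨⟨z, g, hg, hz⟩, rfl⟩
    exact ⟨toEnd g, toEnd_mem hg, (Ad_eq hQ hg x.1).symm.trans hz.symm⟩
  · rintro ⟨k, hk, rfl⟩
    obtain ⟨g, hg, rfl⟩ := exists_toEnd_eq hQ hk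
    have h1 : Ad g x.1 = toEnd g * x.1 * adj hQ (toEnd g) := Ad_eq hQ hg x.1
    have h2 : IsNilpotent (Ad g x.1) := by
      obtain ⟨m, hm⟩ := x.2.2
      refine ⟨m, ?_⟩
      have h3 : (g : V ≃ₗ[ℂ] V).conjAlgEquiv ℂ x.1 ^ m = 0 := by rw [← map_pow, hm, map_zero]
      exact h3
    exact ⟨⟨⟨Ad g x.1, Ad_mem_gOne hg x.2.1, h2⟩, g, hg, rfl⟩, h1⟩

omit [FiniteDimensional ℂ V] in
theorem isInducing_nilCone : @IsInducing (NilCone Q) (End ℂ V) _ (zariski (End ℂ V)) Subtype.val :=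
  @IsInducing.induced _ _ (zariski (End ℂ V)) _

include hQ

/-- The codimension of an orbit in `𝒩₁` is the dimension of the skew-adjoint centralizer, since the
dimension of `𝒩₁` is that of `K` by `topologicalKrullDim_nilCone`. -/
theorem topologicalKrullDim_orbit (x : NilCone Q) : ∃ o : ℕ,
    o + finrank ℂ (skewCent (form Q) x.1) = finrank ℂ (skewCent (form Q) 0) ∧
    topologicalKrullDim (orbit x) = o := by
  obtain ⟨o, ho, h1, h2⟩ := exists_dim_orbitSet hQ x.1
  have hi : @IsInducing (orbit x) (End ℂ V) _ (zariski (End ℂ V)) (fun z => z.1.1) := by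
    let _ := zariski (End ℂ V)
    exact isInducing_nilCone.comp IsInducing.subtypeVal
  refine ⟨o, ho, le_antisymm (topologicalKrullDim_le_of_dimLE hi ?_)
    (le_topologicalKrullDim_of_isPolyImage hi ?_ ?_)⟩
  · rwa [range_orbit hQ]
  · rw [range_orbit hQ]
    exact (isPolyImage_of_isClosed (isClosed_specialIsom 0)).image (isPolyMap_conj hQ x.1)
  · rwa [range_orbit hQ]

variable (hV : Odd (finrank ℂ V))
include hV

/-- There are finitely many orbits, so that a union of orbits has the dimension of one of them. -/
theorem dimLE_of_le_finrank_skewCent {c d : ℕ} (hcd : finrank ℂ (skewCent (form Q) 0) ≤ d + c) :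
    DimLE {x : End ℂ V | (x ∈ gOne Q ∧ IsNilpotent x) ∧ c ≤ finrank ℂ (skewCent (form Q) x)} d := by
  let S : Set (End ℂ V) := {x | (x ∈ gOne Q ∧ IsNilpotent x) ∧ c ≤ finrank ℂ (skewCent (form Q) x)}
  have h1 : S ⊆ ⋃ l ∈ (Set.univ : Set (Σ s : Fin (finrank ℂ V + 1), Fin s → Fin (finrank ℂ V + 1))),
      {x | x ∈ S ∧ HasJordanType x fun i => (l.2 i : ℕ)} := fun x hx => by
    obtain ⟨s, lam, h⟩ := exists_hasJordanType hx.1.2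
    exact Set.mem_biUnion (Set.mem_univ (⟨s, lam⟩ : Σ s : Fin (finrank ℂ V + 1),
      Fin s → Fin (finrank ℂ V + 1))) ⟨hx, h⟩
  refine (DimLE.biUnion (Set.toFinite _) fun l _ => ?_).mono h1
  rcases Set.eq_empty_or_nonempty {x | x ∈ S ∧ HasJordanType x fun i => (l.2 i : ℕ)} with h0 | h0
  · rw [h0]
    exact dimLE_empty
  · obtain ⟨x, hx, hxl⟩ := h0
    obtain ⟨o, ho, -, h2⟩ := exists_dim_orbitSet hQ x
    have hc := hx.2
    refine (h2.mono ?_).le (show o ≤ d by omega)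
    rintro y ⟨hy, hyl⟩
    obtain ⟨g, hg, hgx⟩ := hxl.exists_conj hyl
    obtain ⟨k, hk, hky⟩ := exists_specialIsom_conj hQ form_symm hV ((adj_eq_iff hQ).2 hx.1.1.2)
      ((adj_eq_iff hQ).2 hy.1.1.2) hg hgx
    exact ⟨k, hk, hky.symm⟩

/-- A union of orbits of codimension at least `c` has codimension at least `c`. -/
theorem topologicalKrullDim_locus_le {S : Set (NilCone Q)} {c d : ℕ}
    (hS : ∀ x ∈ S, c ≤ finrank ℂ (skewCent (form Q) x.1))
    (hcd : finrank ℂ (skewCent (form Q) 0) ≤ d + c) : topologicalKrullDim S ≤ d := by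
  have hi : @IsInducing S (End ℂ V) _ (zariski (End ℂ V)) (fun z => z.1.1) := by
    let _ := zariski (End ℂ V)
    exact isInducing_nilCone.comp IsInducing.subtypeVal
  refine topologicalKrullDim_le_of_dimLE hi ((dimLE_of_le_finrank_skewCent hQ hV hcd).mono ?_)
  rintro _ ⟨z, rfl⟩
  exact ⟨z.1.2, hS z.1 z.2⟩

/-- The orbit of the regular nilpotent endomorphism has the dimension of `K`. -/
theorem topologicalKrullDim_nilCone :
    topologicalKrullDim (NilCone Q) = finrank ℂ (skewCent (form Q) 0) := by
  refine le_antisymm ?_ ?_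
  · refine topologicalKrullDim_le_of_dimLE isInducing_nilCone
      ((dimLE_of_le_finrank_skewCent hQ hV (c := 0) le_rfl).mono ?_)
    rintro _ ⟨z, rfl⟩
    exact ⟨z.2, Nat.zero_le _⟩
  · obtain ⟨x, hx, hj, hz⟩ := exists_regular_nilpotent hQ form_symm
    have hn : IsNilpotent x := ⟨_, hj.pow_finrank_eq_zero⟩
    obtain ⟨o, ho, ho'⟩ := topologicalKrullDim_orbit hQ
      ⟨x, ⟨(LinearMap.isNilpotent_trace_of_isNilpotent hn).eq_zero, hx⟩, hn⟩
    change o + finrank ℂ (skewCent (form Q) x) = _ at ho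
    rw [hz, finrank_bot, add_zero] at ho
    rw [← ho, ← ho']
    exact topologicalKrullDim_subspace_le _ _

end Dimensions

section Fibres

variable {V : Type*} [AddCommGroup V] [Module ℂ V] [FiniteDimensional ℂ V] {Q : QuadraticForm ℂ V}
  (hQ : (form Q).Nondegenerate) {F : CompleteFlag V} (hF : F.borel.map (theta Q hQ) = F.borel) {n : ℕ}
  (hV : finrank ℂ V = 2 * n + 1) (x : NilCone Q)

include hQ in
theorem excess_blockCount : excess (blockCount x.1) (finrank ℂ V) =
    2 * finrank ℂ (skewCent (form Q) x.1) := by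
  obtain ⟨s, lam, h⟩ := exists_hasJordanType x.2.2
  have h1 := two_mul_finrank_skewCent hQ form_symm x.2.1.2 h
  have h2 : (2 * finrank ℂ (skewCent (form Q) x.1) : ℤ) =
      ((2 * finrank ℂ (skewCent (form Q) x.1) : ℕ) : ℤ) := by push_cast; rfl
  rw [h2, h1, Nat.cast_sum]
  refine Finset.sum_congr rfl fun j _ => ?_
  rcases Nat.eq_zero_or_pos (blockCount x.1 j) with h3 | h3
  · simp [h3]
  · rw [Nat.cast_mul, Nat.cast_sub h3, Nat.cast_one]

theorem two_mul_mul_succ (n : ℕ) : (2 * n * (n + 1) : ℤ) = 4 * (n * (n + 1) / 2 : ℕ) := by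
  have h1 : n * (n + 1) / 2 * 2 = n * (n + 1) :=
    Nat.div_mul_cancel (Nat.even_mul_succ_self n).two_dvd
  have h2 : (2 * n * (n + 1) : ℤ) = 2 * ((n * (n + 1) : ℕ) : ℤ) := by push_cast; ring
  omega

include hF hV

/-- Twice the dimension of the fibre over `x` is at most the codimension of the orbit of `x`. -/
theorem two_mul_le_finrank_skewCent {k : ℕ} (hk : k ≤ topologicalKrullDim (resolution Q F ⁻¹' {x})) :
    2 * k ≤ finrank ℂ (skewCent (form Q) x.1) := by
  rcases topologicalKrullDim_fibre hQ x hF hV with ⟨-, h1⟩ | ⟨d, h1, h2, -⟩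
  · rw [h1, le_bot_iff] at hk
    exact absurd hk (WithBot.natCast_ne_bot k)
  · rw [h1, Nat.cast_le] at hk
    have h3 := (four_mul_le_of_dimGE_frames _ n hQ form_symm x.2.1.2 (pow_finrank_eq_zero x.2.2) hV _ h2).1
    rw [excess_blockCount hQ] at h3
    have h5 := two_mul_mul_succ n
    omega

/-- The bound for the dimension of the fibre is attained exactly when the block counts are paired. -/
theorem exists_eq_iff_isPaired : (∃ d : ℕ, topologicalKrullDim (resolution Q F ⁻¹' {x}) = d ∧
    2 * d = finrank ℂ (skewCent (form Q) x.1)) ↔ IsPaired (blockCount x.1) := by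
  have h5 := two_mul_mul_succ n
  constructor
  · rintro ⟨d, hd, hd'⟩
    rcases topologicalKrullDim_fibre hQ x hF hV with ⟨-, h1⟩ | ⟨e, h1, h2, -⟩
    · rw [hd] at h1
      exact absurd h1 (WithBot.natCast_ne_bot d)
    · rw [hd, Nat.cast_inj] at h1
      subst h1
      refine (four_mul_le_of_dimGE_frames _ n hQ form_symm x.2.1.2 (pow_finrank_eq_zero x.2.2) hV _ h2).2 ?_
      rw [excess_blockCount hQ, h5, ← hd']
      push_cast
      ring
  · intro hp
    obtain ⟨D, hD, hD'⟩ := exists_dimGE_frames _ n hQ form_symm x.2.1.2 (pow_finrank_eq_zero x.2.2) hV hp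
    rcases topologicalKrullDim_fibre hQ x hF hV with ⟨h1, -⟩ | ⟨d, h1, -, h3⟩
    · rw [h1] at hD
      exact absurd hD.nonempty Set.not_nonempty_empty
    · refine ⟨d, h1, le_antisymm (two_mul_le_finrank_skewCent hQ hF hV x h1.ge) ?_⟩
      have h6 := h3 D hD
      rw [excess_blockCount hQ, h5] at hD'
      omega

end Fibres

end SymResolution

end

open SymResolution
theorem proposition3p1 {V : Type*} [AddCommGroup V] [Module ℂ V] [FiniteDimensional ℂ V]
    (n : ℕ) (hV : Module.finrank ℂ V = 2 * n + 1)
    (Q : QuadraticForm ℂ V) (hQ : (form Q).Nondegenerate)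
    (F : CompleteFlag V) (hF : F.borel.map (theta Q hQ) = F.borel) :
    IsSemismall (resolution Q F) ∧
    ∀ (s : ℕ) (lam : Fin s → ℕ), Antitone lam → ∑ i, lam i = 2 * n + 1 →
      ∀ x : NilCone Q, HasJordanType x.1 lam →
        2 * topologicalKrullDim (resolution Q F ⁻¹' {x}) + topologicalKrullDim (orbit x) ≤
            topologicalKrullDim (NilCone Q) ∧
        (2 * topologicalKrullDim (resolution Q F ⁻¹' {x}) + topologicalKrullDim (orbit x) =
            topologicalKrullDim (NilCone Q) ↔
          ∃ p : Fin s → ℕ, Antitone p ∧ ∑ i, p i = n ∧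
            ∀ i : Fin s, lam i = if (i : ℕ) = 0 then 2 * p i + 1 else 2 * p i) := by
  have hodd : Odd (finrank ℂ V) := ⟨n, hV⟩
  have hN := topologicalKrullDim_nilCone hQ hodd
  have hbot : (2 : WithBot ℕ∞) * ⊥ = ⊥ := WithBot.mul_bot two_ne_zero
  refine ⟨fun k => ?_, fun s lam hl hsum x hx => ?_⟩
  · rw [hN]
    rcases Set.eq_empty_or_nonempty
      {y : NilCone Q | (k : WithBot ℕ∞) ≤ topologicalKrullDim (resolution Q F ⁻¹' {y})} with h0 | ⟨y, hy⟩
    · have : IsEmpty {y : NilCone Q | (k : WithBot ℕ∞) ≤ topologicalKrullDim (resolution Q F ⁻¹' {y})} :=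
        Set.isEmpty_coe_sort.2 h0
      rw [topologicalKrullDim_of_isEmpty, WithBot.add_bot]
      exact bot_le
    · have h1 := two_mul_le_finrank_skewCent hQ hF hV y hy
      obtain ⟨o, ho, -⟩ := topologicalKrullDim_orbit hQ y
      have h2 := topologicalKrullDim_locus_le hQ hodd (c := 2 * k)
        (d := finrank ℂ (skewCent (form Q) 0) - 2 * k)
        (fun y hy => two_mul_le_finrank_skewCent hQ hF hV y hy) (by omega)
      refine (add_le_add_right h2 _).trans ?_
      have h3 : 2 * k + (finrank ℂ (skewCent (form Q) 0) - 2 * k) = finrank ℂ (skewCent (form Q) 0) := by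
        omega
      exact_mod_cast h3.le
  · obtain ⟨o, ho, ho'⟩ := topologicalKrullDim_orbit hQ x
    rw [hN, ho', ← isPaired_iff hl hsum hx.blockCount, ← exists_eq_iff_isPaired hQ hF hV x]
    rcases topologicalKrullDim_fibre hQ x hF hV with ⟨-, h1⟩ | ⟨d, h1, -, -⟩
    · rw [h1, hbot, WithBot.bot_add]
      refine ⟨bot_le, fun h => absurd h.symm (WithBot.natCast_ne_bot _), ?_⟩
      rintro ⟨d, hd, -⟩
      exact absurd hd.symm (WithBot.natCast_ne_bot _)
    · have h2 := two_mul_le_finrank_skewCent hQ hF hV x h1.ge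
      rw [h1]
      refine ⟨?_, fun h => ⟨d, rfl, ?_⟩, ?_⟩
      · exact_mod_cast (show 2 * d + o ≤ finrank ℂ (skewCent (form Q) 0) by omega)
      · have : 2 * d + o = finrank ℂ (skewCent (form Q) 0) := by exact_mod_cast h
        omega
      · rintro ⟨d', hd', h3⟩
        rw [Nat.cast_inj] at hd'
        subst hd'
        exact_mod_cast (show 2 * d + o = finrank ℂ (skewCent (form Q) 0) by omega)
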